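/- **Setting.** There are $N$ players; player $i$ has a local action set $A_i\subset\mathbb R^{d_i}$ and a cost $J_i:\mathbb R^{D}\to\mathbb R$, $D=d_1+\dots+d_N$. Joint actions $a=(a^1,\dots,a^N)\in A=A_1\times\dots\times A_N$ are subject to the coupling constraint $g(a)\le 0$ (coordinatewise), $g:\mathbb R^{D}\to\mathbb R^n$. Let $Q=\{a\in A: g(a)\le 0\}$, let $M(a)=(\nabla_{a^i}J_i(a))_{i\le N}$ be the game mapping, and let $M^0(a,\lambda)=\big(M^0_1(a,\lambda),\dots,M^0_N(a,\lambda),-g(a)\big)$, $M^0_i(a,\lambda)=\nabla_{a^i}J_i(a)+\nabla_{a^i}(\lambda,g(a))$, be the extended game mapping. A generalized Nash equilibrium (GNE) is a point $a\in Q$ such that $J_i(a)\le J_i(y,a^{-i})$ for all $i$ and all $y\in A_i$ with $g(y,a^{-i})\le 0$; a variational equilibrium is an $a\in Q$ with $(M(a),b-a)\ge 0$ for all $b\in Q$. **Assumptions on the game.** 1. Each $A_i$ is convex and compact, each $J_i$ is $C^1$ on $\mathbb R^{D}$ and convex in $a^i$ for fixed $a^{-i}$; $g$ is $C^1$ with convex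 coordinates. 2. For each $i\le N$ there is an affine function $L_i$ of $\lambda$ with $\|M^0_i(a,\lambda)-M^0_i(b,\lambda)\|\le L_i(\lambda)\|a-b\|$ for all $a,b\in\mathbb R^{D}$, $\lambda\in\mathbb R^n_+$; $g$ is Lipschitz on $\mathbb R^{D}$; and $M^0$ is pseudo-monotone over $Q\times\mathbb R^n_+$, i.e. $(M^0(y),x-y)\ge 0$ implies $(M^0(x),x-y)\ge 0$ for $x,y\in Q\times\mathbb R^n_+$. 3. (Slater) There is $a\in A$ with $g_j(a)<0$ for all $j\le n$. 4. Each $J_i$ grows at most quadratically in $a^i$, with coefficients of at most polynomial growth in the other actions: $|J_i(a)|\le C(1+\|a^i\|^2)(1+\|a^{-i}\|)^p$ for some $C,p$ and all $a\in\mathbb R^{D}$. 5. There is a strictly convex potential $f:\mathbb R^{D}\to\mathbb R$ with $\nabla f=M$. **Algorithm.** Fix arbitrary initial vectors $\mu(0)\in\mathbb R^{D}$, $\lambda(0)\in\mathbb R^n$. At each time $t\ge0$, given the past, the states $x^i(t)$, $i\le N$, are independent with $x^i(t)\sim\mathcal N(\mu^i(t),\sigma_i(t)^2 I_{d_i})$,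 and $$\mu^i(t+1)=\mathrm{Proj}_{A_i}\Big[\mu^i(t)-\gamma_i(t+1)\sigma_i^2(t+1)\,\hat J^0_i(t)\,\frac{x^i(t)-\mu^i(t)}{\sigma_i^2(t)}\Big],\qquad \hat J^0_i(t)=J_i(x(t))+(\lambda(t),g(x(t))),$$ $$\lambda(t+1)=\mathrm{Proj}_{\mathbb R^n_+}\big[\lambda(t)+\beta_0(t+1)\,g(x(t))\big].$$ **Parameters.** $\gamma_i(t)\ge0$, $\beta_0(t)\ge 0$, $\sigma_i(t)>0$. Put $\beta_i=\gamma_i\sigma_i^2$ for $i\le N$, let $\beta_{\min}(t),\beta_{\max}(t)$ be the minimum and maximum of $\beta_0(t),\dots,\beta_N(t)$, and let $\gamma_{\max}(t),\sigma_{\max}(t)$ be the maxima of the $\gamma_i(t)$ and of the $\sigma_i(t)$ over $i\le N$. Assume $$\sum_t\beta_{\min}(t)=\infty,\quad \sum_t\big(\beta_{\max}(t)-\beta_{\min}(t)\big)<\infty,\quad \sum_t\gamma_{\max}^2(t)<\infty,\quad \sum_t\gamma_{\max}(t)\sigma_{\max}^3(t)<\infty,$$ and that the $\sigma_i$ are nonincreasing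 up to a constant factor: for some $C$, $\sigma_i(t)\le C\sigma_i(s)$ for all $i$ and all $s\le t$. **Theorem.** The game has exactly one variational equilibrium $a^*$, and $a^*$ is a generalized Nash equilibrium. For all parameters and initial vectors as above, as $t\to\infty$ the means $\mu(t)$ converge to $a^*$ almost surely, and the joint states $x(t)$ converge to $a^*$ in probability. -/

import Mathlib

open MeasureTheory ProbabilityTheory Filter Topology

noncomputable section

/-- The action space `ℝ^{d i}` of player `i`. -/
abbrev ActionSpace {N : ℕ} (d : Fin N → ℕ) (i : Fin N) : Type := EuclideanSpace ℝ (Fin (d i))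

/-- The space of joint actions, the Euclidean product of the action spaces. -/
abbrev JointSpace {N : ℕ} (d : Fin N → ℕ) : Type := PiLp 2 (fun i : Fin N => ActionSpace d i)

/-- The space of pairs (joint action, dual multiplier), with its Euclidean structure. -/
abbrev ExtendedSpace {N : ℕ} (d : Fin N → ℕ) (n : ℕ) : Type :=
  WithLp 2 (JointSpace d × EuclideanSpace ℝ (Fin n))

/-- The joint action in which player `i` plays `y` and the others play as in `a`. -/
def deviate {N : ℕ} {d : Fin N → ℕ} (a : JointSpace d) (i : Fin N) (y : ActionSpace d i) :
    JointSpace d :=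
  WithLp.toLp 2 (Function.update a.ofLp i y)

/-- The nonnegative orthant of `ℝ^n`. -/
def nonnegOrthant (n : ℕ) : Set (EuclideanSpace ℝ (Fin n)) := {l | ∀ j, 0 ≤ l j}

/-- `p` is the Euclidean projection of `x` on `K`, that is, a point of `K` nearest to `x`
(it is unique when `K` is convex, and exists when `K` is moreover closed and nonempty). -/
def IsProjection {E : Type*} [NormedAddCommGroup E] (K : Set E) (x p : E) : Prop :=
  p ∈ K ∧ ∀ y ∈ K, ‖x - p‖ ≤ ‖x - y‖

/-- Pseudo-monotonicity of the mapping `T` over the set `X`. -/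
def PseudoMonotoneOn {E : Type*} [NormedAddCommGroup E] [InnerProductSpace ℝ E]
    (T : E → E) (X : Set E) : Prop :=
  ∀ x ∈ X, ∀ y ∈ X, 0 ≤ inner ℝ (T y) (x - y) → 0 ≤ inner ℝ (T x) (x - y)

/-- The solution set of the variational inequality problem `VI(Y, T)`. -/
def variationalSolutions {E : Type*} [NormedAddCommGroup E] [InnerProductSpace ℝ E]
    (Y : Set E) (T : E → E) : Set E :=
  {y | y ∈ Y ∧ ∀ z ∈ Y, 0 ≤ inner ℝ (T y) (z - y)}

/-- A game with `N` players, where player `i` has actions in `ℝ^{d i}`, local action set `A i` and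
cost function `J i`, and the joint action `a` is subject to the coupling constraints
`g a ≤ 0` in `ℝ^n`. -/
structure CoupledGame (N n : ℕ) (d : Fin N → ℕ) where
  /-- the local action sets -/
  A : (i : Fin N) → Set (ActionSpace d i)
  /-- the cost functions -/
  J : Fin N → JointSpace d → ℝ
  /-- the coupling constraint function -/
  g : JointSpace d → EuclideanSpace ℝ (Fin n)

namespace CoupledGame

variable {N n : ℕ} {d : Fin N → ℕ} (G : CoupledGame N n d)

/-- The product of the local action sets. -/
def jointActions : Set (JointSpace d) := {a | ∀ i, a i ∈ G.A i}

/-- The set `Q` of joint actions that satisfy the local and the coupling constraints. -/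
def feasible : Set (JointSpace d) := {a | a ∈ G.jointActions ∧ ∀ j, G.g a j ≤ 0}

/-- Generalized Nash equilibria: feasible joint actions from which no player can gain by a
unilateral deviation that respects his local constraint and the coupling constraint. -/
def IsGNE (a : JointSpace d) : Prop :=
  a ∈ G.feasible ∧ ∀ (i : Fin N) (y : ActionSpace d i), y ∈ G.A i →
    (∀ j, G.g (deviate a i y) j ≤ 0) → G.J i a ≤ G.J i (deviate a i y)

/-- The game mapping: its block `i` is the gradient of `J i` in the action of player `i`. -/
def gameMap (a : JointSpace d) : JointSpace d :=
  WithLp.toLp 2 (fun i => gradient (G.J i) a i)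

/-- Block `i` of the extended game mapping, for a regular player `i`: the gradient of
`J i + (l, g)` in the action of player `i`. -/
def extendedBlock (i : Fin N) (a : JointSpace d) (l : EuclideanSpace ℝ (Fin n)) :
    ActionSpace d i :=
  G.gameMap a i + gradient (fun b => inner ℝ l (G.g b)) a i

/-- The extended game mapping; the block of the dual player is `-g`. -/
def extendedMap (η : ExtendedSpace d n) : ExtendedSpace d n :=
  WithLp.toLp 2 (WithLp.toLp 2 (fun i => G.extendedBlock i η.fst η.snd), - G.g η.fst)

/-- The cost of a regular player `i` in the associated game with the dual player. -/
def extendedCost (i : Fin N) (a : JointSpace d) (l : EuclideanSpace ℝ (Fin n)) : ℝ :=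
  G.J i a + inner ℝ l (G.g a)

/-- Variational (generalized Nash) equilibria: the solutions of `VI(Q, M)`, with `M` the game
mapping. -/
def variationalEquilibria : Set (JointSpace d) := variationalSolutions G.feasible G.gameMap

/-- Convexity and smoothness of the game. -/
structure IsConvexGame : Prop where
  convex_A : ∀ i, Convex ℝ (G.A i)
  compact_A : ∀ i, IsCompact (G.A i)
  contDiff_J : ∀ i, ContDiff ℝ 1 (G.J i)
  convex_J : ∀ (i : Fin N) (a : JointSpace d),
    ConvexOn ℝ Set.univ (fun y : ActionSpace d i => G.J i (deviate a i y))
  contDiff_g : ContDiff ℝ 1 G.g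
  convex_g : ∀ j, ConvexOn ℝ Set.univ (fun a => G.g a j)

/-- Regularity of the extended game mapping: its regular blocks are Lipschitz in the joint action,
with a constant that is an affine function of the multiplier; the coupling constraint function is
Lipschitz; the extended game mapping is pseudo-monotone over `Q × ℝ^n_+`. -/
structure IsRegular : Prop where
  lipschitz_block : ∀ i, ∃ L : EuclideanSpace ℝ (Fin n) →ᵃ[ℝ] ℝ, ∀ l ∈ nonnegOrthant n,
    ∀ a b, ‖G.extendedBlock i a l - G.extendedBlock i b l‖ ≤ L l * ‖a - b‖
  lipschitz_g : ∃ K, LipschitzWith K G.g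
  pseudoMonotone : PseudoMonotoneOn G.extendedMap
    {η | η.fst ∈ G.feasible ∧ η.snd ∈ nonnegOrthant n}

/-- Slater's condition: some joint action in the local action sets satisfies all the coupling
constraints strictly. -/
def Slater : Prop := ∃ a ∈ G.jointActions, ∀ j, G.g a j < 0

/-- Each cost function grows at most quadratically in the player's own action, with coefficients
of at most polynomial growth in the actions of the other players. -/
def HasQuadraticGrowth : Prop :=
  ∀ i, ∃ (C : ℝ) (p : ℕ), ∀ a : JointSpace d,
    |G.J i a| ≤ C * (1 + ‖a i‖ ^ 2) * (1 + ‖deviate a i 0‖) ^ p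

/-- The game admits a strictly convex potential. -/
def HasStrictlyConvexPotential : Prop :=
  ∃ f : JointSpace d → ℝ, StrictConvexOn ℝ Set.univ f ∧ ∀ a, HasGradientAt f (G.gameMap a) a

end CoupledGame

/-- The parameters of the algorithm: the step sizes `γ i` and the standard deviations `σ i` of the
regular players, and the step sizes `β₀` of the dual player. -/
structure AlgorithmParameters (N : ℕ) where
  γ : Fin N → ℕ → ℝ
  σ : Fin N → ℕ → ℝ
  β₀ : ℕ → ℝ

namespace AlgorithmParameters

variable {N : ℕ} (S : AlgorithmParameters N)

/-- The effective step sizes: `γ i * σ i ^ 2` for a regular player, `β₀` for the dual player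
(indexed by `none`). -/
def β : Option (Fin N) → ℕ → ℝ
  | none, t => S.β₀ t
  | some i, t => S.γ i t * S.σ i t ^ 2

def βmin (t : ℕ) : ℝ := ⨅ k, S.β k t

def βmax (t : ℕ) : ℝ := ⨆ k, S.β k t

def γmax (t : ℕ) : ℝ := ⨆ i, S.γ i t

def σmax (t : ℕ) : ℝ := ⨆ i, S.σ i t

/-- The conditions on the parameters. -/
structure Admissible : Prop where
  γ_nonneg : ∀ i t, 0 ≤ S.γ i t
  σ_pos : ∀ i t, 0 < S.σ i t
  β₀_nonneg : ∀ t, 0 ≤ S.β₀ t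
  /-- the standard deviations are nonincreasing, up to a constant factor -/
  σ_almost_antitone : ∃ C : ℝ, ∀ i s t, s ≤ t → S.σ i t ≤ C * S.σ i s
  sum_βmin : Tendsto (fun T => ∑ t ∈ Finset.range T, S.βmin t) atTop atTop
  sum_diff : Summable (fun t => S.βmax t - S.βmin t)
  sum_γ_sq : Summable (fun t => S.γmax t ^ 2)
  sum_γ_σ_cube : Summable (fun t => S.γmax t * S.σmax t ^ 3)

end AlgorithmParameters

/-- The law of the joint state when the players independently choose their states according to the
normal distributions with means `m i` and covariance matrices `s i ^ 2 • 1`. -/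
def stateLaw {N : ℕ} {d : Fin N → ℕ} (m : JointSpace d) (s : Fin N → ℝ) :
    Measure (JointSpace d) :=
  (Measure.pi (fun i => multivariateGaussian (m i)
    (s i ^ 2 • (1 : Matrix (Fin (d i)) (Fin (d i)) ℝ)))).map (WithLp.toLp 2)

/-- `(μ, l, x)` is a run of the payoff-based algorithm for the game `G`, with parameters `S` and
initial vectors `μ₀`, `l₀`: here `μ t` are the means, `l t` the dual multiplier and `x t` the joint
state at time `t`, and `ℱ` is a filtration for which the means and the multiplier are adapted. -/
structure IsPayoffBasedRun {N n : ℕ} {d : Fin N → ℕ} (G : CoupledGame N n d)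
    (S : AlgorithmParameters N) (μ₀ : JointSpace d) (l₀ : EuclideanSpace ℝ (Fin n))
    {Ω : Type*} {mΩ : MeasurableSpace Ω} (P : Measure Ω) (ℱ : Filtration ℕ mΩ)
    (μ : ℕ → Ω → JointSpace d) (l : ℕ → Ω → EuclideanSpace ℝ (Fin n))
    (x : ℕ → Ω → JointSpace d) : Prop where
  measurable_x : ∀ t, Measurable (x t)
  measurable_μ : ∀ t, Measurable[ℱ t] (μ t)
  measurable_l : ∀ t, Measurable[ℱ t] (l t)
  init_μ : ∀ ω, μ 0 ω = μ₀
  init_l : ∀ ω, l 0 ω = l₀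
  /-- given the past, the states are independent and normal around the current means -/
  condLaw_x : ∀ (t : ℕ) (B : Set (JointSpace d)), MeasurableSet B →
    P⟦x t ⁻¹' B | ℱ t⟧ =ᵐ[P] fun ω => (stateLaw (μ t ω) (fun i => S.σ i t)).real B
  /-- the projected one-point payoff update of the means -/
  update_μ : ∀ t ω i, IsProjection (G.A i)
    (μ t ω i - (S.γ i (t + 1) * S.σ i (t + 1) ^ 2 * G.extendedCost i (x t ω) (l t ω)) •
      ((S.σ i t ^ 2)⁻¹ • (x t ω i - μ t ω i)))
    (μ (t + 1) ω i)
  /-- the projected ascent of the dual player on the observed constraint values -/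
  update_l : ∀ t ω, IsProjection (nonnegOrthant n)
    (l t ω + S.β₀ (t + 1) • G.g (x t ω)) (l (t + 1) ω)

end

/-! The equilibrium side is convex optimization. Since the game map is the gradient of a strictly
convex `f`, the variational equilibrium is the minimizer `a` of `f` on `Q`, and Slater's condition
supplies a multiplier `ls` (`exists_multiplier`). The Lagrangian gap `D b = f b + ⟨ls, g b⟩ - f a`
is nonnegative on the product of the action sets and vanishes there only at `a`. The tangent
inequalities for `f` and `⟨l, g⟩` show that the extended game map, paired with the displacement from
`(a, ls)`, is at least `D`, whatever the multiplier `l` in the orthant (`exists_equilibrium_merit`).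

The stochastic side writes the states as `x = μ + σ ξ` with `ξ` standard Gaussian and independent of
the past. For a given multiplier, the one-point estimate has conditional mean within `O(σ)` of the
true block (`exists_gradientEstimate_bias_le`). Nothing is differentiated under an integral: the
cost with block `i` frozen drops out by symmetry of `ξ i`, the linear part reproduces the block
exactly, and the Lipschitz condition controls the remainder. The estimate has size `1/σ`, so the
squared step is of order `γ²`, up to the weight `1 + ‖l‖²`. Hence `V = ‖μ - a‖² + ‖l - ls‖²`
satisfies `E[V⁺ | past] ≤ (1 + C e) V + C e - 2 βmin D(μ)` with `e` summable (`exists_drift_le`,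
`exists_isStepBound`). The spread `βmax - βmin` enters `e` because primal and dual terms combine
into `D` only when they carry the same step size.

By `robbinsSiegmund`, almost surely `V` is bounded and `∑ βmin D(μ)` is finite. This only brings `μ`
near `a` at some late times, since `V` may stay positive through the multiplier. The rest comes from
`u = ‖μ - a‖²`: on a path with bounded multipliers its drift is at most of order `βmin + e`, and its
martingale part converges because its mean square increments are summable
(`exists_tendsto_sum_sub_condExp`). So `u` cannot climb from near `0` to a fixed level without
spending a fixed amount of `βmin` away from `0`, where the total `βmin` is finite
(`tendsto_zero_of_summable_of_drift`). Finally `σ → 0` carries the limit from the means to the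
states. -/

noncomputable section

/-! ### Blockwise scaling and unilateral deviations -/

section BlockScale

variable {N : ℕ} {d : Fin N → ℕ}

/-- Multiplication of each block of a joint action by its own factor. -/
def blockScale (s : Fin N → ℝ) (ξ : JointSpace d) : JointSpace d :=
  WithLp.toLp 2 (fun i => s i • ξ i)

@[simp] lemma blockScale_apply (s : Fin N → ℝ) (ξ : JointSpace d) (i : Fin N) :
    blockScale s ξ i = s i • ξ i := rfl

lemma continuous_blockScale (s : Fin N → ℝ) :
    Continuous (blockScale s : JointSpace d → JointSpace d) := by
  unfold blockScale; fun_prop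

@[fun_prop]
lemma measurable_blockScale (s : Fin N → ℝ) :
    Measurable (blockScale s : JointSpace d → JointSpace d) :=
  (continuous_blockScale s).measurable

lemma norm_blockScale_le {s : Fin N → ℝ} {S : ℝ} (h0 : ∀ i, 0 ≤ s i) (hS : ∀ i, s i ≤ S)
    (hSn : 0 ≤ S) (ξ : JointSpace d) : ‖blockScale s ξ‖ ≤ S * ‖ξ‖ := by
  refine abs_le_of_sq_le_sq' ?_ (by positivity) |>.2
  rw [mul_pow, PiLp.norm_sq_eq_of_L2, PiLp.norm_sq_eq_of_L2, Finset.mul_sum]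
  refine Finset.sum_le_sum fun i _ => ?_
  rw [blockScale_apply, norm_smul, mul_pow, Real.norm_of_nonneg (h0 i)]
  have := h0 i
  have := hS i
  gcongr

lemma blockScale_blockScale_inv {s : Fin N → ℝ} (hs : ∀ i, s i ≠ 0) (ξ : JointSpace d) :
    blockScale s (blockScale (fun i => (s i)⁻¹) ξ) = ξ := by
  ext1 i
  simp [blockScale, smul_smul, hs i]

lemma blockScale_inv_blockScale {s : Fin N → ℝ} (hs : ∀ i, s i ≠ 0) (ξ : JointSpace d) :
    blockScale (fun i => (s i)⁻¹) (blockScale s ξ) = ξ := by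
  ext1 i
  simp [blockScale, smul_smul, hs i]

@[simp] lemma deviate_apply_self (a : JointSpace d) (i : Fin N) (y : ActionSpace d i) :
    deviate a i y i = y := by simp [deviate]

lemma deviate_apply_of_ne (a : JointSpace d) {i j : Fin N} (h : j ≠ i) (y : ActionSpace d i) :
    deviate a i y j = a j := by simp [deviate, h]

@[simp] lemma deviate_self (a : JointSpace d) (i : Fin N) : deviate a i (a i) = a := by
  ext1; simp [deviate]

lemma norm_deviate_sub_le (a m : JointSpace d) (i : Fin N) (y : ActionSpace d i)
    (h : ‖y - m i‖ ≤ ‖a i - m i‖) : ‖deviate a i y - m‖ ≤ ‖a - m‖ := by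
  refine abs_le_of_sq_le_sq' ?_ (norm_nonneg _) |>.2
  rw [PiLp.norm_sq_eq_of_L2, PiLp.norm_sq_eq_of_L2]
  refine Finset.sum_le_sum fun j _ => ?_
  by_cases hj : j = i
  · subst hj
    simp only [PiLp.sub_apply, deviate_apply_self]
    gcongr
  · simp [deviate_apply_of_ne a hj]

lemma norm_deviate_zero_le (a : JointSpace d) (i : Fin N) : ‖deviate a i 0‖ ≤ ‖a‖ := by
  simpa using norm_deviate_sub_le a 0 i 0 (by simp)

end BlockScale

/-! ### The state law as an affine image of a standard Gaussian -/

section Gaussian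

variable {N : ℕ} {d : Fin N → ℕ}

lemma pi_stdGaussian_map_toLp :
    (Measure.pi (fun i : Fin N => stdGaussian (ActionSpace d i))).map (WithLp.toLp 2) =
      stdGaussian (JointSpace d) := by
  apply Measure.ext_of_charFun
  ext t
  rw [charFun_pi, charFun_stdGaussian]
  simp_rw [charFun_stdGaussian]
  rw [← Complex.exp_sum, ← Complex.ofReal_pow, PiLp.norm_sq_eq_of_L2]
  simp [Finset.sum_div, neg_div]

lemma multivariateGaussian_sq_smul_one {ι : Type*} [Fintype ι] [DecidableEq ι]
    (m : EuclideanSpace ℝ ι) {s : ℝ} (hs : 0 ≤ s) :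
    multivariateGaussian m (s ^ 2 • (1 : Matrix ι ι ℝ)) =
      (stdGaussian (EuclideanSpace ℝ ι)).map (fun ξ => m + s • ξ) := by
  have hpsd : (s ^ 2 • (1 : Matrix ι ι ℝ)).PosSemidef := Matrix.PosSemidef.one.smul (sq_nonneg s)
  apply Measure.ext_of_charFun
  ext t
  have h1 : (fun ξ : EuclideanSpace ℝ ι => m + s • ξ) = (fun x => x + m) ∘ (fun ξ => s • ξ) := by
    ext; simp [add_comm]
  rw [charFun_multivariateGaussian hpsd, h1, ← Measure.map_map (by fun_prop) (by fun_prop),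
    charFun_map_add_const, charFun_map_smul, charFun_stdGaussian, ← Complex.exp_add]
  congr 1
  have h2 : ‖s • t‖ ^ 2 = t.ofLp ⬝ᵥ Matrix.mulVec (s ^ 2 • (1 : Matrix ι ι ℝ)) t.ofLp := by
    rw [norm_smul, mul_pow, Real.norm_of_nonneg hs, EuclideanSpace.real_norm_sq_eq,
      Matrix.smul_mulVec, Matrix.one_mulVec, dotProduct_smul, dotProduct, smul_eq_mul]
    simp [sq]
  rw [← Complex.ofReal_pow, h2, real_inner_comm]
  push_cast
  ring

/-- Separates the noise, whose law is fixed, from the means and deviations, which enter only through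
an affine map. All later expectations are integrals against this one Gaussian. -/
lemma stateLaw_eq_map_stdGaussian (m : JointSpace d) {s : Fin N → ℝ} (hs : ∀ i, 0 ≤ s i) :
    stateLaw m s = (stdGaussian (JointSpace d)).map (fun ξ => m + blockScale s ξ) := by
  have h1 : ∀ i, IsProbabilityMeasure ((stdGaussian (ActionSpace d i)).map
      (fun ξ => m i + s i • ξ)) := fun i => Measure.isProbabilityMeasure_map (by fun_prop)
  rw [stateLaw]
  simp_rw [fun i => multivariateGaussian_sq_smul_one (m i) (hs i)]
  rw [← Measure.pi_map_pi (fun i => by fun_prop), ← pi_stdGaussian_map_toLp,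
    Measure.map_map (by fun_prop) (by fun_prop), Measure.map_map (by fun_prop) (by fun_prop)]
  congr 1

end Gaussian

/-! ### Moments of the standard Gaussian -/

section StdGaussian

variable {E : Type*} [NormedAddCommGroup E] [InnerProductSpace ℝ E] [FiniteDimensional ℝ E]
  [MeasurableSpace E] [BorelSpace E]

lemma integrable_one_add_norm_pow (q : ℕ) :
    Integrable (fun ξ : E => (1 + ‖ξ‖) ^ q) (stdGaussian E) := by
  have hid : MemLp (fun ξ : E => ‖ξ‖) q (stdGaussian E) :=
    (IsGaussian.memLp_id (stdGaussian E) q (by simp)).norm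
  have h : MemLp (fun ξ : E => 1 + ‖ξ‖) q (stdGaussian E) := (memLp_const (1 : ℝ)).add hid
  refine (h.integrable_norm_pow').congr (Eventually.of_forall fun ξ => ?_)
  simp only
  rw [Real.norm_of_nonneg (by positivity)]

/-- The moment `∫ (1 + ‖ξ‖) ^ q` of the standard Gaussian distribution. -/
def gaussianMoment (E : Type*) [NormedAddCommGroup E] [InnerProductSpace ℝ E]
    [FiniteDimensional ℝ E] [MeasurableSpace E] [BorelSpace E] (q : ℕ) : ℝ :=
  ∫ ξ : E, (1 + ‖ξ‖) ^ q ∂stdGaussian E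

lemma gaussianMoment_nonneg (q : ℕ) : 0 ≤ gaussianMoment E q :=
  integral_nonneg fun ξ => by positivity

lemma integrable_of_norm_le_pow {F : Type*} [NormedAddCommGroup F] {f : E → F} {C : ℝ} {q : ℕ}
    (hf : AEStronglyMeasurable f (stdGaussian E)) (h : ∀ ξ, ‖f ξ‖ ≤ C * (1 + ‖ξ‖) ^ q) :
    Integrable f (stdGaussian E) :=
  ((integrable_one_add_norm_pow q).const_mul C).mono' hf (Eventually.of_forall h)

lemma abs_integral_le_mul_gaussianMoment {f : E → ℝ} {C : ℝ} {q : ℕ}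
    (h : ∀ ξ, |f ξ| ≤ C * (1 + ‖ξ‖) ^ q) :
    |∫ ξ, f ξ ∂stdGaussian E| ≤ C * gaussianMoment E q := by
  rw [gaussianMoment, ← integral_const_mul, ← Real.norm_eq_abs]
  exact norm_integral_le_of_norm_le ((integrable_one_add_norm_pow q).const_mul C)
    (Eventually.of_forall fun ξ => h ξ)

lemma integral_le_mul_gaussianMoment {f : E → ℝ} {C : ℝ} {q : ℕ}
    (h : ∀ ξ, |f ξ| ≤ C * (1 + ‖ξ‖) ^ q) :
    ∫ ξ, f ξ ∂stdGaussian E ≤ C * gaussianMoment E q :=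
  (le_abs_self _).trans (abs_integral_le_mul_gaussianMoment h)

lemma integral_inner_mul_inner_stdGaussian (a b : E) :
    ∫ ξ, inner ℝ a ξ * inner ℝ b ξ ∂stdGaussian E = inner ℝ a b := by
  have h := covarianceBilin_apply (μ := stdGaussian E) IsGaussian.memLp_two_id a b
  rw [covarianceBilin_stdGaussian] at h
  rw [innerSL_apply_apply] at h
  simpa using h.symm

end StdGaussian

/-! ### Symmetry and covariance of a single Gaussian block -/

section Reflection

variable {N : ℕ} {d : Fin N → ℕ}

/-- The reflection of the joint space that changes the sign of block `i`. -/
def blockReflection (d : Fin N → ℕ) (i : Fin N) : JointSpace d ≃ₗᵢ[ℝ] JointSpace d :=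
  LinearIsometryEquiv.piLpCongrRight 2
    (fun j => if j = i then LinearIsometryEquiv.neg ℝ else LinearIsometryEquiv.refl ℝ _)

lemma blockReflection_apply_self (i : Fin N) (ξ : JointSpace d) :
    blockReflection d i ξ i = - ξ i := by
  simp [blockReflection]

lemma blockReflection_apply_of_ne {i j : Fin N} (h : j ≠ i) (ξ : JointSpace d) :
    blockReflection d i ξ j = ξ j := by
  simp [blockReflection, h]

lemma deviate_blockReflection (i : Fin N) (ξ : JointSpace d) (y : ActionSpace d i) :
    deviate (blockReflection d i ξ) i y = deviate ξ i y := by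
  ext1 j
  by_cases h : j = i
  · subst h; simp
  · simp [deviate_apply_of_ne _ h, blockReflection_apply_of_ne h]

/-- The reflection of block `i` preserves the Gaussian and the first factor but changes the sign of
the second, so the integral equals its own negative. Nothing need be known about `k`. -/
lemma integral_mul_inner_block_eq_zero (i : Fin N) (b : ActionSpace d i) (k : JointSpace d → ℝ) :
    ∫ ξ, k (deviate ξ i 0) * inner ℝ (ξ i) b ∂stdGaussian (JointSpace d) = 0 := by
  have h : ∫ ξ, k (deviate ξ i 0) * inner ℝ (ξ i) b ∂stdGaussian (JointSpace d) =
      - ∫ ξ, k (deviate ξ i 0) * inner ℝ (ξ i) b ∂stdGaussian (JointSpace d) := by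
    conv_lhs => rw [← stdGaussian_map (blockReflection d i)]
    have hemb : MeasurableEmbedding (blockReflection d i) :=
      (blockReflection d i).toHomeomorph.measurableEmbedding
    rw [hemb.integral_map, ← integral_neg]
    congr 1; funext ξ
    rw [deviate_blockReflection, blockReflection_apply_self, inner_neg_left, mul_neg]
  linarith

lemma inner_toLp_single (i : Fin N) (c : ActionSpace d i) (ξ : JointSpace d) :
    inner ℝ (WithLp.toLp 2 (Pi.single i c) : JointSpace d) ξ = inner ℝ c (ξ i) := by
  rw [PiLp.inner_apply, Finset.sum_eq_single i]
  · simp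
  · intro j _ hj; simp [hj]
  · simp

/-- Identity covariance: with the gradient as `a`, the linear part of the cost contributes exactly
the gradient to the mean of the one-point estimate. -/
lemma integral_inner_block_mul_inner_block (i : Fin N) (a b : ActionSpace d i) :
    ∫ ξ, inner ℝ a (ξ i) * inner ℝ (ξ i) b ∂stdGaussian (JointSpace d) = inner ℝ a b := by
  have h := integral_inner_mul_inner_stdGaussian
    (WithLp.toLp 2 (Pi.single i a) : JointSpace d) (WithLp.toLp 2 (Pi.single i b) : JointSpace d)
  simp_rw [inner_toLp_single] at h
  simpa [real_inner_comm b] using h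

end Reflection

/-! ### A deterministic convergence criterion -/

section Deterministic

/-- As `∑ b` diverges while the part of it spent where `u ≥ δ` is finite, `u` is below `δ` at some
late time. From then on an excursion above `δ` starts with one small step and can afterwards grow
only by a tail of the finite part and by an increment of the convergent series of `w`. -/
lemma tendsto_zero_of_summable_of_drift {u b w : ℕ → ℝ} {C : ℝ} (hC : 0 ≤ C)
    (hu : ∀ t, 0 ≤ u t) (hb : ∀ t, 0 ≤ b t)
    (hstep : ∀ t, u (t + 1) ≤ u t + C * b t + w t)
    (hw : ∃ c, Tendsto (fun T => ∑ t ∈ Finset.range T, w t) atTop (𝓝 c))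
    (hb0 : Tendsto b atTop (𝓝 0))
    (hbsum : Tendsto (fun T => ∑ t ∈ Finset.range T, b t) atTop atTop)
    (hlarge : ∀ ε > 0, Summable (fun t => if ε ≤ u t then b t else 0)) :
    Tendsto u atTop (𝓝 0) := by
  rw [Metric.tendsto_atTop]
  intro ε hε
  set δ : ℝ := ε / 8 with hδ
  have hδ0 : 0 < δ := by positivity
  obtain ⟨c, hc⟩ := hw
  set η : ℝ := δ / (C + 1) with hη
  have hη0 : 0 < η := by positivity
  have hCη : C * η ≤ δ := by
    rw [hη, mul_div_assoc', div_le_iff₀ (by positivity)]; nlinarith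
  have hsum := hlarge δ hδ0
  obtain ⟨T₁, hT₁⟩ := Metric.tendsto_atTop.1 hc δ hδ0
  obtain ⟨T₂, hT₂⟩ := Metric.tendsto_atTop.1 hb0 η hη0
  obtain ⟨T₃, hT₃⟩ := Metric.tendsto_atTop.1 hsum.hasSum.tendsto_sum_nat (η / 2) (by positivity)
  set T := max T₁ (max T₂ T₃) with hT
  have hT1 : T₁ ≤ T := le_max_left _ _
  have hT2 : T₂ ≤ T := (le_max_left _ _).trans (le_max_right _ _)
  have hT3 : T₃ ≤ T := (le_max_right _ _).trans (le_max_right _ _)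
  obtain ⟨t₀, ht₀, hut₀⟩ : ∃ t₀, T ≤ t₀ ∧ u t₀ < δ := by
    by_contra! hcon
    have hs : Summable b := by
      rw [← summable_nat_add_iff T] at hsum ⊢
      refine hsum.congr fun t => ?_
      rw [if_pos (hcon _ (by omega))]
    exact not_tendsto_nhds_of_tendsto_atTop hbsum _ hs.hasSum.tendsto_sum_nat
  set q : ℕ → ℝ := fun t => if δ ≤ u t then b t else 0 with hq
  have hq0 : ∀ t, 0 ≤ q t := fun t => by
    simp only [hq]; split_ifs
    · exact hb t
    · exact le_rfl
  refine ⟨t₀, fun t ht => ?_⟩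
  -- For `t > t₀`, `s` is the last time before `t` with `u s < δ`; one `δ` bounds `u s`, the other
  -- the step `C * b s ≤ C * η` leaving that region. The tails of `q` and `w` then add at most `δ +
  -- 2 * δ`, so `u t ≤ 5 * δ < ε`.
  have key : ∃ s, t₀ ≤ s ∧ s ≤ t ∧ u t ≤ 2 * δ +
      C * (∑ r ∈ Finset.range t, q r - ∑ r ∈ Finset.range s, q r) +
      (∑ r ∈ Finset.range t, w r - ∑ r ∈ Finset.range s, w r) := by
    induction t, ht using Nat.le_induction with
    | base => exact ⟨t₀, le_rfl, le_rfl, by simp; linarith⟩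
    | succ t ht ih =>
      obtain ⟨s, hs, hst, hle⟩ := ih
      rcases lt_or_ge (u t) δ with h | h
      · refine ⟨t, ht, t.le_succ, ?_⟩
        have hbt : b t ≤ η := by
          have := hT₂ t (by omega)
          rw [Real.dist_eq, sub_zero] at this
          exact (le_abs_self _).trans this.le
        rw [Finset.sum_range_succ, Finset.sum_range_succ]
        have := hstep t
        have h1 := mul_le_mul_of_nonneg_left hbt hC
        have h2 := mul_nonneg hC (hq0 t)
        ring_nf at *
        linarith
      · refine ⟨s, hs, by omega, ?_⟩
        have hqt : q t = b t := by simp [hq, h]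
        rw [Finset.sum_range_succ, Finset.sum_range_succ, hqt]
        have := hstep t
        ring_nf at *
        linarith
  obtain ⟨s, hs, hst, hle⟩ := key
  have q1 := hT₃ t (by omega)
  have q2 := hT₃ s (by omega)
  have w1 := hT₁ t (by omega)
  have w2 := hT₁ s (by omega)
  rw [Real.dist_eq, abs_lt] at q1 q2 w1 w2
  rw [Real.dist_eq, sub_zero, abs_of_nonneg (hu t)]
  have hQ : ∑ r ∈ Finset.range t, q r - ∑ r ∈ Finset.range s, q r ≤ η := by linarith
  have := mul_le_mul_of_nonneg_left hQ hC
  linarith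

end Deterministic

/-! ### Almost supermartingales and square-summable martingales -/

section Martingale

variable {Ω : Type*} {mΩ : MeasurableSpace Ω} {P : Measure Ω} [IsProbabilityMeasure P]
  {ℱ : Filtration ℕ mΩ}

/-- A form of the Robbins–Siegmund theorem, with deterministic coefficients. -/
theorem robbinsSiegmund {V U : ℕ → Ω → ℝ} {e : ℕ → ℝ}
    (hVm : ∀ t, StronglyMeasurable[ℱ t] (V t)) (hUm : ∀ t, StronglyMeasurable[ℱ t] (U t))
    (hVi : ∀ t, Integrable (V t) P) (hUi : ∀ t, Integrable (U t) P)
    (hV : ∀ t ω, 0 ≤ V t ω) (hU : ∀ t ω, 0 ≤ U t ω) (he : ∀ t, 0 ≤ e t) (hes : Summable e)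
    (hstep : ∀ t, P[V (t + 1) | ℱ t] ≤ᵐ[P] fun ω => (1 + e t) * V t ω + e t - U t ω) :
    (∃ K, ∀ t, ∫ ω, V t ω ∂P ≤ K) ∧ ∀ᵐ ω ∂P, (∃ K, ∀ t, V t ω ≤ K) ∧ Summable (fun t => U t ω) := by
  set p : ℕ → ℝ := fun t => ∏ s ∈ Finset.range t, (1 + e s) with hp
  have hp1 : ∀ t, 1 ≤ p t := fun t => Finset.one_le_prod fun s _ => by linarith [he s]
  have hp0 : ∀ t, 0 < p t := fun t => one_pos.trans_le (hp1 t)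
  have hpsucc : ∀ t, p (t + 1) = p t * (1 + e t) := fun t => Finset.prod_range_succ _ _
  set B : ℝ := Real.exp (∑' t, e t) with hB
  have hpB : ∀ t, p t ≤ B := fun t => by
    calc p t ≤ ∏ s ∈ Finset.range t, Real.exp (e s) :=
          Finset.prod_le_prod (fun s _ => by linarith [he s])
            fun s _ => by rw [add_comm]; exact Real.add_one_le_exp _
      _ = Real.exp (∑ s ∈ Finset.range t, e s) := (Real.exp_sum _ _).symm
      _ ≤ B := Real.exp_le_exp.2 (hes.sum_le_tsum _ fun s _ => he s)
  -- Since `(1 + e) V + e + 1 = (1 + e) (V + 1)`, adding `1` turns the additive error into the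
  -- multiplicative one, and dividing by the product `p` removes it. Adding back the discounted `U`
  -- leaves a nonnegative supermartingale.
  set W : ℕ → Ω → ℝ := fun t ω => (p t)⁻¹ * (V t ω + 1) +
    ∑ s ∈ Finset.range t, (p (s + 1))⁻¹ * U s ω with hW
  have hW0 : ∀ t ω, 0 ≤ W t ω := fun t ω => by
    have := hV t ω
    have := (hp0 t).le
    exact add_nonneg (by positivity) (Finset.sum_nonneg fun s _ =>
      mul_nonneg (inv_nonneg.2 (hp0 _).le) (hU _ _))
  have hSm : ∀ t k, t ≤ k + 1 → StronglyMeasurable[ℱ k]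
      (fun ω => ∑ s ∈ Finset.range t, (p (s + 1))⁻¹ * U s ω) := fun t k htk =>
    Finset.stronglyMeasurable_fun_sum _ fun s hs =>
      ((hUm s).mono (ℱ.mono (by have := Finset.mem_range.1 hs; omega))).const_mul _
  have hSi : ∀ t, Integrable (fun ω => ∑ s ∈ Finset.range t, (p (s + 1))⁻¹ * U s ω) P :=
    fun t => integrable_finsetSum _ fun s _ => (hUi s).const_mul _
  have hWm : StronglyAdapted ℱ W := fun t =>
    (((hVm t).add stronglyMeasurable_const).const_mul _).add (hSm t t (by omega))
  have hWi : ∀ t, Integrable (W t) P := fun t =>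
    (((hVi t).add (integrable_const 1)).const_mul _).add (hSi t)
  have hsup : Supermartingale W ℱ P := by
    refine supermartingale_nat hWm hWi fun t => ?_
    have h1 : P[W (t + 1) | ℱ t] =ᵐ[P] fun ω => (p (t + 1))⁻¹ * P[V (t + 1) | ℱ t] ω +
        ((p (t + 1))⁻¹ + ∑ s ∈ Finset.range (t + 1), (p (s + 1))⁻¹ * U s ω) := by
      have h2 : W (t + 1) = (p (t + 1))⁻¹ • V (t + 1) + fun ω => (p (t + 1))⁻¹ +
          ∑ s ∈ Finset.range (t + 1), (p (s + 1))⁻¹ * U s ω := by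
        funext ω; simp only [hW, Pi.add_apply, Pi.smul_apply, smul_eq_mul]; ring
      have h3 : Integrable (fun ω => (p (t + 1))⁻¹ +
          ∑ s ∈ Finset.range (t + 1), (p (s + 1))⁻¹ * U s ω) P :=
        (integrable_const _).add (hSi _)
      rw [h2]
      refine (condExp_add ((hVi _).smul _) h3 _).trans ?_
      filter_upwards [condExp_smul (m := ℱ t) (μ := P) (p (t + 1))⁻¹ (V (t + 1))] with ω hω
      have h4 : StronglyMeasurable[ℱ t] (fun ω => (p (t + 1))⁻¹ +
          ∑ s ∈ Finset.range (t + 1), (p (s + 1))⁻¹ * U s ω) :=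
        stronglyMeasurable_const.add (hSm (t + 1) t le_rfl)
      rw [Pi.add_apply, hω, condExp_of_stronglyMeasurable (ℱ.le t) h4 h3]
      simp
    filter_upwards [h1, hstep t] with ω h1 h2
    rw [h1, Finset.sum_range_succ]
    have h3 : (p t)⁻¹ = (p (t + 1))⁻¹ * (1 + e t) := by
      rw [hpsucc]; have := he t; have := (hp0 t).ne'; field_simp
    have h4 := mul_le_mul_of_nonneg_left h2 (inv_nonneg.2 (hp0 (t + 1)).le)
    simp only [hW]
    rw [h3]
    linarith
  have hEW : ∀ t, ∫ ω, W t ω ∂P ≤ ∫ ω, W 0 ω ∂P := fun t => by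
    simpa using hsup.setIntegral_le (Nat.zero_le t) MeasurableSet.univ
  have hVW : ∀ t ω, V t ω ≤ B * W t ω := fun t ω => by
    have h1 : (p t)⁻¹ * (V t ω + 1) ≤ W t ω := le_add_of_nonneg_right (Finset.sum_nonneg fun s _ =>
      mul_nonneg (inv_nonneg.2 (hp0 _).le) (hU _ _))
    rw [inv_mul_le_iff₀ (hp0 t)] at h1
    have h2 := mul_le_mul_of_nonneg_right (hpB t) (hW0 t ω)
    linarith
  have hUW : ∀ t ω, ∑ s ∈ Finset.range t, U s ω ≤ B * W t ω := fun t ω => by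
    have h1 : ∑ s ∈ Finset.range t, (p (s + 1))⁻¹ * U s ω ≤ W t ω := le_add_of_nonneg_left
      (mul_nonneg (inv_nonneg.2 (hp0 _).le) (by linarith [hV t ω]))
    refine le_trans ?_ (mul_le_mul_of_nonneg_left h1 (Real.exp_nonneg _))
    rw [Finset.mul_sum]
    refine Finset.sum_le_sum fun s _ => ?_
    rw [← mul_assoc]
    refine le_mul_of_one_le_left (hU s ω) ?_
    rw [← div_eq_mul_inv, one_le_div (hp0 _)]
    exact hpB _
  refine ⟨⟨B * ∫ ω, W 0 ω ∂P, fun t => ?_⟩, ?_⟩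
  · calc ∫ ω, V t ω ∂P ≤ ∫ ω, B * W t ω ∂P :=
          integral_mono (hVi t) ((hWi t).const_mul _) (hVW t)
      _ = B * ∫ ω, W t ω ∂P := integral_const_mul _ _
      _ ≤ _ := mul_le_mul_of_nonneg_left (hEW t) (Real.exp_nonneg _)
  have hbdd : ∀ t, eLpNorm ((-W) t) 1 P ≤ (Real.toNNReal (∫ ω, W 0 ω ∂P) : ENNReal) := fun t => by
    rw [Pi.neg_apply, eLpNorm_neg, eLpNorm_one_eq_lintegral_enorm,
      ← ofReal_integral_norm_eq_lintegral_enorm (hWi t)]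
    refine ENNReal.ofReal_le_ofReal ?_
    simp_rw [Real.norm_of_nonneg (hW0 t _)]
    exact hEW t
  filter_upwards [hsup.neg.exists_ae_tendsto_of_bdd hbdd] with ω ⟨c, hc⟩
  obtain ⟨K, hK⟩ := hc.bddBelow_range
  have hWK : ∀ t, W t ω ≤ -K := fun t => by
    have := hK ⟨t, rfl⟩
    simp only [Pi.neg_apply] at this
    linarith
  refine ⟨⟨B * -K, fun t => (hVW t ω).trans ?_⟩,
    summable_of_sum_range_le (c := B * -K) (fun t => hU t ω) fun t => (hUW t ω).trans ?_⟩ <;>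
  exact mul_le_mul_of_nonneg_left (hWK t) (Real.exp_nonneg _)

lemma integral_mul_eq_zero_of_condExp_eq_zero {m : MeasurableSpace Ω} (hm : m ≤ mΩ)
    {Y D : Ω → ℝ} (hYm : StronglyMeasurable[m] Y) (hY : MemLp Y 2 P) (hD : MemLp D 2 P)
    (h0 : P[D | m] =ᵐ[P] 0) : ∫ ω, Y ω * D ω ∂P = 0 := by
  have h1 : P[Y * D | m] =ᵐ[P] Y * P[D | m] :=
    condExp_mul_of_stronglyMeasurable_left hYm (hY.integrable_mul hD) (hD.integrable one_le_two)
  rw [show (fun ω => Y ω * D ω) = Y * D from rfl]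
  change ∫ ω, (Y * D) ω ∂P = 0
  rw [← integral_condExp hm]
  refine integral_eq_zero_of_ae ?_
  filter_upwards [h1, h0] with ω h1 h2
  rw [h1, Pi.mul_apply, h2]; simp

/-- An adapted process with square-summable increments has a convergent martingale part. -/
theorem exists_tendsto_sum_sub_condExp {u : ℕ → Ω → ℝ} {c : ℕ → ℝ}
    (hum : ∀ t, StronglyMeasurable[ℱ t] (u t)) (hu : ∀ t, MemLp (u t) 2 P)
    (hc : ∀ t, ∫ ω, (u (t + 1) ω - u t ω) ^ 2 ∂P ≤ c t) (hcs : Summable c) :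
    ∀ᵐ ω ∂P, ∃ x, Tendsto (fun T => ∑ t ∈ Finset.range T,
      (u (t + 1) ω - (P[u (t + 1) | ℱ t]) ω)) atTop (𝓝 x) := by
  set D : ℕ → Ω → ℝ := fun t => u (t + 1) - P[u (t + 1) | ℱ t] with hD
  set M : ℕ → Ω → ℝ := fun T ω => ∑ t ∈ Finset.range T, D t ω with hM
  have hDL : ∀ t, MemLp (D t) 2 P := fun t => (hu _).sub (MemLp.condExp one_le_two (hu (t + 1)))
  have hDi : ∀ t, Integrable (D t) P := fun t => (hDL t).integrable one_le_two
  have hDm : ∀ t, StronglyMeasurable[ℱ (t + 1)] (D t) := fun t =>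
    (hum _).sub (stronglyMeasurable_condExp.mono (ℱ.mono t.le_succ))
  have hD0 : ∀ t, P[D t | ℱ t] =ᵐ[P] 0 := fun t => by
    refine (condExp_sub ((hu (t + 1)).integrable one_le_two) integrable_condExp _).trans ?_
    rw [condExp_of_stronglyMeasurable (ℱ.le t) stronglyMeasurable_condExp integrable_condExp,
      sub_self]
  have hML : ∀ T, MemLp (M T) 2 P := fun T => memLp_finsetSum _ fun t _ => hDL t
  have hMm : ∀ T, StronglyMeasurable[ℱ T] (M T) := fun T =>
    Finset.stronglyMeasurable_fun_sum _ fun t ht =>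
      (hDm t).mono (ℱ.mono (by have := Finset.mem_range.1 ht; omega))
  have hMsucc : ∀ T, M (T + 1) = M T + D T := fun T => by
    funext ω; exact Finset.sum_range_succ _ _
  have hmart : Martingale M ℱ P := by
    refine martingale_nat hMm (fun T => (hML T).integrable one_le_two) fun T => ?_
    rw [hMsucc]
    refine Filter.EventuallyEq.symm
      ((condExp_add ((hML T).integrable one_le_two) (hDi T) _).trans ?_)
    rw [condExp_of_stronglyMeasurable (ℱ.le T) (hMm T) ((hML T).integrable one_le_two)]
    filter_upwards [hD0 T] with ω h
    rw [Pi.add_apply, h]; simp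
  have hDc : ∀ t, ∫ ω, D t ω ^ 2 ∂P ≤ c t := fun t => by
    refine le_trans ?_ (hc t)
    -- The increment of `u` is `D t + Y` with `Y` known at time `t`, hence orthogonal to `D t`. So
    -- the innovation is no larger in mean square than the whole increment.
    set Y : Ω → ℝ := P[u (t + 1) | ℱ t] - u t with hY
    have hYL : MemLp Y 2 P := (MemLp.condExp one_le_two (hu (t + 1))).sub (hu t)
    have hYm : StronglyMeasurable[ℱ t] Y := stronglyMeasurable_condExp.sub (hum t)
    have h0 := integral_mul_eq_zero_of_condExp_eq_zero (ℱ.le t) hYm hYL (hDL t) (hD0 t)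
    have h1 : (fun ω => (u (t + 1) ω - u t ω) ^ 2) =
        fun ω => D t ω ^ 2 + (2 * (Y ω * D t ω) + Y ω ^ 2) := by
      funext ω; simp only [hD, hY, Pi.sub_apply]; ring
    have hYD : Integrable (fun ω => 2 * (Y ω * D t ω)) P := (hYL.integrable_mul (hDL t)).const_mul 2
    have hYY : Integrable (fun ω => Y ω ^ 2) P := hYL.integrable_sq
    have hsum : Integrable (fun ω => 2 * (Y ω * D t ω) + Y ω ^ 2) P := hYD.add hYY
    rw [h1, integral_add (hDL t).integrable_sq hsum, integral_add hYD hYY,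
      integral_const_mul, h0]
    have : 0 ≤ ∫ ω, Y ω ^ 2 ∂P := integral_nonneg fun ω => sq_nonneg _
    linarith
  have hc0 : ∀ t, 0 ≤ c t := fun t => (integral_nonneg fun ω => sq_nonneg _).trans (hDc t)
  have hM2 : ∀ T, ∫ ω, M T ω ^ 2 ∂P ≤ ∑ t ∈ Finset.range T, c t := fun T => by
    induction T with
    | zero => simp [hM]
    | succ T ih =>
      have h0 := integral_mul_eq_zero_of_condExp_eq_zero (ℱ.le T) (hMm T) (hML T) (hDL T) (hD0 T)
      have h1 : (fun ω => M (T + 1) ω ^ 2) =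
          fun ω => M T ω ^ 2 + (2 * (M T ω * D T ω) + D T ω ^ 2) := by
        funext ω; rw [hMsucc, Pi.add_apply]; ring
      have hYD : Integrable (fun ω => 2 * (M T ω * D T ω)) P :=
        ((hML T).integrable_mul (hDL T)).const_mul 2
      have hsum : Integrable (fun ω => 2 * (M T ω * D T ω) + D T ω ^ 2) P :=
        hYD.add (hDL T).integrable_sq
      rw [h1, integral_add (hML T).integrable_sq hsum,
        integral_add hYD (hDL T).integrable_sq, integral_const_mul, h0, Finset.sum_range_succ]
      have := hDc T
      linarith
  have hbdd : ∀ T, eLpNorm (M T) 1 P ≤ (Real.toNNReal (1 + ∑' t, c t) : ENNReal) := fun T => by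
    have hi := (hML T).integrable one_le_two
    rw [eLpNorm_one_eq_lintegral_enorm, ← ofReal_integral_norm_eq_lintegral_enorm hi]
    refine ENNReal.ofReal_le_ofReal ?_
    calc ∫ ω, ‖M T ω‖ ∂P ≤ ∫ ω, (1 + M T ω ^ 2) ∂P :=
          integral_mono hi.norm ((integrable_const 1).add (hML T).integrable_sq) fun ω => by
            simp only [Real.norm_eq_abs]
            nlinarith [sq_abs (M T ω), sq_nonneg (|M T ω| - 1)]
      _ = 1 + ∫ ω, M T ω ^ 2 ∂P := by
          rw [integral_add (integrable_const 1) (hML T).integrable_sq]; simp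
      _ ≤ _ := by
          gcongr
          exact (hM2 T).trans (hcs.sum_le_tsum _ fun t _ => hc0 t)
  exact hmart.submartingale.exists_ae_tendsto_of_bdd hbdd

end Martingale

/-! ### Recovering independent noise from a conditional law -/

section FreshNoise

variable {Ω Ω' X Y : Type*} {mΩ : MeasurableSpace Ω} {P : Measure Ω} [IsProbabilityMeasure P]
  {mΩ' : MeasurableSpace Ω'} [MeasurableSpace X] [MeasurableSpace Y]
  {ν : Measure X} [IsProbabilityMeasure ν]

/-- If, given `Z`, the variable `x` has the law of `T Z ξ` with `ξ ∼ ν`, then the noise recovered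
from `x` has law `ν` and is independent of `Z`. -/
lemma map_prodMk_eq_prod_of_condLaw {Z : Ω → Ω'} (hZ : Measurable Z)
    {x : Ω → Y} (hx : Measurable x) {T : Ω' → X → Y} {T' : Ω' → Y → X}
    (hT : Measurable (Function.uncurry T)) (hT' : Measurable (Function.uncurry T'))
    (hTT : ∀ z ξ, T' z (T z ξ) = ξ)
    (hlaw : ∀ A B, MeasurableSet A → MeasurableSet B →
      P (Z ⁻¹' A ∩ x ⁻¹' B) = ∫⁻ ω in Z ⁻¹' A, ν.map (T (Z ω)) B ∂P) :
    P.map (fun ω => (Z ω, T' (Z ω) (x ω))) = (P.map Z).prod ν := by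
  have := Measure.isProbabilityMeasure_map (μ := P) hZ.aemeasurable
  have hTz : ∀ z, Measurable (T z) := fun z => hT.comp measurable_prodMk_left
  have hΨ : Measurable fun p : Ω' × X => (p.1, T p.1 p.2) := measurable_fst.prodMk hT
  have hΨ' : Measurable fun p : Ω' × Y => (p.1, T' p.1 p.2) := measurable_fst.prodMk hT'
  have h1 : P.map (fun ω => (Z ω, x ω)) =
      ((P.map Z).prod ν).map (fun p => (p.1, T p.1 p.2)) := by
    have := Measure.isProbabilityMeasure_map (μ := (P.map Z).prod ν) hΨ.aemeasurable
    have := Measure.isProbabilityMeasure_map (μ := P) (hZ.prodMk hx).aemeasurable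
    refine Measure.ext_prod fun {A B} hA hB => ?_
    rw [Measure.map_apply (hZ.prodMk hx) (hA.prod hB), Measure.map_apply hΨ (hA.prod hB),
      Measure.prod_apply (hΨ (hA.prod hB)), lintegral_map
        (measurable_measure_prodMk_left (hΨ (hA.prod hB))) hZ, Set.mk_preimage_prod, hlaw A B hA hB,
      ← lintegral_indicator (hZ hA)]
    refine lintegral_congr fun ω => ?_
    by_cases h : Z ω ∈ A
    · rw [Set.indicator_of_mem (by exact h), Measure.map_apply (hTz _) hB]
      congr 1; ext ξ; simp [h]
    · rw [Set.indicator_of_notMem (by exact h)]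
      symm
      convert measure_empty (μ := ν)
      ext ξ; simp [h]
  -- Applying `T'` fibrewise undoes `T`, so the image of the product law returns to the product law.
  have h2 := congrArg (Measure.map (fun p : Ω' × Y => (p.1, T' p.1 p.2))) h1
  rw [Measure.map_map hΨ' (hZ.prodMk hx), Measure.map_map hΨ' hΨ] at h2
  refine h2.trans ?_
  convert Measure.map_id (μ := (P.map Z).prod ν)
  ext p <;> simp [hTT]

/-- The product law says that the constant kernel `ν` is a version of the conditional distribution
of `ξ` given `Z`. -/
lemma condExp_eq_integral_of_map_prodMk_eq_prod [StandardBorelSpace X] [Nonempty X]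
    {Z : Ω → Ω'} (hZ : Measurable Z) {ξ : Ω → X} (hξ : Measurable ξ)
    (h : P.map (fun ω => (Z ω, ξ ω)) = (P.map Z).prod ν) {f : Ω' × X → ℝ} (hf : Measurable f)
    (hfi : Integrable (fun ω => f (Z ω, ξ ω)) P) :
    P[fun ω => f (Z ω, ξ ω) | MeasurableSpace.comap Z inferInstance] =ᵐ[P]
      fun ω => ∫ y, f (Z ω, y) ∂ν := by
  have h1 : condDistrib ξ Z P =ᵐ[P.map Z] Kernel.const Ω' ν :=
    condDistrib_ae_eq_of_measure_eq_compProd Z hξ.aemeasurable (by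
      rw [h, Measure.compProd_const])
  refine (condExp_prod_ae_eq_integral_condDistrib hZ hξ.aemeasurable
    hf.stronglyMeasurable hfi).trans ?_
  filter_upwards [ae_of_ae_map hZ.aemeasurable h1] with ω hω
  rw [hω, Kernel.const_apply]

end FreshNoise

/-! ### Tangent inequality, projections, Lagrange multipliers -/

section ConvexAnalysis

variable {E : Type*} [NormedAddCommGroup E] [InnerProductSpace ℝ E] [CompleteSpace E]

lemma ConvexOn.add_inner_le_of_hasGradientAt {φ : E → ℝ} (hφ : ConvexOn ℝ Set.univ φ) {m v : E}
    (hv : HasGradientAt φ v m) (b : E) : φ m + inner ℝ v (b - m) ≤ φ b := by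
  set ψ : ℝ → ℝ := φ ∘ AffineMap.lineMap m b with hψ
  have hc : ConvexOn ℝ Set.univ ψ := hφ.comp_affineMap _
  have hd : HasDerivAt ψ (inner ℝ v (b - m)) 0 := by
    have h0 : HasFDerivAt φ (InnerProductSpace.toDual ℝ E v) (AffineMap.lineMap m b (0 : ℝ)) := by
      rw [AffineMap.lineMap_apply_zero]; exact hv.hasFDerivAt
    simpa using h0.comp_hasDerivAt (0 : ℝ) (AffineMap.hasDerivAt_lineMap (a := m) (b := b))
  have h := hc.le_slope_of_hasDerivAt (Set.mem_univ 0) (Set.mem_univ 1) one_pos hd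
  simp only [slope_def_field, hψ, Function.comp_apply, AffineMap.lineMap_apply_zero,
    AffineMap.lineMap_apply_one, sub_zero, div_one] at h
  linarith

/-- At a nearest point `p` the angle between `x - p` and `y - p` is not acute. This is the only
property of the projections that the convergence argument uses besides membership. -/
lemma norm_sub_le_of_isProjection {F : Type*} [NormedAddCommGroup F] [InnerProductSpace ℝ F]
    {K : Set F} (hK : Convex ℝ K) {x p y : F}
    (hp : IsProjection K x p) (hy : y ∈ K) : ‖p - y‖ ≤ ‖x - y‖ := by
  have h : inner ℝ (x - p) (y - p) ≤ 0 := by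
    refine (norm_eq_iInf_iff_real_inner_le_zero hK hp.1).1 (le_antisymm ?_ ?_) y hy
    · have : Nonempty K := ⟨⟨p, hp.1⟩⟩
      exact le_ciInf fun w => hp.2 w w.2
    · exact ciInf_le ⟨0, by rintro _ ⟨w, rfl⟩; exact norm_nonneg _⟩ (⟨p, hp.1⟩ : K)
  have h1 : x - y = (x - p) - (y - p) := by abel
  have h2 := norm_sub_sq_real (x - p) (y - p)
  rw [← h1] at h2
  refine abs_le_of_sq_le_sq' ?_ (norm_nonneg _) |>.2
  rw [norm_sub_rev p y]
  nlinarith [sq_nonneg ‖x - p‖]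

lemma convexOn_inner_of_nonneg {F : Type*} [AddCommGroup F] [Module ℝ F] {n : ℕ}
    {g : F → EuclideanSpace ℝ (Fin n)} (hg : ∀ j, ConvexOn ℝ Set.univ (fun a => g a j))
    {l : EuclideanSpace ℝ (Fin n)} (hl : l ∈ nonnegOrthant n) :
    ConvexOn ℝ Set.univ (fun b => inner ℝ l (g b)) := by
  refine ⟨convex_univ, fun x _ y _ s t hs ht hst => ?_⟩
  simp only [PiLp.inner_apply, smul_eq_mul, Finset.mul_sum, ← Finset.sum_add_distrib]
  refine Finset.sum_le_sum fun j _ => ?_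
  have h := mul_le_mul_of_nonneg_left
    ((hg j).2 (Set.mem_univ x) (Set.mem_univ y) hs ht hst) (hl j)
  simp only [smul_eq_mul] at h
  simp only [RCLike.inner_apply, conj_trivial]
  linarith

/-- Lagrange multipliers for a convex program under Slater's condition. -/
theorem exists_multiplier {F : Type*} [AddCommGroup F] [Module ℝ F] {n : ℕ} {A : Set F}
    (hA : Convex ℝ A) {f : F → ℝ} (hf : ConvexOn ℝ Set.univ f)
    {g : F → EuclideanSpace ℝ (Fin n)} (hg : ∀ j, ConvexOn ℝ Set.univ (fun a => g a j))
    (hslater : ∃ a ∈ A, ∀ j, g a j < 0) {v : ℝ} (hv : ∀ b ∈ A, (∀ j, g b j ≤ 0) → v ≤ f b) :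
    ∃ l ∈ nonnegOrthant n, ∀ b ∈ A, v ≤ f b + inner ℝ l (g b) := by
  obtain ⟨b₀, hb₀, hgb₀⟩ := hslater
  -- The strict epigraph of the constraint and objective values: strictness makes it open, convexity
  -- of the data makes it convex, and the lower bound `v` keeps the origin out, so a functional
  -- separates it from `0`.
  set C : Set (ℝ × (Fin n → ℝ)) := {p | ∃ b ∈ A, f b - v < p.1 ∧ ∀ j, g b j < p.2 j} with hC
  have hCconv : Convex ℝ C := by
    rintro ⟨r, s⟩ ⟨b, hb, hbr, hbs⟩ ⟨r', s'⟩ ⟨b', hb', hbr', hbs'⟩ x y hx hy hxy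
    have hcomb : ∀ {p q p' q' : ℝ}, p < p' → q < q' → x * p + y * q < x * p' + y * q' := by
      intro p q p' q' h1 h2
      rcases hx.eq_or_lt with rfl | hx'
      · have : y = 1 := by linarith
        subst this; linarith
      · have := mul_lt_mul_of_pos_left h1 hx'
        have := mul_le_mul_of_nonneg_left h2.le hy
        linarith
    refine ⟨x • b + y • b', hA hb hb' hx hy hxy, ?_, fun j => ?_⟩
    · have h1 := hf.2 (Set.mem_univ b) (Set.mem_univ b') hx hy hxy
      have h2 := hcomb hbr hbr'
      simp only [smul_eq_mul, Prod.fst_add, Prod.smul_fst] at *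
      have : x * v + y * v = v := by rw [← add_mul, hxy, one_mul]
      linarith
    · have h1 := (hg j).2 (Set.mem_univ b) (Set.mem_univ b') hx hy hxy
      have h2 := hcomb (hbs j) (hbs' j)
      simp only [smul_eq_mul, Prod.snd_add, Prod.smul_snd, Pi.add_apply, Pi.smul_apply] at *
      linarith
  have hCopen : IsOpen C := by
    have : C = ⋃ b ∈ A, (Set.Ioi (f b - v)) ×ˢ (Set.univ.pi fun j => Set.Ioi (g b j)) := by
      ext p
      simp only [hC, Set.mem_ofPred_eq, Set.mem_iUnion, Set.mem_prod, Set.mem_Ioi, Set.mem_pi,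
        Set.mem_univ, true_imp_iff, exists_prop]
    rw [this]
    exact isOpen_biUnion fun b _ => isOpen_Ioi.prod
      (isOpen_set_pi Set.finite_univ fun j _ => isOpen_Ioi)
  have h0 : (0 : ℝ × (Fin n → ℝ)) ∉ C := by
    rintro ⟨b, hb, h1, h2⟩
    have := hv b hb fun j => (h2 j).le
    simp at h1
    linarith
  obtain ⟨φ, hφ⟩ := geometric_hahn_banach_open_point hCconv hCopen h0
  rw [map_zero] at hφ
  set ρ : ℝ := - φ (1, 0) with hρ
  set lam : Fin n → ℝ := fun j => - φ (0, Pi.single j 1) with hlam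
  have hφe : ∀ r s, φ (r, s) = - (ρ * r + ∑ j, lam j * s j) := by
    intro r s
    have h1 : (r, s) = r • ((1 : ℝ), (0 : Fin n → ℝ)) +
        ∑ j, s j • ((0 : ℝ), (Pi.single j (1 : ℝ) : Fin n → ℝ)) := by
      refine Prod.ext ?_ ?_
      · simp [Prod.fst_sum]
      · funext k
        simp [Prod.snd_sum, Finset.sum_apply, Pi.single_apply]
    rw [h1, map_add, map_smul, map_sum]
    simp only [map_smul, smul_eq_mul, hρ, hlam]
    simp only [neg_mul, Finset.sum_neg_distrib]
    simp only [mul_comm]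
    ring
  have hpos : ∀ b ∈ A, ∀ (r : ℝ) (s : Fin n → ℝ), f b - v < r → (∀ j, g b j < s j) → 0 < ρ * r + ∑ j, lam j * s j := by
    intro b hb r s h1 h2
    have := hφ (r, s) ⟨b, hb, h1, h2⟩
    rw [hφe] at this; linarith
  -- `C` is stable under raising any coordinate, so the separating functional stays positive along
  -- such rays; this forces the signs of `ρ` and `lam`.
  have haff : ∀ p q : ℝ, (∀ K > 0, 0 < p + K * q) → 0 ≤ q := by
    intro p q h
    by_contra! hq
    have := h ((|p| + 1) / -q) (div_pos (by positivity) (by linarith))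
    have h2 : (|p| + 1) / -q * q = -(|p| + 1) := by
      rw [div_mul_eq_mul_div, mul_div_assoc, div_neg, div_self hq.ne]; ring
    rw [h2] at this
    linarith [le_abs_self p]
  have hρ0 : 0 ≤ ρ := by
    refine haff (ρ * (f b₀ - v) + ∑ j, lam j * 0) ρ fun K hK => ?_
    have := hpos b₀ hb₀ (f b₀ - v + K) (fun _ => 0) (by linarith) hgb₀
    linarith
  have hlam0 : ∀ j, 0 ≤ lam j := fun j => by
    refine haff (ρ * (f b₀ - v + 1)) (lam j) fun K hK => ?_
    have := hpos b₀ hb₀ (f b₀ - v + 1) (Pi.single j K) (by linarith) fun k => by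
      refine (hgb₀ k).trans_le ?_
      rcases eq_or_ne k j with rfl | hk
      · simpa using hK.le
      · simp [hk]
    simpa [Pi.single_apply, mul_comm] using this
  -- Passage to the boundary of `C`: raising every coordinate by `ε` adds only `ε * S`, and `ε` is
  -- chosen so that this is less than the supposed deficit.
  have hge : ∀ b ∈ A, 0 ≤ ρ * (f b - v) + ∑ j, lam j * g b j := by
    intro b hb
    by_contra! hneg
    set S := ρ + ∑ j, lam j with hS
    have hS0 : 0 ≤ S := add_nonneg hρ0 (Finset.sum_nonneg fun j _ => hlam0 j)
    set ε := - (ρ * (f b - v) + ∑ j, lam j * g b j) / (S + 1) with hε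
    have hε0 : 0 < ε := div_pos (by linarith) (by linarith)
    have h1 := hpos b hb (f b - v + ε) (fun j => g b j + ε) (by linarith) fun j => by linarith
    simp only [mul_add, Finset.sum_add_distrib, ← Finset.sum_mul] at h1
    have h2 : ε * (S + 1) = - (ρ * (f b - v) + ∑ j, lam j * g b j) := by
      rw [hε]; field_simp
    have h3 : ε * S = ρ * ε + (∑ j, lam j) * ε := by rw [hS]; ring
    rw [mul_add, mul_one] at h2
    linarith
  -- Slater's condition excludes a vertical functional: with `ρ = 0`, strict feasibility of `b₀`
  -- would make every `lam j` vanish, and with it the functional.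
  have hρpos : 0 < ρ := by
    refine hρ0.lt_of_ne fun h => ?_
    have h1 := hge b₀ hb₀
    rw [← h, zero_mul, zero_add] at h1
    have h2 : ∀ j, lam j * g b₀ j ≤ 0 := fun j =>
      mul_nonpos_of_nonneg_of_nonpos (hlam0 j) (hgb₀ j).le
    have h3 : ∑ j, lam j * g b₀ j = 0 := le_antisymm (Finset.sum_nonpos fun j _ => h2 j) h1
    have h4 : ∀ j, lam j = 0 := fun j => by
      have := (Finset.sum_eq_zero_iff_of_nonpos fun j _ => h2 j).1 h3 j (Finset.mem_univ j)
      exact (mul_eq_zero.1 this).resolve_right (hgb₀ j).ne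
    have h5 := hpos b₀ hb₀ (f b₀ - v + 1) (fun _ => 0) (by linarith) hgb₀
    simp [← h] at h5
  refine ⟨WithLp.toLp 2 fun j => ρ⁻¹ * lam j, fun j => mul_nonneg (inv_nonneg.2 hρ0) (hlam0 j),
    fun b hb => ?_⟩
  have h1 : inner ℝ (WithLp.toLp 2 fun j => ρ⁻¹ * lam j : EuclideanSpace ℝ (Fin n)) (g b) =
      ρ⁻¹ * ∑ j, lam j * g b j := by
    simp only [PiLp.inner_apply, RCLike.inner_apply, conj_trivial, Finset.mul_sum]
    exact Finset.sum_congr rfl fun j _ => by ring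
  have h2 := mul_nonneg (inv_nonneg.2 hρ0) (hge b hb)
  rw [mul_add, ← mul_assoc, inv_mul_cancel₀ hρpos.ne', one_mul, ← h1] at h2
  linarith

end ConvexAnalysis

/-! ### Partial gradients as blocks of the full gradient -/

section Gradients

variable {N : ℕ} {d : Fin N → ℕ}

/-- Chain rule: the inclusion of block `i` has the projection onto block `i` as adjoint. -/
lemma HasGradientAt.comp_deviate {h : JointSpace d → ℝ} {v x : JointSpace d} {i : Fin N}
    {y : ActionSpace d i} (hv : HasGradientAt h v (deviate x i y)) :
    HasGradientAt (fun z => h (deviate x i z)) (v i) y := by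
  have h1 : HasFDerivAt (fun z : ActionSpace d i => deviate x i z)
      ((PiLp.continuousLinearEquiv 2 ℝ (ActionSpace d)).symm.toContinuousLinearMap.comp
        (.pi (Pi.single i (.id ℝ (ActionSpace d i))))) y :=
    (PiLp.continuousLinearEquiv 2 ℝ (ActionSpace d)).symm.hasFDerivAt.comp y
      (hasFDerivAt_update x.ofLp y)
  rw [hasGradientAt_iff_hasFDerivAt] at hv ⊢
  refine (hv.comp y h1).congr_fderiv ?_
  ext w
  have h2 : (PiLp.continuousLinearEquiv 2 ℝ (ActionSpace d)).symm.toContinuousLinearMap.comp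
        (.pi (Pi.single i (.id ℝ (ActionSpace d i)))) w = WithLp.toLp 2 (Pi.single i w) := by
    ext1 j
    rcases eq_or_ne j i with rfl | hj
    · simp
    · simp [hj]
  rw [ContinuousLinearMap.comp_apply, h2, InnerProductSpace.toDual_apply_apply,
    InnerProductSpace.toDual_apply_apply, real_inner_comm, inner_toLp_single, real_inner_comm]

end Gradients

/-! ### The equilibrium, its multiplier and the merit function -/

namespace CoupledGame

variable {N n : ℕ} {d : Fin N → ℕ} {G : CoupledGame N n d}

lemma hasGradientAt_J (hG : G.IsConvexGame) (i : Fin N) (a : JointSpace d) :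
    HasGradientAt (G.J i) (gradient (G.J i) a) a :=
  ((hG.contDiff_J i).differentiable one_ne_zero a).hasGradientAt

lemma hasGradientAt_inner_g (hG : G.IsConvexGame) (l : EuclideanSpace ℝ (Fin n))
    (a : JointSpace d) : HasGradientAt (fun b => inner ℝ l (G.g b))
      (gradient (fun b => inner ℝ l (G.g b)) a) a :=
  (((contDiff_const.inner ℝ hG.contDiff_g).differentiable one_ne_zero) a).hasGradientAt

lemma hasGradientAt_extendedCost_deviate (hG : G.IsConvexGame) (i : Fin N)
    (l : EuclideanSpace ℝ (Fin n)) (x : JointSpace d) (y : ActionSpace d i) :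
    HasGradientAt (fun z => G.extendedCost i (deviate x i z) l)
      (G.extendedBlock i (deviate x i y) l) y := by
  have h := (hasGradientAt_J hG i (deviate x i y)).comp_deviate
  have h' := (hasGradientAt_inner_g hG l (deviate x i y)).comp_deviate
  rw [hasGradientAt_iff_hasFDerivAt] at h h' ⊢
  refine (h.add h').congr_fderiv ?_
  rw [← map_add]; rfl

lemma convex_jointActions (hG : G.IsConvexGame) : Convex ℝ G.jointActions :=
  fun _ hx _ hy _ _ hs ht hst i => hG.convex_A i (hx i) (hy i) hs ht hst

lemma isCompact_jointActions (hG : G.IsConvexGame) : IsCompact G.jointActions := by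
  have h := (isCompact_univ_pi hG.compact_A).image
    (PiLp.continuous_toLp 2 (fun i => ActionSpace d i))
  convert h using 1
  ext a
  constructor
  · intro ha; exact ⟨a.ofLp, fun i _ => ha i, rfl⟩
  · rintro ⟨b, hb, rfl⟩ i; exact hb i (Set.mem_univ i)

lemma convex_feasible (hG : G.IsConvexGame) : Convex ℝ G.feasible := by
  refine (convex_jointActions hG).inter (?_ : Convex ℝ {a | ∀ j, G.g a j ≤ 0})
  rw [Set.ofPred_forall]
  exact convex_iInter fun j => by simpa using (hG.convex_g j).convex_le 0

lemma continuous_g (hG : G.IsConvexGame) : Continuous G.g := hG.contDiff_g.continuous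

lemma isCompact_feasible (hG : G.IsConvexGame) : IsCompact G.feasible := by
  refine (isCompact_jointActions hG).inter_right (?_ : IsClosed {a | ∀ j, G.g a j ≤ 0})
  rw [Set.ofPred_forall]
  refine isClosed_iInter fun j => isClosed_le ?_ continuous_const
  exact (EuclideanSpace.proj (𝕜 := ℝ) j).continuous.comp (continuous_g hG)

/-- An admissible unilateral deviation is itself a point of `Q`. Tested there, the variational
inequality involves only block `i`, and convexity in the player's own action turns it into a cost
comparison. -/
lemma isGNE_of_mem_variationalEquilibria (hG : G.IsConvexGame) {a : JointSpace d}
    (ha : a ∈ G.variationalEquilibria) : G.IsGNE a := by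
  refine ⟨ha.1, fun i y hy hg => ?_⟩
  have hfeas : deviate a i y ∈ G.feasible := by
    refine ⟨fun j => ?_, hg⟩
    rcases eq_or_ne j i with rfl | hj
    · simpa using hy
    · rw [deviate_apply_of_ne a hj]; exact ha.1.1 j
  have h1 := ha.2 _ hfeas
  have h2 : inner ℝ (G.gameMap a) (deviate a i y - a) = inner ℝ (G.gameMap a i) (y - a i) := by
    rw [PiLp.inner_apply, Finset.sum_eq_single i]
    · simp
    · intro j _ hj; simp [deviate_apply_of_ne a hj]
    · simp
  have h3 : HasGradientAt (fun z => G.J i (deviate a i z)) (G.gameMap a i) (a i) := by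
    have := (hasGradientAt_J hG i (deviate a i (a i))).comp_deviate
    rwa [deviate_self] at this
  have h4 := (hG.convex_J i a).add_inner_le_of_hasGradientAt h3 y
  rw [deviate_self] at h4
  linarith

/-- The variational equilibrium of a game with a strictly convex potential, a dual multiplier,
and a merit function that bounds the extended game mapping from below. -/
theorem exists_equilibrium_merit (hG : G.IsConvexGame) (hslater : G.Slater)
    (hpot : G.HasStrictlyConvexPotential) :
    ∃ (a : JointSpace d) (ls : EuclideanSpace ℝ (Fin n)) (D : JointSpace d → ℝ),
      G.variationalEquilibria = {a} ∧ G.IsGNE a ∧ ls ∈ nonnegOrthant n ∧ Continuous D ∧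
      (∀ b ∈ G.jointActions, 0 ≤ D b) ∧
      (∀ ε > 0, ∃ δ > 0, ∀ b ∈ G.jointActions, ε ≤ ‖b - a‖ ^ 2 → δ ≤ D b) ∧
      ∀ b ∈ G.jointActions, ∀ l ∈ nonnegOrthant n,
        D b ≤ ∑ i, inner ℝ (G.extendedBlock i b l) (b i - a i) - inner ℝ (G.g b) (l - ls) := by
  obtain ⟨f, hf, hfg⟩ := hpot
  have hfc : Continuous f := continuous_iff_continuousAt.2 fun a => (hfg a).continuousAt
  have hne : G.feasible.Nonempty := by
    obtain ⟨b, hb, hgb⟩ := hslater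
    exact ⟨b, hb, fun j => (hgb j).le⟩
  obtain ⟨a, ha, hamin⟩ := (isCompact_feasible hG).exists_isMinOn hne hfc.continuousOn
  have hVI : a ∈ G.variationalEquilibria := by
    refine ⟨ha, fun z hz => ?_⟩
    have hd : HasDerivAt (f ∘ AffineMap.lineMap a z) (inner ℝ (G.gameMap a) (z - a)) (0 : ℝ) := by
      have h0 : HasFDerivAt f (InnerProductSpace.toDual ℝ _ (G.gameMap a))
          (AffineMap.lineMap a z (0 : ℝ)) := by
        rw [AffineMap.lineMap_apply_zero]; exact (hfg a).hasFDerivAt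
      simpa using h0.comp_hasDerivAt (0 : ℝ) (AffineMap.hasDerivAt_lineMap (a := a) (b := z))
    -- First-order condition at the minimizer: only the slopes from the right are available, because
    -- only these points of the line are known to be feasible.
    have ht := hd.hasDerivWithinAt (s := Set.Ioi 0)
    rw [hasDerivWithinAt_iff_tendsto_slope' (by simp)] at ht
    refine ge_of_tendsto ht ?_
    filter_upwards [Ioo_mem_nhdsGT (zero_lt_one' ℝ)] with t ht
    rw [slope_def_field]
    refine div_nonneg ?_ (by linarith [ht.1])
    simp only [Function.comp_apply, AffineMap.lineMap_apply_zero, sub_nonneg]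
    exact hamin ((convex_feasible hG).lineMap_mem ha hz ⟨ht.1.le, ht.2.le⟩)
  -- By the tangent inequality every variational equilibrium minimizes `f` on `Q`, and strict
  -- convexity allows one minimizer.
  have huniq : G.variationalEquilibria = {a} := by
    refine Set.eq_singleton_iff_unique_mem.2 ⟨hVI, fun b hb => ?_⟩
    have hbmin : IsMinOn f G.feasible b := fun z hz => by
      have := hf.convexOn.add_inner_le_of_hasGradientAt (hfg b) z
      have := hb.2 z hz
      simp only [Set.mem_ofPred_eq]
      linarith
    exact (hf.subset (Set.subset_univ _) (convex_feasible hG)).eq_of_isMinOn hbmin hamin hb.1 ha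
  obtain ⟨ls, hls, hlag⟩ := exists_multiplier (convex_jointActions hG) hf.convexOn hG.convex_g
    hslater (v := f a) fun b hb hgb => hamin ⟨hb, hgb⟩
  set D : JointSpace d → ℝ := fun b => f b + inner ℝ ls (G.g b) - f a with hD
  have hDc : Continuous D := (hfc.add (continuous_const.inner (continuous_g hG))).sub
    continuous_const
  have hD0 : ∀ b ∈ G.jointActions, 0 ≤ D b := fun b hb => by
    have := hlag b hb; simp only [hD]; linarith
  have hinner_a : ∀ l ∈ nonnegOrthant n, inner ℝ l (G.g a) ≤ 0 := fun l hl => by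
    simp only [PiLp.inner_apply, RCLike.inner_apply, conj_trivial]
    exact Finset.sum_nonpos fun j _ => mul_nonpos_of_nonpos_of_nonneg (ha.2 j) (hl j)
  have hDa : D a ≤ 0 := by
    have := hinner_a ls hls
    simp only [hD]; linarith
  have hDsc : StrictConvexOn ℝ Set.univ D :=
    (hf.add_convexOn (convexOn_inner_of_nonneg hG.convex_g hls)).add_const (-f a)
  -- A second zero of `D` would make `D` negative at the midpoint with `a`, against nonnegativity on
  -- the convex set of joint actions.
  have hDpos : ∀ b ∈ G.jointActions, b ≠ a → 0 < D b := fun b hb hba => by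
    by_contra! hle
    have h1 := hDsc.2 (Set.mem_univ b) (Set.mem_univ a) hba (half_pos one_pos)
      (half_pos one_pos) (add_halves 1)
    have h2 := hD0 _ (convex_jointActions hG hb ha.1 (half_pos one_pos).le
      (half_pos one_pos).le (add_halves 1))
    simp only [smul_eq_mul] at h1
    linarith
  refine ⟨a, ls, D, huniq, isGNE_of_mem_variationalEquilibria hG hVI, hls, hDc, hD0,
    fun ε hε => ?_, fun b hb l hl => ?_⟩
  · set K := G.jointActions ∩ {b | ε ≤ ‖b - a‖ ^ 2} with hK
    have hKc : IsCompact K := (isCompact_jointActions hG).inter_right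
      (isClosed_le continuous_const (by fun_prop))
    rcases K.eq_empty_or_nonempty with hKe | hKn
    · exact ⟨1, one_pos, fun b hb hε' => by
        have : b ∈ K := ⟨hb, hε'⟩
        simp [hKe] at this⟩
    · obtain ⟨c, hc, hcmin⟩ := hKc.exists_isMinOn hKn hDc.continuousOn
      refine ⟨D c, hDpos c hc.1 ?_, fun b hb hε' => hcmin ⟨hb, hε'⟩⟩
      rintro rfl
      have := hc.2
      simp at this
      linarith
  -- Tangent inequalities at `b` towards `a`. The term `⟨l, g a⟩ ≤ 0` may be discarded and `⟨l, g
  -- b⟩` cancels against the dual block, which is why the bound does not depend on `l`.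
  · have h1 := hf.convexOn.add_inner_le_of_hasGradientAt (hfg b) a
    have h2 := (convexOn_inner_of_nonneg hG.convex_g hl).add_inner_le_of_hasGradientAt
      (hasGradientAt_inner_g hG l b) a
    have h3 : ∑ i, inner ℝ (G.extendedBlock i b l) (b i - a i) =
        - inner ℝ (G.gameMap b) (a - b) -
          inner ℝ (gradient (fun c => inner ℝ l (G.g c)) b) (a - b) := by
      rw [PiLp.inner_apply, PiLp.inner_apply, ← Finset.sum_neg_distrib, ← Finset.sum_sub_distrib]
      refine Finset.sum_congr rfl fun i _ => ?_
      rw [extendedBlock, inner_add_left, PiLp.sub_apply, ← neg_sub (a i) (b i), inner_neg_right,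
        inner_neg_right]
      ring
    have h4 := hinner_a l hl
    have h5 : inner ℝ (G.g b) (l - ls) = inner ℝ l (G.g b) - inner ℝ ls (G.g b) := by
      rw [inner_sub_right, real_inner_comm l, real_inner_comm ls]
    rw [h3, h5]
    simp only [hD]
    linarith

end CoupledGame

/-! ### Growth bounds and the bias of the one-point estimate -/

namespace CoupledGame

variable {N n : ℕ} {d : Fin N → ℕ} {G : CoupledGame N n d}

lemma continuous_extendedCost (hG : G.IsConvexGame) (i : Fin N) :
    Continuous (fun p : JointSpace d × EuclideanSpace ℝ (Fin n) => G.extendedCost i p.1 p.2) :=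
  ((hG.contDiff_J i).continuous.comp continuous_fst).add
    (continuous_snd.inner ((continuous_g hG).comp continuous_fst))

lemma exists_norm_g_le (hreg : G.IsRegular) :
    ∃ C : ℝ, 0 ≤ C ∧ ∀ x, ‖G.g x‖ ≤ C * (1 + ‖x‖) := by
  obtain ⟨K, hK⟩ := hreg.lipschitz_g
  refine ⟨‖G.g 0‖ + K, by positivity, fun x => ?_⟩
  have h1 := hK.norm_sub_le x 0
  rw [sub_zero] at h1
  have h2 := norm_le_norm_add_norm_sub' (G.g x) (G.g 0)
  have h3 : 0 ≤ ‖G.g 0‖ * ‖x‖ := by positivity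
  have h4 : (0 : ℝ) ≤ K := K.2
  rw [add_mul, mul_add, mul_add]
  linarith

lemma exists_abs_extendedCost_le (hreg : G.IsRegular) (hgrowth : G.HasQuadraticGrowth) :
    ∃ (C : ℝ) (q : ℕ), 0 ≤ C ∧ ∀ i x l,
      |G.extendedCost i x l| ≤ C * (1 + ‖l‖) * (1 + ‖x‖) ^ q := by
  choose C p hJ using hgrowth
  obtain ⟨K, hK0, hK⟩ := exists_norm_g_le hreg
  -- One exponent for all players: the sum dominates each `p i`, and `2` absorbs the quadratic
  -- factor; it also keeps the exponent positive, as the linear growth of `g` requires.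
  refine ⟨∑ i, |C i| + K, ∑ i, p i + 2, by positivity, fun i x l => ?_⟩
  have hone : 1 ≤ 1 + ‖x‖ := by linarith [norm_nonneg x]
  have h1 : |G.J i x| ≤ |C i| * (1 + ‖x‖) ^ (∑ i, p i + 2) := by
    calc |G.J i x| ≤ C i * (1 + ‖x i‖ ^ 2) * (1 + ‖deviate x i 0‖) ^ p i := hJ i x
      _ ≤ |C i| * (1 + ‖x‖) ^ 2 * (1 + ‖x‖) ^ (∑ i, p i) := by
        have h2 : 1 + ‖x i‖ ^ 2 ≤ (1 + ‖x‖) ^ 2 := by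
          have := PiLp.norm_apply_le x i
          nlinarith [norm_nonneg x, norm_nonneg (x i)]
        have h3 : (1 + ‖deviate x i 0‖) ^ p i ≤ (1 + ‖x‖) ^ (∑ i, p i) := by
          calc (1 + ‖deviate x i 0‖) ^ p i ≤ (1 + ‖x‖) ^ p i := by
                have := norm_deviate_zero_le x i
                gcongr
            _ ≤ _ := pow_le_pow_right₀ hone
                (Finset.single_le_sum (fun _ _ => Nat.zero_le _) (Finset.mem_univ i))
        have h4 := le_abs_self (C i)
        gcongr
      _ = _ := by rw [pow_add]; ring
  have h2 : |inner ℝ l (G.g x)| ≤ ‖l‖ * (K * (1 + ‖x‖) ^ (∑ i, p i + 2)) := by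
    refine (abs_real_inner_le_norm _ _).trans ?_
    have h3 := (hK x).trans (mul_le_mul_of_nonneg_left
      (le_self_pow₀ hone (n := ∑ i, p i + 2) (by omega)) hK0)
    gcongr
  have h3 : |C i| ≤ ∑ i, |C i| :=
    Finset.single_le_sum (f := fun i => |C i|) (fun _ _ => abs_nonneg _) (Finset.mem_univ i)
  set X := (1 + ‖x‖) ^ (∑ i, p i + 2) with hX
  have hX0 : 0 ≤ X := by positivity
  calc |G.extendedCost i x l| ≤ |G.J i x| + |inner ℝ l (G.g x)| := abs_add_le _ _
    _ ≤ |C i| * X + ‖l‖ * (K * X) := add_le_add h1 h2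
    _ ≤ (∑ i, |C i| + K) * (1 + ‖l‖) * X := by
        have h4 := mul_le_mul_of_nonneg_right h3 hX0
        have h5 : 0 ≤ (∑ i, |C i|) * ‖l‖ * X := by positivity
        have h6 : 0 ≤ K * X := by positivity
        nlinarith

lemma exists_norm_extendedBlock_sub_le (hreg : G.IsRegular) :
    ∃ L : ℝ, 0 ≤ L ∧ ∀ i, ∀ l ∈ nonnegOrthant n, ∀ a b,
      ‖G.extendedBlock i a l - G.extendedBlock i b l‖ ≤ L * (1 + ‖l‖) * ‖a - b‖ := by
  choose A hA using hreg.lipschitz_block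
  refine ⟨∑ i, (|A i 0| + ‖(A i).linear.toContinuousLinearMap‖), by positivity,
    fun i l hl a b => (hA i l hl a b).trans ?_⟩
  gcongr
  have h1 : A i l = (A i).linear.toContinuousLinearMap l + A i 0 := by
    have := congrFun (A i).decomp l
    simpa using this
  have h2 := (le_abs_self _).trans ((A i).linear.toContinuousLinearMap.le_opNorm l)
  have h3 : |A i 0| + ‖(A i).linear.toContinuousLinearMap‖ ≤
      ∑ i, (|A i 0| + ‖(A i).linear.toContinuousLinearMap‖) :=
    Finset.single_le_sum (f := fun i => |A i 0| + ‖(A i).linear.toContinuousLinearMap‖)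
      (fun _ _ => by positivity) (Finset.mem_univ i)
  have h4 := mul_le_mul_of_nonneg_right h3 (by positivity : (0 : ℝ) ≤ 1 + ‖l‖)
  rw [h1]
  have h5 := le_abs_self (A i 0)
  have h6 : 0 ≤ |A i 0| * ‖l‖ := by positivity
  have h7 := norm_nonneg (A i).linear.toContinuousLinearMap
  linarith

lemma exists_norm_extendedBlock_le (hreg : G.IsRegular) (R : ℝ) :
    ∃ C : ℝ, 0 ≤ C ∧ ∀ i m, ∀ l ∈ nonnegOrthant n, ‖m‖ ≤ R →
      ‖G.extendedBlock i m l‖ ≤ C * (1 + ‖l‖) := by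
  obtain ⟨L, hL0, hL⟩ := exists_norm_extendedBlock_sub_le hreg
  obtain ⟨K, hK⟩ := hreg.lipschitz_g
  refine ⟨‖G.gameMap 0‖ + K + L * |R|, by positivity, fun i m l hl hm => ?_⟩
  have h1 : ‖gradient (fun b => inner ℝ l (G.g b)) 0‖ ≤ ‖l‖ * K := by
    rw [gradient, LinearIsometryEquiv.norm_map]
    refine norm_fderiv_le_of_lip' ℝ (by positivity) (Eventually.of_forall fun x => ?_)
    rw [← inner_sub_right]
    refine (norm_inner_le_norm _ _).trans ?_
    rw [mul_assoc]
    have := hK.norm_sub_le x 0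
    gcongr
  have h2 : ‖G.extendedBlock i 0 l‖ ≤ ‖G.gameMap 0‖ + ‖l‖ * K :=
    (norm_add_le _ _).trans (add_le_add (PiLp.norm_apply_le _ _)
      ((PiLp.norm_apply_le _ _).trans h1))
  have h3 := hL i l hl m 0
  rw [sub_zero] at h3
  have h4 := norm_le_norm_add_norm_sub' (G.extendedBlock i m l) (G.extendedBlock i 0 l)
  have h5 : L * (1 + ‖l‖) * ‖m‖ ≤ L * (1 + ‖l‖) * |R| := by
    have := hm.trans (le_abs_self R)
    gcongr
  have h6 : 0 ≤ ‖G.gameMap 0‖ * ‖l‖ := by positivity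
  have h7 : (0 : ℝ) ≤ K := K.2
  nlinarith

/-- The one-point estimate of the gradient of the extended cost of player `i` at the mean `m`,
from the state `x`. -/
def gradientEstimate (G : CoupledGame N n d) (i : Fin N) (s : Fin N → ℝ) (m : JointSpace d)
    (l : EuclideanSpace ℝ (Fin n)) (x : JointSpace d) : ActionSpace d i :=
  G.extendedCost i x l • ((s i ^ 2)⁻¹ • (x i - m i))

lemma gradientEstimate_add_blockScale (i : Fin N) {s : Fin N → ℝ} (hs : 0 < s i)
    (m ξ : JointSpace d) (l : EuclideanSpace ℝ (Fin n)) :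
    G.gradientEstimate i s m l (m + blockScale s ξ) =
      (G.extendedCost i (m + blockScale s ξ) l * (s i)⁻¹) • ξ i := by
  rw [gradientEstimate, PiLp.add_apply, add_sub_cancel_left, blockScale_apply, smul_smul,
    smul_smul]
  congr 1
  field_simp

lemma one_add_norm_add_blockScale_le {R S : ℝ} {s : Fin N → ℝ} {m : JointSpace d}
    (hs0 : ∀ i, 0 < s i) (hsS : ∀ i, s i ≤ S) (hS : 0 ≤ S) (hm : ‖m‖ ≤ R) (ξ : JointSpace d) :
    1 + ‖m + blockScale s ξ‖ ≤ (1 + R + S) * (1 + ‖ξ‖) := by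
  have h1 := norm_add_le m (blockScale s ξ)
  have h2 := norm_blockScale_le (fun i => (hs0 i).le) hsS hS ξ
  have h3 := norm_nonneg ξ
  have h4 : 0 ≤ R := (norm_nonneg m).trans hm
  nlinarith [mul_nonneg h4 h3]

lemma exists_abs_extendedCost_add_blockScale_le (hreg : G.IsRegular)
    (hgrowth : G.HasQuadraticGrowth) {R S : ℝ} (hR : 0 ≤ R) (hS : 0 ≤ S) :
    ∃ (C : ℝ) (q : ℕ), 0 ≤ C ∧ ∀ (i : Fin N) (s : Fin N → ℝ) (m ξ : JointSpace d)
      (l : EuclideanSpace ℝ (Fin n)), (∀ j, 0 < s j) → (∀ j, s j ≤ S) → ‖m‖ ≤ R →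
      |G.extendedCost i (m + blockScale s ξ) l| ≤ C * (1 + ‖l‖) * (1 + ‖ξ‖) ^ q := by
  obtain ⟨C, q, hC0, hC⟩ := exists_abs_extendedCost_le hreg hgrowth
  refine ⟨C * (1 + R + S) ^ q, q, by positivity, fun i s m ξ l hs0 hsS hm =>
    (hC i _ l).trans ?_⟩
  have h1 := pow_le_pow_left₀ (by positivity)
    (one_add_norm_add_blockScale_le hs0 hsS hS hm ξ) q
  rw [mul_pow] at h1
  calc C * (1 + ‖l‖) * (1 + ‖m + blockScale s ξ‖) ^ q
      ≤ C * (1 + ‖l‖) * ((1 + R + S) ^ q * (1 + ‖ξ‖) ^ q) := by gcongr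
    _ = _ := by ring

/-- The gradient estimate has a bias of the order of the standard deviation. -/
lemma exists_gradientEstimate_bias_le (hG : G.IsConvexGame) (hreg : G.IsRegular)
    (hgrowth : G.HasQuadraticGrowth) {R S : ℝ} (hR : 0 ≤ R) (hS : 0 ≤ S) :
    ∃ C : ℝ, 0 ≤ C ∧ ∀ (i : Fin N) (s : Fin N → ℝ) (sb : ℝ) (m : JointSpace d),
      ∀ l ∈ nonnegOrthant n, ∀ b : ActionSpace d i,
      (∀ j, 0 < s j) → (∀ j, s j ≤ sb) → 0 ≤ sb → sb ≤ S → ‖m‖ ≤ R →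
      Integrable (fun ξ => inner ℝ (G.gradientEstimate i s m l (m + blockScale s ξ)) b)
        (stdGaussian (JointSpace d)) ∧
      |∫ ξ, inner ℝ (G.gradientEstimate i s m l (m + blockScale s ξ)) b
          ∂stdGaussian (JointSpace d) - inner ℝ (G.extendedBlock i m l) b|
        ≤ C * (1 + ‖l‖) * sb * ‖b‖ := by
  obtain ⟨L, hL0, hL⟩ := exists_norm_extendedBlock_sub_le hreg
  obtain ⟨C, q, hC0, hC⟩ := exists_abs_extendedCost_add_blockScale_le hreg hgrowth hR hS
  refine ⟨L * gaussianMoment (JointSpace d) 3, mul_nonneg hL0 (gaussianMoment_nonneg _),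
    fun i s sb m l hl b hs0 hsb hsb0 hsbS hm => ?_⟩
  have hsS : ∀ j, s j ≤ S := fun j => (hsb j).trans hsbS
  set h : JointSpace d → ℝ := fun ξ => G.extendedCost i (m + blockScale s ξ) l with hh
  have hhc : Continuous h := (continuous_extendedCost hG i).comp
    ((continuous_const.add (continuous_blockScale s)).prodMk continuous_const)
  have hdevc : Continuous (fun ξ : JointSpace d => deviate ξ i (0 : ActionSpace d i)) :=
    (PiLp.continuous_toLp 2 _).comp
      ((PiLp.continuous_ofLp 2 _).update i continuous_const)
  have hblk : ∀ ξ : JointSpace d, ‖ξ i‖ ≤ 1 + ‖ξ‖ := fun ξ =>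
    (PiLp.norm_apply_le ξ i).trans (by linarith)
  have hinner : ∀ ξ : JointSpace d, |inner ℝ (ξ i) b| ≤ (1 + ‖ξ‖) * ‖b‖ := fun ξ =>
    (abs_real_inner_le_norm _ _).trans (by have := hblk ξ; gcongr)
  have hinnerc : Continuous (fun ξ : JointSpace d => inner ℝ (ξ i) b) := by fun_prop
  have hint : ∀ k : JointSpace d → JointSpace d, Continuous k → (∀ ξ, ‖k ξ‖ ≤ ‖ξ‖) →
      Integrable (fun ξ => h (k ξ) * (s i)⁻¹ * inner ℝ (ξ i) b) (stdGaussian (JointSpace d)) := by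
    intro k hk hkn
    refine integrable_of_norm_le_pow (C := C * (1 + ‖l‖) * (s i)⁻¹ * ‖b‖) (q := q + 1)
      (((hhc.comp hk).mul continuous_const).mul hinnerc).aestronglyMeasurable fun ξ => ?_
    rw [Real.norm_eq_abs, abs_mul, abs_mul, abs_of_pos (inv_pos.2 (hs0 i))]
    have h1 := hC i s m (k ξ) l hs0 hsS hm
    have h2 := hinner ξ
    have h3 : (1 + ‖k ξ‖) ^ q ≤ (1 + ‖ξ‖) ^ q := by have := hkn ξ; gcongr
    have h4 := (inv_pos.2 (hs0 i)).le
    calc |h (k ξ)| * (s i)⁻¹ * |inner ℝ (ξ i) b|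
        ≤ (C * (1 + ‖l‖) * (1 + ‖ξ‖) ^ q) * (s i)⁻¹ * ((1 + ‖ξ‖) * ‖b‖) := by
          gcongr
          exact h1.trans (by gcongr)
      _ = _ := by rw [pow_succ]; ring
  have hrw : ∀ ξ, inner ℝ (G.gradientEstimate i s m l (m + blockScale s ξ)) b =
      h ξ * (s i)⁻¹ * inner ℝ (ξ i) b := fun ξ => by
    rw [gradientEstimate_add_blockScale i (hs0 i), real_inner_smul_left]
  simp_rw [hrw]
  have hi1 := hint id continuous_id fun ξ => le_rfl
  have hi2 := hint _ hdevc fun ξ => norm_deviate_zero_le ξ i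
  have hi3 : Integrable (fun ξ : JointSpace d =>
      inner ℝ (G.extendedBlock i m l) (ξ i) * inner ℝ (ξ i) b) (stdGaussian (JointSpace d)) := by
    refine integrable_of_norm_le_pow (C := ‖G.extendedBlock i m l‖ * ‖b‖) (q := 2)
      (Continuous.aestronglyMeasurable (by fun_prop)) fun ξ => ?_
    rw [Real.norm_eq_abs, abs_mul]
    calc |inner ℝ (G.extendedBlock i m l) (ξ i)| * |inner ℝ (ξ i) b|
        ≤ (‖G.extendedBlock i m l‖ * (1 + ‖ξ‖)) * ((1 + ‖ξ‖) * ‖b‖) :=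
          mul_le_mul ((abs_real_inner_le_norm _ _).trans (by have := hblk ξ; gcongr))
            (hinner ξ) (abs_nonneg _) (by positivity)
      _ = _ := by ring
  refine ⟨hi1, ?_⟩
  -- Two terms are subtracted under the integral: the cost with block `i` frozen at its mean, of
  -- mean zero by reflection, and the linear part, whose mean is the block itself. The second-order
  -- remainder, divided by `s i`, keeps one factor `sb`.
  have h0 := integral_mul_inner_block_eq_zero i b fun ξ => h ξ * (s i)⁻¹
  have h1 := integral_inner_block_mul_inner_block i (G.extendedBlock i m l) b
  have h2 : ∫ ξ, h ξ * (s i)⁻¹ * inner ℝ (ξ i) b ∂stdGaussian (JointSpace d) -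
      inner ℝ (G.extendedBlock i m l) b =
      ∫ ξ, (h ξ * (s i)⁻¹ * inner ℝ (ξ i) b - h (deviate ξ i 0) * (s i)⁻¹ * inner ℝ (ξ i) b -
        inner ℝ (G.extendedBlock i m l) (ξ i) * inner ℝ (ξ i) b)
          ∂stdGaussian (JointSpace d) := by
    rw [integral_sub, integral_sub, h0, h1, sub_zero]
    exacts [hi1, hi2, hi1.sub hi2, hi3]
  rw [h2]
  refine (abs_integral_le_mul_gaussianMoment (C := L * (1 + ‖l‖) * sb * ‖b‖) (q := 3)
    fun ξ => ?_).trans (le_of_eq (by ring))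
  have hrem : |h ξ - h (deviate ξ i 0) - inner ℝ (G.extendedBlock i m l) (s i • ξ i)| ≤
      L * (1 + ‖l‖) * (sb * ‖ξ‖) * ‖s i • ξ i‖ := by
    set x := m + blockScale s ξ with hx
    have hxm : ‖x - m‖ ≤ sb * ‖ξ‖ := by
      rw [hx, add_sub_cancel_left]
      exact norm_blockScale_le (fun j => (hs0 j).le) hsb hsb0 ξ
    have hdev : m + blockScale s (deviate ξ i 0) = deviate x i (m i) := by
      ext1 j
      rcases eq_or_ne j i with rfl | hj
      · simp
      · simp [deviate_apply_of_ne _ hj, hx]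
    -- Mean value inequality along the segment that moves block `i` alone. Its points are no farther
    -- from `m` than `x`, so the Lipschitz condition bounds the deviation of the derivative from its
    -- value at `m`.
    have key := (convex_segment (m i) (x i)).norm_image_sub_le_of_norm_hasFDerivWithin_le'
      (f := fun z => G.extendedCost i (deviate x i z) l)
      (f' := fun y => InnerProductSpace.toDual ℝ _ (G.extendedBlock i (deviate x i y) l))
      (φ := InnerProductSpace.toDual ℝ _ (G.extendedBlock i m l))
      (C := L * (1 + ‖l‖) * (sb * ‖ξ‖))
      (fun y _ => (hasGradientAt_extendedCost_deviate hG i l x y).hasFDerivAt.hasFDerivWithinAt)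
      (fun y hy => by
        rw [← map_sub, LinearIsometryEquiv.norm_map]
        refine (hL i l hl _ _).trans ?_
        have h5 : ‖y - m i‖ ≤ ‖x i - m i‖ := by
          obtain ⟨θ, hθ, rfl⟩ := (segment_eq_image_lineMap ℝ (m i) (x i)) ▸ hy
          rw [AffineMap.lineMap_apply_module', add_sub_cancel_right, norm_smul,
            Real.norm_of_nonneg hθ.1]
          exact mul_le_of_le_one_left (norm_nonneg _) hθ.2
        have := (norm_deviate_sub_le x m i y h5).trans hxm
        gcongr)
      (left_mem_segment ℝ _ _) (right_mem_segment ℝ _ _)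
    rw [deviate_self, ← hdev, InnerProductSpace.toDual_apply_apply, Real.norm_eq_abs] at key
    have hxi : x i - m i = s i • ξ i := by simp [hx]
    rw [hxi] at key
    exact key
  have hfac : h ξ * (s i)⁻¹ * inner ℝ (ξ i) b - h (deviate ξ i 0) * (s i)⁻¹ * inner ℝ (ξ i) b -
      inner ℝ (G.extendedBlock i m l) (ξ i) * inner ℝ (ξ i) b =
      (h ξ - h (deviate ξ i 0) - inner ℝ (G.extendedBlock i m l) (s i • ξ i)) * (s i)⁻¹ *
        inner ℝ (ξ i) b := by
    rw [real_inner_smul_right]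
    have := (hs0 i).ne'
    field_simp
  rw [hfac, abs_mul, abs_mul, abs_of_pos (inv_pos.2 (hs0 i))]
  rw [norm_smul, Real.norm_of_nonneg (hs0 i).le] at hrem
  have h4 := (inv_pos.2 (hs0 i)).le
  calc _ ≤ (L * (1 + ‖l‖) * (sb * ‖ξ‖) * (s i * ‖ξ i‖)) * (s i)⁻¹ * ((1 + ‖ξ‖) * ‖b‖) := by
        have := hinner ξ
        have := (hs0 i).le
        gcongr
    _ = L * (1 + ‖l‖) * sb * ‖ξ‖ * ‖ξ i‖ * ((1 + ‖ξ‖) * ‖b‖) := by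
        have := (hs0 i).ne'
        field_simp
    _ ≤ L * (1 + ‖l‖) * sb * (1 + ‖ξ‖) * (1 + ‖ξ‖) * ((1 + ‖ξ‖) * ‖b‖) := by
        have := hblk ξ
        have : ‖ξ‖ ≤ 1 + ‖ξ‖ := by linarith
        gcongr
    _ = _ := by ring

end CoupledGame

/-- Bounds on the parameters of one step of the algorithm: the standard deviations `s`, the
effective step sizes `b` of the regular players and `b₀` of the dual player. -/
structure IsStepBound {N : ℕ} (s b : Fin N → ℝ) (b₀ sb κ bm B : ℝ) : Prop where
  s_pos : ∀ i, 0 < s i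
  s_le : ∀ i, s i ≤ sb
  sb_nonneg : 0 ≤ sb
  bm_nonneg : 0 ≤ bm
  bm_le : ∀ i, bm ≤ b i
  le_B : ∀ i, b i ≤ B
  bm_le₀ : bm ≤ b₀
  le_B₀ : b₀ ≤ B
  κ_nonneg : 0 ≤ κ
  le_κ : ∀ i, b i ≤ κ * s i

/-! ### One-step drift of the means and of the multiplier -/

namespace CoupledGame

variable {N n : ℕ} {d : Fin N → ℕ} {G : CoupledGame N n d}

/-- The unprojected update of the means. -/
def meanStep (G : CoupledGame N n d) (s b : Fin N → ℝ) (m : JointSpace d)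
    (l : EuclideanSpace ℝ (Fin n)) (x : JointSpace d) : JointSpace d :=
  WithLp.toLp 2 (fun i => m i - b i • G.gradientEstimate i s m l x)

lemma continuous_gradientEstimate (hG : G.IsConvexGame) (i : Fin N) (s : Fin N → ℝ) :
    Continuous (fun p : (JointSpace d × EuclideanSpace ℝ (Fin n)) × JointSpace d =>
      G.gradientEstimate i s p.1.1 p.1.2 p.2) := by
  have h := (continuous_extendedCost hG i).comp
    (f := fun p : (JointSpace d × EuclideanSpace ℝ (Fin n)) × JointSpace d => (p.2, p.1.2))
    (by fun_prop)
  unfold gradientEstimate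
  exact h.smul (by fun_prop)

lemma continuous_meanStep (hG : G.IsConvexGame) (s b : Fin N → ℝ) :
    Continuous (fun p : (JointSpace d × EuclideanSpace ℝ (Fin n)) × JointSpace d =>
      G.meanStep s b p.1.1 p.1.2 p.2) := by
  refine (PiLp.continuous_toLp 2 _).comp (continuous_pi fun i => ?_)
  have := continuous_gradientEstimate hG i s
  fun_prop

/-- The estimate has a factor `1 / s i`, so the step is controlled through the ratio `b i / s i ≤ κ`
and not through `b i` alone. -/
lemma exists_norm_smul_gradientEstimate_sq_le (hreg : G.IsRegular)
    (hgrowth : G.HasQuadraticGrowth) {R S : ℝ} (hR : 0 ≤ R) (hS : 0 ≤ S) :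
    ∃ (C : ℝ) (q : ℕ), 0 ≤ C ∧ ∀ (i : Fin N) (s b : Fin N → ℝ) (b₀ sb κ bm B : ℝ)
      (m ξ : JointSpace d) (l : EuclideanSpace ℝ (Fin n)), IsStepBound s b b₀ sb κ bm B →
      sb ≤ S → ‖m‖ ≤ R →
      ‖b i • G.gradientEstimate i s m l (m + blockScale s ξ)‖ ^ 2 ≤
        C * κ ^ 2 * (1 + ‖l‖ ^ 2) * (1 + ‖ξ‖) ^ q := by
  obtain ⟨C, q, hC0, hC⟩ := exists_abs_extendedCost_add_blockScale_le hreg hgrowth hR hS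
  refine ⟨2 * C ^ 2, 2 * (q + 1), by positivity, fun i s b b₀ sb κ bm B m ξ l hb hsb hm => ?_⟩
  have hs := hb.s_pos i
  have hbi : 0 ≤ b i := hb.bm_nonneg.trans (hb.bm_le i)
  have hκ := hb.κ_nonneg
  have h1 := hC i s m ξ l hb.s_pos (fun j => (hb.s_le j).trans hsb) hm
  have h2 : ‖b i • G.gradientEstimate i s m l (m + blockScale s ξ)‖ ≤
      κ * C * (1 + ‖l‖) * (1 + ‖ξ‖) ^ (q + 1) := by
    rw [gradientEstimate_add_blockScale i hs, norm_smul, norm_smul, Real.norm_of_nonneg hbi,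
      norm_mul, Real.norm_eq_abs, Real.norm_of_nonneg (inv_pos.2 hs).le]
    have h3 : b i * (s i)⁻¹ ≤ κ := by
      rw [← div_eq_mul_inv, div_le_iff₀ hs]; exact hb.le_κ i
    have h4 : ‖ξ i‖ ≤ 1 + ‖ξ‖ := (PiLp.norm_apply_le ξ i).trans (by linarith)
    calc _ = (b i * (s i)⁻¹) * |G.extendedCost i (m + blockScale s ξ) l| * ‖ξ i‖ := by ring
      _ ≤ κ * (C * (1 + ‖l‖) * (1 + ‖ξ‖) ^ q) * (1 + ‖ξ‖) := by gcongr
      _ = _ := by rw [pow_succ]; ring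
  calc _ ≤ (κ * C * (1 + ‖l‖) * (1 + ‖ξ‖) ^ (q + 1)) ^ 2 := by gcongr
    _ = κ ^ 2 * C ^ 2 * (1 + ‖l‖) ^ 2 * (1 + ‖ξ‖) ^ (2 * (q + 1)) := by rw [pow_mul']; ring
    _ ≤ κ ^ 2 * C ^ 2 * (2 * (1 + ‖l‖ ^ 2)) * (1 + ‖ξ‖) ^ (2 * (q + 1)) := by
        have : (1 + ‖l‖) ^ 2 ≤ 2 * (1 + ‖l‖ ^ 2) := by nlinarith [sq_nonneg (1 - ‖l‖)]
        gcongr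
    _ = _ := by ring

lemma exists_norm_meanStep_sub_sq_le (hreg : G.IsRegular)
    (hgrowth : G.HasQuadraticGrowth) {R S : ℝ} (hR : 0 ≤ R) (hS : 0 ≤ S) :
    ∃ (C : ℝ) (q : ℕ), 0 ≤ C ∧ ∀ (s b : Fin N → ℝ) (b₀ sb κ bm B : ℝ)
      (m ξ : JointSpace d) (l : EuclideanSpace ℝ (Fin n)), IsStepBound s b b₀ sb κ bm B →
      sb ≤ S → ‖m‖ ≤ R →
      ‖G.meanStep s b m l (m + blockScale s ξ) - m‖ ^ 2 ≤
        C * κ ^ 2 * (1 + ‖l‖ ^ 2) * (1 + ‖ξ‖) ^ q := by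
  obtain ⟨C, q, hC0, hC⟩ := exists_norm_smul_gradientEstimate_sq_le hreg hgrowth hR hS
  refine ⟨N * C, q, by positivity, fun s b b₀ sb κ bm B m ξ l hb hsb hm => ?_⟩
  rw [PiLp.norm_sq_eq_of_L2]
  calc ∑ i, ‖(G.meanStep s b m l (m + blockScale s ξ) - m) i‖ ^ 2
      ≤ ∑ _i : Fin N, C * κ ^ 2 * (1 + ‖l‖ ^ 2) * (1 + ‖ξ‖) ^ q := by
        refine Finset.sum_le_sum fun i _ => ?_
        rw [PiLp.sub_apply, meanStep]
        simp only [sub_sub_cancel_left, norm_neg]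
        exact hC i s b b₀ sb κ bm B m ξ l hb hsb hm
    _ = _ := by simp; ring

/-- Expand the square around `m`: the cross term is the pairing with the true block up to the bias,
which costs `B * sb`, and the squared step costs `κ ^ 2`. -/
lemma exists_integral_meanStep_le (hG : G.IsConvexGame) (hreg : G.IsRegular)
    (hgrowth : G.HasQuadraticGrowth) {R S : ℝ} (hR : 0 ≤ R) (hS : 0 ≤ S) (a : JointSpace d) :
    ∃ C : ℝ, 0 ≤ C ∧ ∀ (s b : Fin N → ℝ) (b₀ sb κ bm B : ℝ) (m : JointSpace d),
      ∀ l ∈ nonnegOrthant n, IsStepBound s b b₀ sb κ bm B → sb ≤ S → ‖m‖ ≤ R →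
      ∫ ξ, ‖G.meanStep s b m l (m + blockScale s ξ) - a‖ ^ 2 ∂stdGaussian (JointSpace d) ≤
        ‖m - a‖ ^ 2 - 2 * ∑ i, b i * inner ℝ (G.extendedBlock i m l) (m i - a i) +
          C * (B * sb + κ ^ 2) * (1 + ‖l‖ ^ 2) := by
  obtain ⟨C₁, hC₁0, hC₁⟩ := exists_gradientEstimate_bias_le hG hreg hgrowth hR hS
  obtain ⟨C₂, q, hC₂0, hC₂⟩ := exists_norm_meanStep_sub_sq_le hreg hgrowth hR hS
  set M := gaussianMoment (JointSpace d) q with hM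
  have hM0 : 0 ≤ M := gaussianMoment_nonneg q
  refine ⟨4 * N * C₁ * (R + ‖a‖) + C₂ * M, by positivity,
    fun s b b₀ sb κ bm B m l hl hb hsb hm => ?_⟩
  set Γ : Fin N → JointSpace d → ℝ := fun i ξ =>
    inner ℝ (G.gradientEstimate i s m l (m + blockScale s ξ)) (m i - a i) with hΓ
  have hbias := fun i => hC₁ i s sb m l hl (m i - a i) hb.s_pos hb.s_le hb.sb_nonneg hsb hm
  have hΓi : ∀ i, Integrable (Γ i) (stdGaussian (JointSpace d)) := fun i => (hbias i).1
  have hstepc : Continuous (fun ξ => G.meanStep s b m l (m + blockScale s ξ)) :=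
    (continuous_meanStep hG s b).comp (f := fun ξ => ((m, l), m + blockScale s ξ))
      (continuous_const.prodMk (continuous_const.add (continuous_blockScale s)))
  have hQb : ∀ ξ, |‖G.meanStep s b m l (m + blockScale s ξ) - m‖ ^ 2| ≤
      C₂ * κ ^ 2 * (1 + ‖l‖ ^ 2) * (1 + ‖ξ‖) ^ q := fun ξ => by
    rw [abs_of_nonneg (sq_nonneg _)]
    exact hC₂ s b b₀ sb κ bm B m ξ l hb hsb hm
  have hQi : Integrable (fun ξ => ‖G.meanStep s b m l (m + blockScale s ξ) - m‖ ^ 2)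
      (stdGaussian (JointSpace d)) :=
    integrable_of_norm_le_pow (Continuous.aestronglyMeasurable (by fun_prop)) hQb
  have hexp : ∀ ξ, ‖G.meanStep s b m l (m + blockScale s ξ) - a‖ ^ 2 =
      ‖m - a‖ ^ 2 + (- 2 * ∑ i, b i * Γ i ξ +
        ‖G.meanStep s b m l (m + blockScale s ξ) - m‖ ^ 2) := fun ξ => by
    have h1 : G.meanStep s b m l (m + blockScale s ξ) - a =
        (m - a) + (G.meanStep s b m l (m + blockScale s ξ) - m) := by abel
    have h2 : inner ℝ (m - a) (G.meanStep s b m l (m + blockScale s ξ) - m) =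
        - ∑ i, b i * Γ i ξ := by
      rw [PiLp.inner_apply, ← Finset.sum_neg_distrib]
      refine Finset.sum_congr rfl fun i _ => ?_
      rw [PiLp.sub_apply, PiLp.sub_apply, meanStep]
      simp only [sub_sub_cancel_left, inner_neg_right, real_inner_smul_right, hΓ]
      rw [real_inner_comm]
    rw [h1, norm_add_sq_real, h2]
    ring
  have hsumi : Integrable (fun ξ => - 2 * ∑ i, b i * Γ i ξ) (stdGaussian (JointSpace d)) :=
    (integrable_finsetSum _ fun i _ => (hΓi i).const_mul (b i)).const_mul _
  have hQ2 : Integrable (fun ξ => - 2 * ∑ i, b i * Γ i ξ +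
      ‖G.meanStep s b m l (m + blockScale s ξ) - m‖ ^ 2) (stdGaussian (JointSpace d)) :=
    hsumi.add hQi
  simp_rw [hexp]
  rw [integral_add (integrable_const _) hQ2, integral_add hsumi hQi, integral_const_mul,
    integral_finsetSum _ fun i _ => (hΓi i).const_mul (b i)]
  simp_rw [integral_const_mul]
  have hQ := integral_le_mul_gaussianMoment hQb
  rw [← hM] at hQ
  have hB0 : 0 ≤ B := hb.bm_nonneg.trans (hb.bm_le₀.trans hb.le_B₀)
  have hsb0 := hb.sb_nonneg
  have hterm : ∀ i, b i * inner ℝ (G.extendedBlock i m l) (m i - a i) -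
      2 * B * C₁ * (1 + ‖l‖ ^ 2) * sb * (R + ‖a‖) ≤
      b i * ∫ ξ, Γ i ξ ∂stdGaussian (JointSpace d) := fun i => by
    have hbi : 0 ≤ b i := hb.bm_nonneg.trans (hb.bm_le i)
    have h1 := (abs_le.1 (hbias i).2).1
    have h2 : ‖m i - a i‖ ≤ R + ‖a‖ :=
      (PiLp.norm_apply_le (m - a) i).trans ((norm_sub_le _ _).trans (by linarith))
    have h3 : 1 + ‖l‖ ≤ 2 * (1 + ‖l‖ ^ 2) := by nlinarith [sq_nonneg (1 - ‖l‖)]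
    have h4 : b i * (C₁ * (1 + ‖l‖) * sb * ‖m i - a i‖) ≤
        B * (C₁ * (2 * (1 + ‖l‖ ^ 2)) * sb * (R + ‖a‖)) := by
      have := hb.le_B i
      gcongr
    have h5 := mul_le_mul_of_nonneg_left h1 hbi
    simp only [hΓ]
    linarith
  have hsum := Finset.sum_le_sum fun i (_ : i ∈ Finset.univ) => hterm i
  rw [Finset.sum_sub_distrib] at hsum
  simp only [Finset.sum_const, Finset.card_univ, Fintype.card_fin, nsmul_eq_mul] at hsum
  simp only [integral_const, probReal_univ, one_smul]
  have e1 : 0 ≤ N * C₁ * (R + ‖a‖) * κ ^ 2 * (1 + ‖l‖ ^ 2) := by positivity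
  have e2 : 0 ≤ C₂ * M * (B * sb) * (1 + ‖l‖ ^ 2) := by positivity
  nlinarith only [hsum, hQ, e1, e2]

lemma exists_norm_g_add_blockScale_sq_le (hreg : G.IsRegular) {R S : ℝ} (hS : 0 ≤ S) :
    ∃ C : ℝ, 0 ≤ C ∧ ∀ (s : Fin N → ℝ) (m ξ : JointSpace d), (∀ j, 0 < s j) → (∀ j, s j ≤ S) →
      ‖m‖ ≤ R → ‖G.g (m + blockScale s ξ)‖ ^ 2 ≤ C * (1 + ‖ξ‖) ^ 2 := by
  obtain ⟨C, hC0, hC⟩ := exists_norm_g_le hreg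
  refine ⟨(C * (1 + R + S)) ^ 2, by positivity, fun s m ξ hs0 hsS hm => ?_⟩
  rw [← mul_pow]
  have h1 := one_add_norm_add_blockScale_le hs0 hsS hS hm ξ
  have h2 := (hC (m + blockScale s ξ)).trans (mul_le_mul_of_nonneg_left h1 hC0)
  rw [← mul_assoc] at h2
  gcongr

/-- The constraint is observed at the state and not at the mean, which costs `B * sb` by the
Lipschitz condition. There is no division by a deviation here, so the squared step costs only `B ^
2`. -/
lemma exists_integral_dualStep_le (hG : G.IsConvexGame) (hreg : G.IsRegular)
    {R S : ℝ} (hS : 0 ≤ S) (ls : EuclideanSpace ℝ (Fin n)) :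
    ∃ C : ℝ, 0 ≤ C ∧ ∀ (s b : Fin N → ℝ) (b₀ sb κ bm B : ℝ) (m : JointSpace d)
      (l : EuclideanSpace ℝ (Fin n)), IsStepBound s b b₀ sb κ bm B → sb ≤ S → ‖m‖ ≤ R →
      ∫ ξ, ‖l + b₀ • G.g (m + blockScale s ξ) - ls‖ ^ 2 ∂stdGaussian (JointSpace d) ≤
        ‖l - ls‖ ^ 2 + 2 * b₀ * inner ℝ (G.g m) (l - ls) +
          C * (B * sb + B ^ 2) * (1 + ‖l‖ ^ 2) := by
  obtain ⟨K, hK⟩ := hreg.lipschitz_g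
  obtain ⟨C, hC0, hC⟩ := exists_norm_g_add_blockScale_sq_le hreg hS
  set M₁ := gaussianMoment (JointSpace d) 1 with hM₁
  set M₂ := gaussianMoment (JointSpace d) 2 with hM₂
  have hM₁0 : 0 ≤ M₁ := gaussianMoment_nonneg 1
  have hM₂0 : 0 ≤ M₂ := gaussianMoment_nonneg 2
  refine ⟨4 * K * M₁ * (1 + ‖ls‖) + C * M₂, by positivity,
    fun s b b₀ sb κ bm B m l hb hsb hm => ?_⟩
  have hb₀ : 0 ≤ b₀ := hb.bm_nonneg.trans hb.bm_le₀
  have hB0 : 0 ≤ B := hb₀.trans hb.le_B₀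
  have hsb0 := hb.sb_nonneg
  have hgc : Continuous (fun ξ => G.g (m + blockScale s ξ)) :=
    (continuous_g hG).comp (continuous_const.add (continuous_blockScale s))
  have hb1 : ∀ ξ, |inner ℝ (G.g (m + blockScale s ξ) - G.g m) (l - ls)| ≤
      (K * sb * ‖l - ls‖) * (1 + ‖ξ‖) ^ 1 := fun ξ => by
    refine (abs_real_inner_le_norm _ _).trans ?_
    have h1 := hK.norm_sub_le (m + blockScale s ξ) m
    rw [add_sub_cancel_left] at h1
    have h2 := norm_blockScale_le (fun i => (hb.s_pos i).le) hb.s_le hsb0 ξ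
    calc _ ≤ (K * (sb * (1 + ‖ξ‖))) * ‖l - ls‖ := by
          gcongr
          refine h1.trans ?_
          gcongr
          refine h2.trans ?_
          gcongr
          linarith
      _ = _ := by ring
  have hb2 : ∀ ξ, |‖G.g (m + blockScale s ξ)‖ ^ 2| ≤ C * (1 + ‖ξ‖) ^ 2 := fun ξ => by
    rw [abs_of_nonneg (sq_nonneg _)]
    exact hC s m ξ hb.s_pos (fun j => (hb.s_le j).trans hsb) hm
  have hi1 : Integrable (fun ξ => inner ℝ (G.g (m + blockScale s ξ) - G.g m) (l - ls))
      (stdGaussian (JointSpace d)) :=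
    integrable_of_norm_le_pow (Continuous.aestronglyMeasurable (by fun_prop)) hb1
  have hi2 : Integrable (fun ξ => ‖G.g (m + blockScale s ξ)‖ ^ 2) (stdGaussian (JointSpace d)) :=
    integrable_of_norm_le_pow (Continuous.aestronglyMeasurable (by fun_prop)) hb2
  have hexp : ∀ ξ, ‖l + b₀ • G.g (m + blockScale s ξ) - ls‖ ^ 2 =
      (‖l - ls‖ ^ 2 + 2 * b₀ * inner ℝ (G.g m) (l - ls)) +
        (2 * b₀ * inner ℝ (G.g (m + blockScale s ξ) - G.g m) (l - ls) +
          b₀ ^ 2 * ‖G.g (m + blockScale s ξ)‖ ^ 2) := fun ξ => by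
    have h1 : l + b₀ • G.g (m + blockScale s ξ) - ls =
        (l - ls) + b₀ • G.g (m + blockScale s ξ) := by abel
    rw [h1, norm_add_sq_real, real_inner_smul_right, norm_smul, mul_pow, Real.norm_of_nonneg hb₀,
      inner_sub_left (G.g (m + blockScale s ξ)), real_inner_comm (G.g (m + blockScale s ξ))]
    ring
  have hi3 : Integrable (fun ξ => 2 * b₀ * inner ℝ (G.g (m + blockScale s ξ) - G.g m) (l - ls) +
      b₀ ^ 2 * ‖G.g (m + blockScale s ξ)‖ ^ 2) (stdGaussian (JointSpace d)) :=
    (hi1.const_mul _).add (hi2.const_mul _)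
  simp_rw [hexp]
  rw [integral_add (integrable_const _) hi3, integral_add (hi1.const_mul _) (hi2.const_mul _),
    integral_const_mul, integral_const_mul]
  simp only [integral_const, probReal_univ, one_smul]
  have h1 := integral_le_mul_gaussianMoment hb1
  have h2 := integral_le_mul_gaussianMoment hb2
  rw [← hM₁] at h1
  rw [← hM₂] at h2
  have h3 : ‖l - ls‖ ≤ 2 * (1 + ‖ls‖) * (1 + ‖l‖ ^ 2) := by
    have := norm_sub_le l ls
    have h5 := norm_nonneg ls
    nlinarith [sq_nonneg (1 - ‖l‖), mul_nonneg h5 (sq_nonneg ‖l‖)]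
  have h4 : 2 * b₀ * ∫ ξ, inner ℝ (G.g (m + blockScale s ξ) - G.g m) (l - ls)
      ∂stdGaussian (JointSpace d) ≤
      2 * B * (K * sb * (2 * (1 + ‖ls‖) * (1 + ‖l‖ ^ 2)) * M₁) := by
    have hle := hb.le_B₀
    refine (mul_le_mul_of_nonneg_left h1 (by positivity)).trans ?_
    gcongr
  have h5 : b₀ ^ 2 * ∫ ξ, ‖G.g (m + blockScale s ξ)‖ ^ 2 ∂stdGaussian (JointSpace d) ≤
      B ^ 2 * (C * M₂) * (1 + ‖l‖ ^ 2) := by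
    have hle := hb.le_B₀
    refine (mul_le_mul_of_nonneg_left h2 (by positivity)).trans ?_
    have : b₀ ^ 2 * (C * M₂) ≤ B ^ 2 * (C * M₂) := by gcongr
    refine this.trans (le_mul_of_one_le_right (by positivity) (by nlinarith [sq_nonneg ‖l‖]))
  have e1 : 0 ≤ 4 * K * M₁ * (1 + ‖ls‖) * B ^ 2 * (1 + ‖l‖ ^ 2) := by positivity
  have e2 : 0 ≤ C * M₂ * (B * sb) * (1 + ‖l‖ ^ 2) := by positivity
  linarith

/-- Absorbs the weight `1 + ‖l‖ ^ 2` of the error terms into the Lyapunov function; `r` stands for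
its part from the means. -/
lemma one_add_norm_sq_le {E : Type*} [NormedAddCommGroup E] (l ls : E) {r : ℝ} (hr : 0 ≤ r) :
    1 + ‖l‖ ^ 2 ≤ (2 + 2 * ‖ls‖ ^ 2) * (1 + (r + ‖l - ls‖ ^ 2)) := by
  have h3 : ‖l‖ ≤ ‖l - ls‖ + ‖ls‖ := by simpa using norm_add_le (l - ls) ls
  have h4 := pow_le_pow_left₀ (norm_nonneg l) h3 2
  have h6 : 0 ≤ ‖ls‖ ^ 2 * (r + ‖l - ls‖ ^ 2) := by positivity
  nlinarith only [h4, h6, hr, sq_nonneg (‖l - ls‖ - ‖ls‖)]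

set_option maxHeartbeats 1000000 in
/-- The drift of the Lyapunov function and of the distance of the means to the equilibrium. -/
theorem exists_drift_le (hG : G.IsConvexGame) (hreg : G.IsRegular)
    (hgrowth : G.HasQuadraticGrowth) {R S : ℝ} (hR : 0 ≤ R) (hS : 0 ≤ S) {a : JointSpace d}
    {ls : EuclideanSpace ℝ (Fin n)} {D : JointSpace d → ℝ}
    (hD : ∀ b ∈ G.jointActions, ∀ l ∈ nonnegOrthant n,
      D b ≤ ∑ i, inner ℝ (G.extendedBlock i b l) (b i - a i) - inner ℝ (G.g b) (l - ls)) :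
    ∃ C : ℝ, 0 ≤ C ∧ ∀ (s b : Fin N → ℝ) (b₀ sb κ bm B : ℝ), ∀ m ∈ G.jointActions,
      ∀ l ∈ nonnegOrthant n, IsStepBound s b b₀ sb κ bm B → sb ≤ S → ‖m‖ ≤ R →
      (∫ ξ, ‖G.meanStep s b m l (m + blockScale s ξ) - a‖ ^ 2 ∂stdGaussian (JointSpace d) +
        ∫ ξ, ‖l + b₀ • G.g (m + blockScale s ξ) - ls‖ ^ 2 ∂stdGaussian (JointSpace d) ≤
        (1 + C * (B * sb + κ ^ 2 + B ^ 2 + (B - bm))) * (‖m - a‖ ^ 2 + ‖l - ls‖ ^ 2) +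
          C * (B * sb + κ ^ 2 + B ^ 2 + (B - bm)) - 2 * bm * D m) ∧
      ∫ ξ, ‖G.meanStep s b m l (m + blockScale s ξ) - a‖ ^ 2 ∂stdGaussian (JointSpace d) ≤
        ‖m - a‖ ^ 2 + C * (bm + (B * sb + κ ^ 2 + B ^ 2 + (B - bm))) * (1 + ‖l‖ ^ 2) := by
  obtain ⟨C₁, hC₁0, hC₁⟩ := exists_integral_meanStep_le hG hreg hgrowth hR hS a
  obtain ⟨C₂, hC₂0, hC₂⟩ := exists_integral_dualStep_le hG hreg hS ls
  obtain ⟨C₃, hC₃0, hC₃⟩ := exists_norm_extendedBlock_le hreg R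
  obtain ⟨K, hK0, hK⟩ := exists_norm_g_le hreg
  -- a common bound for the pairing of the extended game mapping with `z - z*`
  set C₄ : ℝ := 2 * N * C₃ * (R + ‖a‖) + 2 * K * (1 + R) * (1 + ‖ls‖) with hC₄
  have hC₄0 : 0 ≤ C₄ := by positivity
  set Cs : ℝ := C₁ + C₂ + 2 * C₄ with hCs
  have hCs0 : 0 ≤ Cs := by positivity
  refine ⟨Cs * (2 + 2 * ‖ls‖ ^ 2), by positivity,
    fun s b b₀ sb κ bm B m hm l hl hb hsb hmR => ?_⟩
  have h1 := hC₁ s b b₀ sb κ bm B m l hl hb hsb hmR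
  have h2 := hC₂ s b b₀ sb κ bm B m l hb hsb hmR
  have hb₀ : 0 ≤ b₀ := hb.bm_nonneg.trans hb.bm_le₀
  have hB0 : 0 ≤ B := hb₀.trans hb.le_B₀
  have hsb0 := hb.sb_nonneg
  have hbm0 := hb.bm_nonneg
  have hBbm : 0 ≤ B - bm := by linarith [hb.bm_le₀, hb.le_B₀]
  set Λ : ℝ := 1 + ‖l‖ ^ 2 with hΛ
  have hΛ1 : 1 ≤ Λ := by rw [hΛ]; nlinarith [sq_nonneg ‖l‖]
  have hl1 : 1 + ‖l‖ ≤ 2 * Λ := by rw [hΛ]; nlinarith [sq_nonneg (1 - ‖l‖)]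
  have hT : ∀ i, |inner ℝ (G.extendedBlock i m l) (m i - a i)| ≤
      2 * C₃ * (R + ‖a‖) * Λ := fun i => by
    refine (abs_real_inner_le_norm _ _).trans ?_
    have h3 := hC₃ i m l hl hmR
    have h4 : ‖m i - a i‖ ≤ R + ‖a‖ :=
      (PiLp.norm_apply_le (m - a) i).trans ((norm_sub_le _ _).trans (by linarith))
    calc _ ≤ (C₃ * (2 * Λ)) * (R + ‖a‖) := by
          gcongr
          exact h3.trans (by gcongr)
      _ = _ := by ring
  have hdual : |inner ℝ (G.g m) (l - ls)| ≤ 2 * K * (1 + R) * (1 + ‖ls‖) * Λ := by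
    refine (abs_real_inner_le_norm _ _).trans ?_
    have h3 : ‖G.g m‖ ≤ K * (1 + R) := (hK m).trans (by gcongr)
    have h4 : ‖l - ls‖ ≤ (1 + ‖ls‖) * (2 * Λ) := by
      have h5 := norm_sub_le l ls
      have h6 : (1 + ‖l‖) * (1 + ‖ls‖) ≤ 2 * Λ * (1 + ‖ls‖) := by gcongr
      have h7 : 0 ≤ ‖l‖ * ‖ls‖ := by positivity
      linarith
    calc _ ≤ (K * (1 + R)) * ((1 + ‖ls‖) * (2 * Λ)) := by gcongr
      _ = _ := by ring
  -- replacing all the step sizes by `bm` costs a multiple of `B - bm`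
  have hdiff : ∀ {β y Y : ℝ}, bm ≤ β → β ≤ B → |y| ≤ Y → bm * y - (B - bm) * Y ≤ β * y := by
    intro β y Y h3 h4 h5
    have h6 := neg_le_of_abs_le h5
    have h7 : 0 ≤ Y := (abs_nonneg y).trans h5
    nlinarith [mul_le_mul_of_nonneg_right h4 h7]
  have hsum1 : bm * ∑ i, inner ℝ (G.extendedBlock i m l) (m i - a i) -
      (B - bm) * (N * (2 * C₃ * (R + ‖a‖) * Λ)) ≤
      ∑ i, b i * inner ℝ (G.extendedBlock i m l) (m i - a i) := by
    have := Finset.sum_le_sum fun i (_ : i ∈ Finset.univ) =>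
      hdiff (hb.bm_le i) (hb.le_B i) (hT i)
    rw [Finset.sum_sub_distrib, ← Finset.mul_sum] at this
    simpa [mul_assoc, mul_comm, mul_left_comm] using this
  have hdual1 := hdiff hb.bm_le₀ hb.le_B₀ (y := - inner ℝ (G.g m) (l - ls))
    ((abs_neg _).trans_le hdual)
  -- For the means alone there is no dual term to combine with the pairing into `D`, so it is
  -- bounded in absolute value; hence the drift of order `bm` in the second claim.
  have hsum2 : - (B * (N * (2 * C₃ * (R + ‖a‖) * Λ))) ≤
      ∑ i, b i * inner ℝ (G.extendedBlock i m l) (m i - a i) := by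
    have : ∀ i, - (B * (2 * C₃ * (R + ‖a‖) * Λ)) ≤
        b i * inner ℝ (G.extendedBlock i m l) (m i - a i) := fun i => by
      have hbi : 0 ≤ b i := hbm0.trans (hb.bm_le i)
      refine (abs_le.1 ?_).1
      rw [abs_mul, abs_of_nonneg hbi]
      exact mul_le_mul (hb.le_B i) (hT i) (abs_nonneg _) hB0
    have := Finset.sum_le_sum fun i (_ : i ∈ Finset.univ) => this i
    simpa [mul_assoc, mul_comm, mul_left_comm] using this
  have hDm := mul_le_mul_of_nonneg_left (hD m hm l hl) hbm0
  have hΛV : Λ ≤ (2 + 2 * ‖ls‖ ^ 2) * (1 + (‖m - a‖ ^ 2 + ‖l - ls‖ ^ 2)) :=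
    one_add_norm_sq_le l ls (sq_nonneg _)
  set e := B * sb + κ ^ 2 + B ^ 2 + (B - bm) with he
  have q1 : 0 ≤ B * sb := mul_nonneg hB0 hsb0
  have q2 : 0 ≤ κ ^ 2 := sq_nonneg κ
  have q3 : 0 ≤ B ^ 2 := sq_nonneg B
  have he0 : 0 ≤ e := by positivity
  have p1 : C₁ * (B * sb + κ ^ 2) * Λ ≤ C₁ * e * Λ := by
    gcongr; linarith only [he, q3, hBbm]
  have p2 : C₂ * (B * sb + B ^ 2) * Λ ≤ C₂ * e * Λ := by
    gcongr; linarith only [he, q2, hBbm]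
  have p3 : (B - bm) * (C₄ * Λ) ≤ e * (C₄ * Λ) := by
    gcongr; linarith only [he, q1, q2, q3]
  have hC₄Λ : C₄ * Λ = N * (2 * C₃ * (R + ‖a‖) * Λ) + 2 * K * (1 + R) * (1 + ‖ls‖) * Λ := by
    rw [hC₄]; ring
  refine ⟨?_, ?_⟩
  · have h3 : Cs * e * Λ ≤
        Cs * e * ((2 + 2 * ‖ls‖ ^ 2) * (1 + (‖m - a‖ ^ 2 + ‖l - ls‖ ^ 2))) := by gcongr
    have h4 : Cs * e * Λ = C₁ * e * Λ + C₂ * e * Λ + 2 * (e * (C₄ * Λ)) := by rw [hCs]; ring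
    have h5 : (B - bm) * (C₄ * Λ) = (B - bm) * (N * (2 * C₃ * (R + ‖a‖) * Λ)) +
      (B - bm) * (2 * K * (1 + R) * (1 + ‖ls‖) * Λ) := by rw [hC₄Λ]; ring
    linarith only [h1, h2, h3, h4, h5, p1, p2, p3, hsum1, hdual1, hDm]
  · have h5 : bm + (B - bm) ≤ bm + e := by linarith only [he, q1, q2, q3]
    have p4 : B * (N * (2 * C₃ * (R + ‖a‖) * Λ)) ≤ (bm + e) * (C₄ * Λ) := by
      have h6 : N * (2 * C₃ * (R + ‖a‖) * Λ) ≤ C₄ * Λ := by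
        rw [hC₄Λ]; exact le_add_of_nonneg_right (by positivity)
      have h7 : B ≤ bm + e := by linarith only [h5]
      have : 0 ≤ C₄ * Λ := by positivity
      gcongr
    have h8 : C₁ * e * Λ ≤ C₁ * (bm + e) * Λ := by gcongr; linarith only [hbm0]
    have h9 : 0 ≤ C₂ * (bm + e) * Λ := by positivity
    have h10 : Cs * (bm + e) * Λ ≤ Cs * (2 + 2 * ‖ls‖ ^ 2) * (bm + e) * Λ := by
      gcongr
      exact le_mul_of_one_le_right hCs0 (by linarith only [sq_nonneg ‖ls‖])
    have h12 : Cs * (bm + e) * Λ =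
        C₁ * (bm + e) * Λ + C₂ * (bm + e) * Λ + 2 * ((bm + e) * (C₄ * Λ)) := by rw [hCs]; ring
    linarith only [h1, h8, h9, h10, h12, p1, p4, hsum2]

end CoupledGame

/-! ### Fresh noise relative to a sub-σ-algebra -/

section FreshNoise

variable {Ω E X Y : Type*} {m mΩ : MeasurableSpace Ω} {P : Measure Ω} [IsProbabilityMeasure P]
  [MeasurableSpace E] [MeasurableSpace X] [MeasurableSpace Y]
  {ν : Measure X} [IsProbabilityMeasure ν]

lemma measurable_uncurry_comp {Ω' : Type*} {mΩ' : MeasurableSpace Ω'} {T : E → X → Y}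
    (hT : Measurable (Function.uncurry T)) {z : Ω' → E} (hz : Measurable z) :
    Measurable (Function.uncurry fun ω => T (z ω)) :=
  hT.comp ((hz.comp measurable_fst).prodMk measurable_snd)

lemma measure_inter_preimage_eq_setLIntegral_of_condLaw (hm : m ≤ mΩ) {x : Ω → Y}
    (hx : Measurable x) {k : Ω → Measure Y} [∀ ω, IsProbabilityMeasure (k ω)] {B : Set Y}
    (hB : MeasurableSet B) (hk : Measurable (fun ω => k ω B))
    (hlaw : P⟦x ⁻¹' B | m⟧ =ᵐ[P] fun ω => (k ω).real B) {A : Set Ω} (hA : MeasurableSet[m] A) :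
    P (A ∩ x ⁻¹' B) = ∫⁻ ω in A, k ω B ∂P := by
  have h1 : ∫ ω in A, (P⟦x ⁻¹' B | m⟧) ω ∂P = P.real (A ∩ x ⁻¹' B) := by
    rw [setIntegral_condExp hm ((integrable_const 1).indicator (hx hB)) hA,
      integral_indicator (hx hB), Measure.restrict_restrict (hx hB), Set.inter_comm]
    simp
  have h2 : ∫ ω in A, (P⟦x ⁻¹' B | m⟧) ω ∂P = (∫⁻ ω in A, k ω B ∂P).toReal := by
    rw [integral_congr_ae (ae_restrict_of_ae hlaw)]
    exact integral_toReal hk.aemeasurable (Eventually.of_forall fun ω => measure_lt_top _ _)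
  have h3 : ∫⁻ ω in A, k ω B ∂P ≠ ⊤ := by
    refine ne_top_of_le_ne_top (b := ∫⁻ _ in A, 1 ∂P) (by simp) (lintegral_mono fun ω => prob_le_one)
  rw [h1, measureReal_def] at h2
  exact (ENNReal.toReal_eq_toReal_iff' (measure_ne_top _ _) h3).1 h2

lemma indep_comap_and_map_eq_of_map_prodMk_eq_prod {Ω' : Type*} {mΩ' : MeasurableSpace Ω'}
    {Z : Ω → Ω'} (hZ : Measurable Z) {ξ : Ω → X} (hξ : Measurable ξ)
    (h : P.map (fun ω => (Z ω, ξ ω)) = (P.map Z).prod ν) :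
    Indep (MeasurableSpace.comap Z mΩ') (MeasurableSpace.comap ξ inferInstance) P ∧
      P.map ξ = ν := by
  have hpr := Measure.isProbabilityMeasure_map (μ := P) hZ.aemeasurable
  have hlaw : P.map ξ = ν := by
    have h1 := congrArg Measure.snd h
    rw [Measure.snd_map_prodMk hZ, Measure.snd_prod] at h1
    simpa using h1
  refine ⟨?_, hlaw⟩
  rw [← IndepFun_iff_Indep, indepFun_iff_map_prod_eq_prod_map_map hZ.aemeasurable hξ.aemeasurable,
    hlaw]
  exact h

/-- If, given `m`, the variable `x` has the law of `T z ξ` with `ξ ∼ ν`, then the noise recovered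
from `x` has law `ν` and is independent of `m`. -/
lemma indep_and_map_eq_of_condLaw (hm : m ≤ mΩ) {z : Ω → E} (hz : Measurable[m] z)
    {x : Ω → Y} (hx : Measurable x) {T : E → X → Y} {T' : E → Y → X}
    (hT : Measurable (Function.uncurry T)) (hT' : Measurable (Function.uncurry T'))
    (hTT : ∀ z ξ, T' z (T z ξ) = ξ)
    (hlaw : ∀ B, MeasurableSet B → P⟦x ⁻¹' B | m⟧ =ᵐ[P] fun ω => (ν.map (T (z ω))).real B) :
    Indep m (MeasurableSpace.comap (fun ω => T' (z ω) (x ω)) inferInstance) P ∧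
      P.map (fun ω => T' (z ω) (x ω)) = ν := by
  have hTz : ∀ e, Measurable (T e) := fun e => hT.comp measurable_prodMk_left
  have hprob : ∀ ω, IsProbabilityMeasure (ν.map (T (z ω))) := fun ω =>
    Measure.isProbabilityMeasure_map (hTz _).aemeasurable
  have hid : @Measurable Ω Ω mΩ m id := measurable_id'' hm
  have hTm : @Measurable (Ω × X) Y (m.prod inferInstance) _
      (Function.uncurry fun ω => T (z ω)) :=
    measurable_uncurry_comp hT hz
  have hTm' : @Measurable (Ω × Y) X (m.prod inferInstance) _
      (Function.uncurry fun ω => T' (z ω)) :=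
    measurable_uncurry_comp hT' hz
  have hξ : Measurable (fun ω => T' (z ω) (x ω)) :=
    hT'.comp ((hz.mono hm le_rfl).prodMk hx)
  have hk : ∀ B, MeasurableSet B → Measurable (fun ω => ν.map (T (z ω)) B) := by
    intro B hB
    have h1 : (fun ω => ν.map (T (z ω)) B) =
        (fun e => ν (Prod.mk e ⁻¹' (Function.uncurry T ⁻¹' B))) ∘ z := by
      funext ω; rw [Measure.map_apply (hTz _) hB]; rfl
    rw [h1]
    exact (measurable_measure_prodMk_left (hT hB)).comp (hz.mono hm le_rfl)
  -- The conditioning variable is the identity map into `Ω` equipped with `m`, so that the product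
  -- law expresses independence of all of `m`.
  have key := @map_prodMk_eq_prod_of_condLaw Ω Ω X Y mΩ P _ m _ _ ν _ id hid x hx
    (fun ω => T (z ω)) (fun ω => T' (z ω)) hTm hTm' (fun ω ξ => hTT _ _)
    (fun A B hA hB => measure_inter_preimage_eq_setLIntegral_of_condLaw hm hx hB (hk B hB)
      (hlaw B hB) hA)
  have h := indep_comap_and_map_eq_of_map_prodMk_eq_prod hid hξ key
  rwa [show MeasurableSpace.comap id m = m from MeasurableSpace.comap_id] at h

lemma condExp_comap_eq_integral_of_indep [StandardBorelSpace X] [Nonempty X] {Ω' : Type*}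
    {mΩ' : MeasurableSpace Ω'} {Z : Ω → Ω'} (hZ : Measurable Z) {z : Ω' → E} (hz : Measurable z)
    {ξ : Ω → X} (hξ : Measurable ξ)
    (hind : Indep (MeasurableSpace.comap Z inferInstance) (MeasurableSpace.comap ξ inferInstance) P)
    (hlaw : P.map ξ = ν) {f : E × X → ℝ} (hf : Measurable f)
    (hfi : Integrable (fun ω => f (z (Z ω), ξ ω)) P) :
    P[fun ω => f (z (Z ω), ξ ω) | MeasurableSpace.comap Z inferInstance] =ᵐ[P]
      fun ω => ∫ y, f (z (Z ω), y) ∂ν := by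
  have hprod := (indepFun_iff_map_prod_eq_prod_map_map hZ.aemeasurable hξ.aemeasurable).1
    ((IndepFun_iff_Indep _ _ _).2 hind)
  rw [hlaw] at hprod
  exact condExp_eq_integral_of_map_prodMk_eq_prod hZ hξ hprod
    (hf.comp ((hz.comp measurable_fst).prodMk measurable_snd)) hfi

lemma condExp_eq_integral_of_indep [StandardBorelSpace X] [Nonempty X] (hm : m ≤ mΩ)
    {z : Ω → E} (hz : Measurable[m] z) {ξ : Ω → X} (hξ : Measurable ξ)
    (hind : Indep m (MeasurableSpace.comap ξ inferInstance) P) (hlaw : P.map ξ = ν)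
    {f : E × X → ℝ} (hf : Measurable f) (hfi : Integrable (fun ω => f (z ω, ξ ω)) P) :
    P[fun ω => f (z ω, ξ ω) | m] =ᵐ[P] fun ω => ∫ y, f (z ω, y) ∂ν := by
  have hid : @Measurable Ω Ω mΩ m id := measurable_id'' hm
  have hc : MeasurableSpace.comap id m = m := MeasurableSpace.comap_id
  have h := condExp_comap_eq_integral_of_indep hid hz hξ (by rwa [hc]) hlaw hf hfi
  rwa [hc] at h

end FreshNoise

/-! ### Consequences of the parameter conditions -/

section Parameters

/-- Step `t` pairs step sizes of time `t + 1` with deviations of time `t`. Replacing `s` by its tail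
supremum `S`, which decreases and is comparable to `s`, the shift costs `K * (S t - S (t + 1))`, a
telescoping series. -/
lemma summable_mul_shift {b s : ℕ → ℝ} {K C : ℝ} (hb0 : ∀ t, 0 ≤ b t) (hbK : ∀ t, b t ≤ K)
    (hs0 : ∀ t, 0 ≤ s t) (hC : ∀ r t, r ≤ t → s t ≤ C * s r) (hsum : Summable fun t => b t * s t) :
    Summable fun t => b (t + 1) * s t := by
  set S : ℕ → ℝ := fun t => ⨆ k, s (t + k) with hS
  have hbdd : ∀ t, BddAbove (Set.range fun k => s (t + k)) := fun t =>
    ⟨C * s t, by rintro _ ⟨k, rfl⟩; exact hC _ _ (by omega)⟩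
  have hsS : ∀ t, s t ≤ S t := fun t => le_ciSup (hbdd t) 0
  have hSs : ∀ t, S t ≤ C * s t := fun t => ciSup_le fun k => hC _ _ (by omega)
  have hanti : ∀ t, S (t + 1) ≤ S t := fun t => ciSup_le fun k => by
    have := le_ciSup (hbdd t) (k + 1)
    simpa [add_assoc, add_comm 1 k] using this
  have htel : Summable fun t => S t - S (t + 1) := by
    refine summable_of_sum_range_le (c := S 0) (fun t => sub_nonneg.2 (hanti t)) fun T => ?_
    rw [Finset.sum_range_sub']
    linarith [(hs0 T).trans (hsS T)]
  refine Summable.of_nonneg_of_le (fun t => mul_nonneg (hb0 _) (hs0 _)) (fun t => ?_)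
    ((((summable_nat_add_iff 1).2 hsum).mul_left C).add (htel.mul_left K))
  have h1 := mul_le_mul_of_nonneg_left (hsS t) (hb0 (t + 1))
  have h2 := mul_le_mul_of_nonneg_left (hSs (t + 1)) (hb0 (t + 1))
  have h3 := mul_le_mul_of_nonneg_right (hbK (t + 1)) (sub_nonneg.2 (hanti t))
  linarith

namespace AlgorithmParameters

variable {N : ℕ} {S : AlgorithmParameters N}

lemma βmin_le (k : Option (Fin N)) (t : ℕ) : S.βmin t ≤ S.β k t :=
  ciInf_le (Finite.bddBelow_range _) k

lemma le_βmax (k : Option (Fin N)) (t : ℕ) : S.β k t ≤ S.βmax t :=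
  le_ciSup (Finite.bddAbove_range fun k => S.β k t) k

lemma γ_le_γmax (i : Fin N) (t : ℕ) : S.γ i t ≤ S.γmax t :=
  le_ciSup (Finite.bddAbove_range fun i => S.γ i t) i

lemma σ_le_σmax (i : Fin N) (t : ℕ) : S.σ i t ≤ S.σmax t :=
  le_ciSup (Finite.bddAbove_range fun i => S.σ i t) i

/-- The size of the perturbation terms of one step. -/
def perturbation (S : AlgorithmParameters N) (c : ℝ) (t : ℕ) : ℝ :=
  S.βmax (t + 1) * S.σmax t + (c * S.γmax (t + 1)) ^ 2 + S.βmax (t + 1) ^ 2 +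
    (S.βmax (t + 1) - S.βmin (t + 1))

lemma Admissible.exists_isStepBound [Nonempty (Fin N)] (hS : S.Admissible) :
    ∃ c Sb : ℝ, 0 ≤ Sb ∧ (∀ t, S.σmax t ≤ Sb) ∧
      (∀ t, IsStepBound (fun i => S.σ i t) (fun i => S.γ i (t + 1) * S.σ i (t + 1) ^ 2)
        (S.β₀ (t + 1)) (S.σmax t) (c * S.γmax (t + 1)) (S.βmin (t + 1)) (S.βmax (t + 1))) ∧
      Summable (S.perturbation c) ∧ Tendsto S.σmax atTop (𝓝 0) ∧
      Tendsto (fun t => S.βmin (t + 1)) atTop (𝓝 0) := by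
  obtain ⟨C₀, hC₀⟩ := hS.σ_almost_antitone
  set C := |C₀| with hC
  have hσ : ∀ i s t, s ≤ t → S.σ i t ≤ C * S.σ i s := fun i s t hst =>
    (hC₀ i s t hst).trans (mul_le_mul_of_nonneg_right (le_abs_self _) (hS.σ_pos i s).le)
  have i₀ : Fin N := Classical.arbitrary _
  have hσm0 : ∀ t, 0 ≤ S.σmax t := fun t => (hS.σ_pos i₀ t).le.trans (σ_le_σmax i₀ t)
  have hγm0 : ∀ t, 0 ≤ S.γmax t := fun t => (hS.γ_nonneg i₀ t).trans (γ_le_γmax i₀ t)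
  have hσm : ∀ s t, s ≤ t → S.σmax t ≤ C * S.σmax s := fun s t hst => ciSup_le fun i =>
    (hσ i s t hst).trans (mul_le_mul_of_nonneg_left (σ_le_σmax i s) (abs_nonneg _))
  set Sb := C * S.σmax 0 with hSb
  have hSb0 : 0 ≤ Sb := mul_nonneg (abs_nonneg _) (hσm0 0)
  have hσSb : ∀ t, S.σmax t ≤ Sb := fun t => hσm 0 t (Nat.zero_le t)
  have hβ0 : ∀ k t, 0 ≤ S.β k t := fun k t => by
    cases k with
    | none => exact hS.β₀_nonneg t
    | some i => exact mul_nonneg (hS.γ_nonneg i t) (sq_nonneg _)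
  have hbm0 : ∀ t, 0 ≤ S.βmin t := fun t => le_ciInf fun k => hβ0 k t
  have hδ0 : ∀ t, 0 ≤ S.βmax t - S.βmin t := fun t =>
    sub_nonneg.2 ((βmin_le none t).trans (le_βmax none t))
  set b : ℕ → ℝ := fun t => S.γmax t * S.σmax t ^ 2 with hb
  have hb0 : ∀ t, 0 ≤ b t := fun t => mul_nonneg (hγm0 t) (sq_nonneg _)
  -- A regular player is needed here: all effective step sizes, including that of the dual player,
  -- thereby lie within the summable spread of `γmax * σmax ^ 2`.
  have hbmb : ∀ t, S.βmin t ≤ b t := fun t => by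
    refine (βmin_le (some i₀) t).trans ?_
    have h1 := γ_le_γmax (S := S) i₀ t
    have h2 := σ_le_σmax (S := S) i₀ t
    have h3 := (hS.σ_pos i₀ t).le
    have h4 := hγm0 t
    simp only [β, hb]
    gcongr
  have hγ0 : Tendsto S.γmax atTop (𝓝 0) := by
    have h1 := (hS.sum_γ_sq.tendsto_atTop_zero).sqrt
    simp only [Real.sqrt_zero] at h1
    exact h1.congr fun t => Real.sqrt_sq (hγm0 t)
  obtain ⟨Γ, hΓ⟩ := hγ0.bddAbove_range
  have hγΓ : ∀ t, S.γmax t ≤ Γ := fun t => hΓ ⟨t, rfl⟩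
  have hΓ0 : 0 ≤ Γ := (hγm0 0).trans (hγΓ 0)
  have hbK : ∀ t, b t ≤ Γ * Sb ^ 2 := fun t => by
    have h1 := hγΓ t
    have h2 := hσSb t
    have h3 := hσm0 t
    simp only [hb]
    gcongr
  have hbγ : ∀ t, b t ≤ Sb ^ 2 * S.γmax t := fun t => by
    have h2 := hσSb t
    have h3 := hσm0 t
    have h4 := hγm0 t
    simp only [hb]
    rw [mul_comm]
    gcongr
  have hbtend : Tendsto b atTop (𝓝 0) :=
    squeeze_zero hb0 hbγ (by simpa using hγ0.const_mul (Sb ^ 2))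
  have hbσ : Summable fun t => b t * S.σmax t :=
    hS.sum_γ_σ_cube.congr fun t => by simp only [hb]; ring
  have hshift := summable_mul_shift hb0 hbK hσm0 hσm hbσ
  have hδs := (summable_nat_add_iff 1).2 hS.sum_diff
  have hδtend := hS.sum_diff.tendsto_atTop_zero
  obtain ⟨Δ, hΔ⟩ := hδtend.bddAbove_range
  have hδΔ : ∀ t, S.βmax t - S.βmin t ≤ Δ := fun t => hΔ ⟨t, rfl⟩
  have hmax : ∀ t, S.βmax t ≤ b t + (S.βmax t - S.βmin t) := fun t => by linarith [hbmb t]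
  have hmax0 : ∀ t, 0 ≤ S.βmax t := fun t => (hβ0 none t).trans (le_βmax none t)
  -- The estimate at step `t` contributes a factor `1 / σ i t`, so one factor `σ i (t + 1)` of the
  -- step size is exchanged for `C * σ i t` and the other is bounded by `Sb`.
  set c := C * Sb with hc
  refine ⟨c, Sb, hSb0, hσSb, fun t => ?_, ?_, ?_, ?_⟩
  · refine ⟨fun i => hS.σ_pos i t, fun i => σ_le_σmax i t, hσm0 t, hbm0 _,
      fun i => βmin_le (some i) (t + 1), fun i => le_βmax (some i) (t + 1),
      βmin_le none (t + 1), le_βmax none (t + 1),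
      mul_nonneg (mul_nonneg (abs_nonneg _) hSb0) (hγm0 _), fun i => ?_⟩
    have h1 := γ_le_γmax (S := S) i (t + 1)
    have h2 := hσ i t (t + 1) t.le_succ
    have h3 := (σ_le_σmax (S := S) i (t + 1)).trans (hσSb _)
    have h4 := (hS.σ_pos i (t + 1)).le
    have h5 := hγm0 (t + 1)
    have h6 := (hS.σ_pos i t).le
    calc S.γ i (t + 1) * S.σ i (t + 1) ^ 2 = S.γ i (t + 1) * (S.σ i (t + 1) * S.σ i (t + 1)) := by
          ring
      _ ≤ S.γmax (t + 1) * ((C * S.σ i t) * Sb) := by gcongr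
      _ = c * S.γmax (t + 1) * S.σ i t := by rw [hc]; ring
  · have s1 : Summable fun t => S.βmax (t + 1) * S.σmax t := by
      refine Summable.of_nonneg_of_le (fun t => mul_nonneg (hmax0 _) (hσm0 t)) (fun t => ?_)
        (hshift.add (hδs.mul_left Sb))
      have h1 := mul_le_mul_of_nonneg_right (hmax (t + 1)) (hσm0 t)
      have h2 := mul_le_mul_of_nonneg_right (hσSb t) (hδ0 (t + 1))
      linarith
    have s2 : Summable fun t => (c * S.γmax (t + 1)) ^ 2 := by
      simp_rw [mul_pow]
      exact ((summable_nat_add_iff 1).2 hS.sum_γ_sq).mul_left _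
    have s3 : Summable fun t => S.βmax (t + 1) ^ 2 := by
      refine Summable.of_nonneg_of_le (fun t => sq_nonneg _) (fun t => ?_)
        ((((summable_nat_add_iff 1).2 hS.sum_γ_sq).mul_left (2 * Sb ^ 4)).add
          (hδs.mul_left (2 * Δ)))
      have h1 := (hmax (t + 1)).trans (add_le_add_left (hbγ (t + 1)) _)
      have h2 := pow_le_pow_left₀ (hmax0 (t + 1)) h1 2
      have h3 := mul_le_mul_of_nonneg_right (hδΔ (t + 1)) (hδ0 (t + 1))
      nlinarith [sq_nonneg (Sb ^ 2 * S.γmax (t + 1) - (S.βmax (t + 1) - S.βmin (t + 1)))]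
    exact ((s1.add s2).add s3).add hδs
  · rw [Metric.tendsto_atTop]
    by_contra! hcon
    obtain ⟨ε, hε, hfreq⟩ := hcon
    -- Almost monotonicity turns infinitely many large deviations into a lower bound at all times;
    -- then summability of `γmax * σmax ^ 3` would make `∑ βmin` finite.
    have hlow : ∀ s, ε ≤ C * S.σmax s := fun s => by
      obtain ⟨t, hst, ht⟩ := hfreq s
      rw [Real.dist_eq, sub_zero, abs_of_nonneg (hσm0 t)] at ht
      exact ht.trans (hσm s t hst)
    have hsum : Summable S.βmin := by
      refine Summable.of_nonneg_of_le hbm0 (fun t => ?_) (hbσ.mul_left (C / ε))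
      refine (hbmb t).trans ?_
      rw [div_mul_eq_mul_div, le_div_iff₀ hε]
      have := mul_le_mul_of_nonneg_left (hlow t) (hb0 t)
      linarith
    exact not_tendsto_nhds_of_tendsto_atTop hS.sum_βmin _ hsum.hasSum.tendsto_sum_nat
  · exact squeeze_zero (fun t => hbm0 _) (fun t => hbmb _)
      (hbtend.comp (tendsto_add_atTop_nat 1))

end AlgorithmParameters

end Parameters

/-! ### Auxiliary facts on convergence in measure, projections and filtrations -/

section Auxiliary

lemma tendstoInMeasure_of_sub {α ι E : Type*} {mα : MeasurableSpace α} {P : Measure α}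
    [NormedAddCommGroup E] {F : Filter ι} {f f' : ι → α → E} {g : α → E}
    (hf : TendstoInMeasure P f F g)
    (hff' : TendstoInMeasure P (fun t ω => f' t ω - f t ω) F (fun _ => 0)) :
    TendstoInMeasure P f' F g := by
  intro ε hε
  have h2 : 0 < ε / 2 := ENNReal.half_pos hε.ne'
  have h := (hf _ h2).add (hff' _ h2)
  rw [add_zero] at h
  refine tendsto_of_tendsto_of_tendsto_of_le_of_le tendsto_const_nhds h (fun _ => zero_le)
    fun t => (measure_mono ?_).trans (measure_union_le _ _)
  intro ω hω
  by_contra hcon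
  simp only [Set.mem_union, Set.mem_ofPred_eq, not_or, not_le] at hcon hω
  refine absurd hω (not_le.2 ?_)
  calc edist (f' t ω) (g ω) ≤ edist (f' t ω) (f t ω) + edist (f t ω) (g ω) := edist_triangle _ _ _
    _ = edist (f' t ω - f t ω) 0 + edist (f t ω) (g ω) := by
        rw [edist_eq_enorm_sub, edist_eq_enorm_sub (f' t ω - f t ω), sub_zero]
    _ < ε / 2 + ε / 2 := ENNReal.add_lt_add hcon.2 hcon.1
    _ = ε := ENNReal.add_halves ε

lemma convex_nonnegOrthant (n : ℕ) : Convex ℝ (nonnegOrthant n) :=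
  fun _ hx _ hy _ _ hs ht _ j => add_nonneg (mul_nonneg hs (hx j)) (mul_nonneg ht (hy j))

lemma norm_toLp_sub_le_of_isProjection {N : ℕ} {d : Fin N → ℕ}
    {A : (i : Fin N) → Set (ActionSpace d i)} (hA : ∀ i, Convex ℝ (A i)) {p y a : JointSpace d}
    (hp : ∀ i, IsProjection (A i) (y i) (p i)) (ha : ∀ i, a i ∈ A i) : ‖p - a‖ ≤ ‖y - a‖ := by
  refine abs_le_of_sq_le_sq' ?_ (norm_nonneg _) |>.2
  rw [PiLp.norm_sq_eq_of_L2, PiLp.norm_sq_eq_of_L2]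
  refine Finset.sum_le_sum fun i _ => ?_
  have := norm_sub_le_of_isProjection (hA i) (hp i) (ha i)
  simp only [PiLp.sub_apply]
  gcongr

/-- The filtration that starts one step later. -/
def shiftFiltration {Ω : Type*} {mΩ : MeasurableSpace Ω} (ℱ : Filtration ℕ mΩ) :
    Filtration ℕ mΩ where
  seq t := ℱ (t + 1)
  mono' _ _ h := ℱ.mono (Nat.add_le_add_right h 1)
  le' t := ℱ.le (t + 1)

end Auxiliary

/-! ### Integrals of products with independent noise -/

section Independence

variable {Ω X : Type*} {m mΩ : MeasurableSpace Ω} {P : Measure Ω}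
  [MeasurableSpace X] {ν : Measure X}

lemma integrable_mul_comp_of_indep {ξ : Ω → X} (hξ : Measurable ξ)
    (hind : Indep m (MeasurableSpace.comap ξ inferInstance) P) (hlaw : P.map ξ = ν)
    {φ : Ω → ℝ} (hφ : Measurable[m] φ) (hφi : Integrable φ P) {k : X → ℝ} (hk : Measurable k)
    (hki : Integrable k ν) :
    Integrable (fun ω => φ ω * k (ξ ω)) P ∧
      ∫ ω, φ ω * k (ξ ω) ∂P = (∫ ω, φ ω ∂P) * ∫ y, k y ∂ν := by
  have hI : IndepFun φ (fun ω => k (ξ ω)) P := by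
    rw [IndepFun_iff_Indep]
    refine indep_of_indep_of_le_left (indep_of_indep_of_le_right hind ?_) hφ.comap_le
    exact (hk.comp (comap_measurable ξ)).comap_le
  have hki' : Integrable (fun ω => k (ξ ω)) P := by
    rw [← hlaw] at hki
    exact hki.comp_measurable hξ
  refine ⟨hI.integrable_mul hφi hki', ?_⟩
  rw [← hlaw, integral_map hξ.aemeasurable hk.aestronglyMeasurable]
  exact hI.integral_fun_mul_eq_mul_integral hφi.aestronglyMeasurable hki'.aestronglyMeasurable

end Independence

/-! ### Noise, a priori bounds and integrability along a run -/

namespace IsPayoffBasedRun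

variable {N n : ℕ} {d : Fin N → ℕ} {G : CoupledGame N n d} {S : AlgorithmParameters N}
  {μ₀ : JointSpace d} {l₀ : EuclideanSpace ℝ (Fin n)} {Ω : Type*} {mΩ : MeasurableSpace Ω}
  {P : Measure Ω} {ℱ : Filtration ℕ mΩ} {μ : ℕ → Ω → JointSpace d}
  {l : ℕ → Ω → EuclideanSpace ℝ (Fin n)} {x : ℕ → Ω → JointSpace d}

/-- The standardized noise of the joint state at time `t`. -/
def noise (S : AlgorithmParameters N) (μ x : ℕ → Ω → JointSpace d) (t : ℕ) (ω : Ω) : JointSpace d :=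
  blockScale (fun i => (S.σ i t)⁻¹) (x t ω - μ t ω)

lemma eq_add_blockScale_noise (hσ : ∀ i t, 0 < S.σ i t) (t : ℕ) (ω : Ω) :
    x t ω = μ t ω + blockScale (fun i => S.σ i t) (noise S μ x t ω) := by
  rw [noise, blockScale_blockScale_inv fun i => (hσ i t).ne', add_sub_cancel]

lemma measurable_noise (h : IsPayoffBasedRun G S μ₀ l₀ P ℱ μ l x) (t : ℕ) :
    Measurable (noise S μ x t) :=
  (measurable_blockScale _).comp ((h.measurable_x t).sub ((h.measurable_μ t).mono (ℱ.le t) le_rfl))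

/-- For fixed mean the state is an invertible affine function of the noise, since all deviations are
positive, so the prescribed conditional law of the state determines that of the noise. -/
lemma indep_noise [IsProbabilityMeasure P] (h : IsPayoffBasedRun G S μ₀ l₀ P ℱ μ l x) (hσ : ∀ i t, 0 < S.σ i t) (t : ℕ) :
    Indep (ℱ t) (MeasurableSpace.comap (noise S μ x t) inferInstance) P ∧
      P.map (noise S μ x t) = stdGaussian (JointSpace d) := by
  refine indep_and_map_eq_of_condLaw (ℱ.le t) (h.measurable_μ t) (h.measurable_x t)
    (T := fun m ξ => m + blockScale (fun i => S.σ i t) ξ)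
    (T' := fun m y => blockScale (fun i => (S.σ i t)⁻¹) (y - m)) ?_ ?_ (fun m ξ => ?_) fun B hB => ?_
  · exact measurable_fst.add ((measurable_blockScale _).comp measurable_snd)
  · exact (measurable_blockScale _).comp (measurable_snd.sub measurable_fst)
  · rw [add_sub_cancel_left, blockScale_inv_blockScale fun i => (hσ i t).ne']
  · refine (h.condLaw_x t B hB).trans (Eventually.of_forall fun ω => ?_)
    simp only
    rw [stateLaw_eq_map_stdGaussian _ fun i => (hσ i t).le]

lemma integrable_mul_noise [IsProbabilityMeasure P] (h : IsPayoffBasedRun G S μ₀ l₀ P ℱ μ l x) (hσ : ∀ i t, 0 < S.σ i t)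
    (t : ℕ) {φ : Ω → ℝ} (hφ : Measurable[ℱ t] φ) (hφi : Integrable φ P) (q : ℕ) :
    Integrable (fun ω => φ ω * (1 + ‖noise S μ x t ω‖) ^ q) P ∧
      ∫ ω, φ ω * (1 + ‖noise S μ x t ω‖) ^ q ∂P =
        (∫ ω, φ ω ∂P) * gaussianMoment (JointSpace d) q :=
  integrable_mul_comp_of_indep (h.measurable_noise t) (h.indep_noise hσ t).1
    (h.indep_noise hσ t).2 hφ hφi (k := fun ξ => (1 + ‖ξ‖) ^ q) (by fun_prop)
    (integrable_one_add_norm_pow q)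

lemma mem_jointActions (h : IsPayoffBasedRun G S μ₀ l₀ P ℱ μ l x) (t : ℕ) (ω : Ω) :
    μ (t + 1) ω ∈ G.jointActions := fun i => (h.update_μ t ω i).1

lemma mem_nonnegOrthant (h : IsPayoffBasedRun G S μ₀ l₀ P ℱ μ l x) (t : ℕ) (ω : Ω) :
    l (t + 1) ω ∈ nonnegOrthant n := (h.update_l t ω).1

lemma exists_norm_le (h : IsPayoffBasedRun G S μ₀ l₀ P ℱ μ l x) (hG : G.IsConvexGame) :
    ∃ R : ℝ, 0 ≤ R ∧ ∀ t ω, ‖μ t ω‖ ≤ R := by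
  obtain ⟨R, hR⟩ := (CoupledGame.isCompact_jointActions hG).isBounded.exists_norm_le
  refine ⟨max ‖μ₀‖ R, (norm_nonneg _).trans (le_max_left _ _), fun t ω => ?_⟩
  cases t with
  | zero => rw [h.init_μ]; exact le_max_left _ _
  | succ t => exact (hR _ (h.mem_jointActions t ω)).trans (le_max_right _ _)

lemma norm_mean_sub_le (h : IsPayoffBasedRun G S μ₀ l₀ P ℱ μ l x) (hG : G.IsConvexGame)
    (hσ : ∀ i t, 0 < S.σ i t) {a : JointSpace d} (ha : a ∈ G.jointActions) (t : ℕ) (ω : Ω) :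
    ‖μ (t + 1) ω - a‖ ≤ ‖G.meanStep (fun i => S.σ i t)
      (fun i => S.γ i (t + 1) * S.σ i (t + 1) ^ 2) (μ t ω) (l t ω)
      (μ t ω + blockScale (fun i => S.σ i t) (noise S μ x t ω)) - a‖ := by
  rw [← eq_add_blockScale_noise hσ]
  refine norm_toLp_sub_le_of_isProjection hG.convex_A (fun i => ?_) ha
  have := h.update_μ t ω i
  rw [mul_smul] at this
  exact this

lemma norm_multiplier_sub_le (h : IsPayoffBasedRun G S μ₀ l₀ P ℱ μ l x)
    (hσ : ∀ i t, 0 < S.σ i t) {ls : EuclideanSpace ℝ (Fin n)} (hls : ls ∈ nonnegOrthant n)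
    (t : ℕ) (ω : Ω) :
    ‖l (t + 1) ω - ls‖ ≤ ‖l t ω + S.β₀ (t + 1) •
      G.g (μ t ω + blockScale (fun i => S.σ i t) (noise S μ x t ω)) - ls‖ := by
  rw [← eq_add_blockScale_noise hσ]
  exact norm_sub_le_of_isProjection (convex_nonnegOrthant n) (h.update_l t ω) hls

lemma measurable_norm_multiplier_sq (h : IsPayoffBasedRun G S μ₀ l₀ P ℱ μ l x) (t : ℕ) :
    Measurable[ℱ t] (fun ω => ‖l t ω‖ ^ 2) :=
  (measurable_norm.comp (h.measurable_l t)).pow_const 2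

variable {R Sb : ℝ}

lemma integrable_norm_dualStep_sub_sq [IsProbabilityMeasure P] (h : IsPayoffBasedRun G S μ₀ l₀ P ℱ μ l x)
    (hG : G.IsConvexGame) (hreg : G.IsRegular) (hσ : ∀ i t, 0 < S.σ i t) (hSb : 0 ≤ Sb)
    (hσS : ∀ i t, S.σ i t ≤ Sb) (hR : ∀ t ω, ‖μ t ω‖ ≤ R) (ls : EuclideanSpace ℝ (Fin n)) (t : ℕ)
    (hl : Integrable (fun ω => ‖l t ω‖ ^ 2) P) :
    Integrable (fun ω => ‖l t ω + S.β₀ (t + 1) •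
      G.g (μ t ω + blockScale (fun i => S.σ i t) (noise S μ x t ω)) - ls‖ ^ 2) P := by
  obtain ⟨C, hC0, hC⟩ := CoupledGame.exists_norm_g_add_blockScale_sq_le (R := R) hreg hSb
  have hi := (h.integrable_mul_noise hσ t (φ := fun _ => (1 : ℝ)) measurable_const
    (integrable_const 1) 2).1
  refine ((hl.const_mul 3).add ((hi.const_mul (3 * S.β₀ (t + 1) ^ 2 * C)).add
    (integrable_const (3 * ‖ls‖ ^ 2)))).mono' ?_ (Eventually.of_forall fun ω => ?_)
  · have hc : Continuous fun p : EuclideanSpace ℝ (Fin n) × JointSpace d =>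
        ‖p.1 + S.β₀ (t + 1) • G.g p.2 - ls‖ ^ 2 := by
      have := CoupledGame.continuous_g hG
      fun_prop
    simp_rw [← eq_add_blockScale_noise hσ]
    exact (hc.measurable.comp (((h.measurable_l t).mono (ℱ.le t) le_rfl).prodMk
      (h.measurable_x t))).aestronglyMeasurable
  · rw [Real.norm_of_nonneg (sq_nonneg _)]
    have h1 := hC (fun i => S.σ i t) (μ t ω) (noise S μ x t ω) (fun i => hσ i t)
      (fun i => hσS i t) (hR t ω)
    have h2 := norm_sub_le (l t ω + S.β₀ (t + 1) •
      G.g (μ t ω + blockScale (fun i => S.σ i t) (noise S μ x t ω))) ls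
    have h3 := norm_add_le (l t ω) (S.β₀ (t + 1) •
      G.g (μ t ω + blockScale (fun i => S.σ i t) (noise S μ x t ω)))
    have h4 : ‖S.β₀ (t + 1) • G.g (μ t ω + blockScale (fun i => S.σ i t) (noise S μ x t ω))‖ ^ 2 ≤
        S.β₀ (t + 1) ^ 2 * (C * (1 + ‖noise S μ x t ω‖) ^ 2) := by
      rw [norm_smul, mul_pow, Real.norm_eq_abs, sq_abs]
      gcongr
    have h5 := pow_le_pow_left₀ (norm_nonneg _) (h2.trans (add_le_add_left h3 _)) 2
    simp only [Pi.add_apply]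
    generalize ‖S.β₀ (t + 1) • G.g (μ t ω + blockScale (fun i => S.σ i t) (noise S μ x t ω))‖ = y
      at h4 h5
    refine h5.trans ?_
    nlinarith only [h4, sq_nonneg (‖l t ω‖ - y), sq_nonneg (‖l t ω‖ - ‖ls‖), sq_nonneg (y - ‖ls‖)]

/-- Unlike the means, the multiplier is not confined to a bounded set; square integrability passes
from one step to the next, as projecting does not increase the distance to `0`. -/
lemma integrable_norm_multiplier_sq [IsProbabilityMeasure P] (h : IsPayoffBasedRun G S μ₀ l₀ P ℱ μ l x)
    (hG : G.IsConvexGame) (hreg : G.IsRegular) (hσ : ∀ i t, 0 < S.σ i t) (hSb : 0 ≤ Sb)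
    (hσS : ∀ i t, S.σ i t ≤ Sb) (hR : ∀ t ω, ‖μ t ω‖ ≤ R) (t : ℕ) :
    Integrable (fun ω => ‖l t ω‖ ^ 2) P := by
  induction t with
  | zero => simp_rw [h.init_l]; exact integrable_const _
  | succ t ih =>
    refine (h.integrable_norm_dualStep_sub_sq hG hreg hσ hSb hσS hR 0 t ih).mono'
      ((h.measurable_norm_multiplier_sq (t + 1)).mono (ℱ.le _) le_rfl).aestronglyMeasurable
      (Eventually.of_forall fun ω => ?_)
    rw [Real.norm_of_nonneg (sq_nonneg _)]
    have := h.norm_multiplier_sub_le hσ (ls := 0) (fun j => le_rfl) t ω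
    rw [sub_zero] at this
    gcongr

end IsPayoffBasedRun

namespace CoupledGame

variable {N n : ℕ} {d : Fin N → ℕ} {G : CoupledGame N n d}

lemma continuous_add_blockScale (s : Fin N → ℝ) :
    Continuous fun p : (JointSpace d × EuclideanSpace ℝ (Fin n)) × JointSpace d =>
      p.1.1 + blockScale s p.2 :=
  (continuous_fst.comp continuous_fst).add ((continuous_blockScale s).comp continuous_snd)

lemma measurable_norm_meanStep_sub_sq (hG : G.IsConvexGame) (s b : Fin N → ℝ)
    (a : JointSpace d) :
    Measurable fun p : (JointSpace d × EuclideanSpace ℝ (Fin n)) × JointSpace d =>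
      ‖G.meanStep s b p.1.1 p.1.2 (p.1.1 + blockScale s p.2) - a‖ ^ 2 := by
  have h1 : Continuous fun p : (JointSpace d × EuclideanSpace ℝ (Fin n)) × JointSpace d =>
      G.meanStep s b p.1.1 p.1.2 (p.1.1 + blockScale s p.2) :=
    (continuous_meanStep hG s b).comp
      (f := fun p : (JointSpace d × EuclideanSpace ℝ (Fin n)) × JointSpace d =>
        (p.1, p.1.1 + blockScale s p.2))
      (continuous_fst.prodMk (continuous_add_blockScale s))
  exact (measurable_norm.comp (h1.measurable.sub_const a)).pow_const 2

lemma measurable_norm_dualStep_sub_sq (hG : G.IsConvexGame) (s : Fin N → ℝ) (b₀ : ℝ)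
    (ls : EuclideanSpace ℝ (Fin n)) :
    Measurable fun p : (JointSpace d × EuclideanSpace ℝ (Fin n)) × JointSpace d =>
      ‖p.1.2 + b₀ • G.g (p.1.1 + blockScale s p.2) - ls‖ ^ 2 := by
  have h1 : Continuous fun p : (JointSpace d × EuclideanSpace ℝ (Fin n)) × JointSpace d =>
      G.g (p.1.1 + blockScale s p.2) := (continuous_g hG).comp (continuous_add_blockScale s)
  have h2 : Measurable fun p : (JointSpace d × EuclideanSpace ℝ (Fin n)) × JointSpace d =>
      p.1.2 := measurable_snd.comp measurable_fst
  exact (measurable_norm.comp ((h2.add (h1.measurable.const_smul b₀)).sub_const ls)).pow_const 2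

end CoupledGame

/-! ### Conditional drift and convergence of the run -/

namespace IsPayoffBasedRun

variable {N n : ℕ} {d : Fin N → ℕ} {G : CoupledGame N n d} {S : AlgorithmParameters N}
  {μ₀ : JointSpace d} {l₀ : EuclideanSpace ℝ (Fin n)} {Ω : Type*} {mΩ : MeasurableSpace Ω}
  {P : Measure Ω} [IsProbabilityMeasure P] {ℱ : Filtration ℕ mΩ} {μ : ℕ → Ω → JointSpace d}
  {l : ℕ → Ω → EuclideanSpace ℝ (Fin n)} {x : ℕ → Ω → JointSpace d} {R Sb c : ℝ}

/-- The mean square displacement of the unprojected means. -/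
lemma exists_integral_norm_meanStep_sub_sq_le (h : IsPayoffBasedRun G S μ₀ l₀ P ℱ μ l x)
    (hG : G.IsConvexGame) (hreg : G.IsRegular) (hgrowth : G.HasQuadraticGrowth)
    (hσ : ∀ i t, 0 < S.σ i t) (hSb : 0 ≤ Sb) (hσS : ∀ t, S.σmax t ≤ Sb)
    (hstep : ∀ t, IsStepBound (fun i => S.σ i t) (fun i => S.γ i (t + 1) * S.σ i (t + 1) ^ 2)
        (S.β₀ (t + 1)) (S.σmax t) (c * S.γmax (t + 1)) (S.βmin (t + 1)) (S.βmax (t + 1)))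
    (hR0 : 0 ≤ R) (hR : ∀ t ω, ‖μ t ω‖ ≤ R)
    (hl : ∀ t, Integrable (fun ω => ‖l t ω‖ ^ 2) P) :
    ∃ C : ℝ, 0 ≤ C ∧ ∀ t,
      Integrable (fun ω => ‖G.meanStep (fun i => S.σ i t)
        (fun i => S.γ i (t + 1) * S.σ i (t + 1) ^ 2) (μ t ω) (l t ω)
        (μ t ω + blockScale (fun i => S.σ i t) (noise S μ x t ω)) - μ t ω‖ ^ 2) P ∧
      ∫ ω, ‖G.meanStep (fun i => S.σ i t)
        (fun i => S.γ i (t + 1) * S.σ i (t + 1) ^ 2) (μ t ω) (l t ω)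
        (μ t ω + blockScale (fun i => S.σ i t) (noise S μ x t ω)) - μ t ω‖ ^ 2 ∂P ≤
        C * (c * S.γmax (t + 1)) ^ 2 * (1 + ∫ ω, ‖l t ω‖ ^ 2 ∂P) := by
  obtain ⟨C, q, hC0, hC⟩ := CoupledGame.exists_norm_meanStep_sub_sq_le hreg hgrowth hR0 hSb
  refine ⟨C * gaussianMoment (JointSpace d) q, mul_nonneg hC0 (gaussianMoment_nonneg q),
    fun t => ?_⟩
  have hφ : Measurable[ℱ t] (fun ω => C * (c * S.γmax (t + 1)) ^ 2 * (1 + ‖l t ω‖ ^ 2)) :=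
    ((h.measurable_norm_multiplier_sq t).const_add 1).const_mul _
  have hφi : Integrable (fun ω => C * (c * S.γmax (t + 1)) ^ 2 * (1 + ‖l t ω‖ ^ 2)) P :=
    ((integrable_const 1).add (hl t)).const_mul _
  have key := h.integrable_mul_noise hσ t hφ hφi q
  have hb : ∀ ω, ‖G.meanStep (fun i => S.σ i t)
        (fun i => S.γ i (t + 1) * S.σ i (t + 1) ^ 2) (μ t ω) (l t ω)
        (μ t ω + blockScale (fun i => S.σ i t) (noise S μ x t ω)) - μ t ω‖ ^ 2 ≤
      C * (c * S.γmax (t + 1)) ^ 2 * (1 + ‖l t ω‖ ^ 2) * (1 + ‖noise S μ x t ω‖) ^ q := fun ω =>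
    hC _ _ _ _ _ _ _ (μ t ω) (noise S μ x t ω) (l t ω) (hstep t) (hσS t) (hR t ω)
  have hc : Continuous fun p : (JointSpace d × EuclideanSpace ℝ (Fin n)) × JointSpace d =>
      ‖G.meanStep (fun i => S.σ i t) (fun i => S.γ i (t + 1) * S.σ i (t + 1) ^ 2)
        p.1.1 p.1.2 p.2 - p.1.1‖ ^ 2 := by
    have := CoupledGame.continuous_meanStep hG (fun i => S.σ i t)
      (fun i => S.γ i (t + 1) * S.σ i (t + 1) ^ 2)
    fun_prop
  have hm := hc.measurable.comp ((((h.measurable_μ t).prodMk (h.measurable_l t)).mono (ℱ.le t)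
    le_rfl).prodMk (h.measurable_x t))
  have hi : Integrable (fun ω => ‖G.meanStep (fun i => S.σ i t)
        (fun i => S.γ i (t + 1) * S.σ i (t + 1) ^ 2) (μ t ω) (l t ω)
        (μ t ω + blockScale (fun i => S.σ i t) (noise S μ x t ω)) - μ t ω‖ ^ 2) P := by
    refine key.1.mono' ?_ (Eventually.of_forall fun ω => ?_)
    · simp_rw [← eq_add_blockScale_noise hσ]
      exact hm.aestronglyMeasurable
    · rw [Real.norm_of_nonneg (sq_nonneg _)]
      exact hb ω
  refine ⟨hi, (integral_mono hi key.1 hb).trans (le_of_eq ?_)⟩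
  rw [key.2, integral_const_mul, integral_add (integrable_const 1) (hl t)]
  simp only [integral_const, probReal_univ, one_smul]
  ring

/-- The conditional drift of the Lyapunov function and of the distance to the equilibrium. -/
theorem exists_condExp_drift_le (h : IsPayoffBasedRun G S μ₀ l₀ P ℱ μ l x)
    (hG : G.IsConvexGame) (hreg : G.IsRegular) (hgrowth : G.HasQuadraticGrowth)
    (hσ : ∀ i t, 0 < S.σ i t) (hSb : 0 ≤ Sb) (hσS : ∀ t, S.σmax t ≤ Sb)
    (hstep : ∀ t, IsStepBound (fun i => S.σ i t) (fun i => S.γ i (t + 1) * S.σ i (t + 1) ^ 2)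
        (S.β₀ (t + 1)) (S.σmax t) (c * S.γmax (t + 1)) (S.βmin (t + 1)) (S.βmax (t + 1)))
    (hR0 : 0 ≤ R) (hR : ∀ t ω, ‖μ t ω‖ ≤ R)
    (hl : ∀ t, Integrable (fun ω => ‖l t ω‖ ^ 2) P) {a : JointSpace d} (ha : a ∈ G.jointActions)
    {ls : EuclideanSpace ℝ (Fin n)} (hls : ls ∈ nonnegOrthant n) {D : JointSpace d → ℝ}
    (hD : ∀ b ∈ G.jointActions, ∀ l ∈ nonnegOrthant n,
      D b ≤ ∑ i, inner ℝ (G.extendedBlock i b l) (b i - a i) - inner ℝ (G.g b) (l - ls)) :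
    ∃ C : ℝ, 0 ≤ C ∧ ∀ t, (∀ ω, μ t ω ∈ G.jointActions) → (∀ ω, l t ω ∈ nonnegOrthant n) →
      (P[fun ω => ‖μ (t + 1) ω - a‖ ^ 2 + ‖l (t + 1) ω - ls‖ ^ 2 | ℱ t] ≤ᵐ[P] fun ω =>
        (1 + C * S.perturbation c t) * (‖μ t ω - a‖ ^ 2 + ‖l t ω - ls‖ ^ 2) +
          C * S.perturbation c t - 2 * S.βmin (t + 1) * D (μ t ω)) ∧
      P[fun ω => ‖μ (t + 1) ω - a‖ ^ 2 | ℱ t] ≤ᵐ[P] fun ω =>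
        ‖μ t ω - a‖ ^ 2 + C * (S.βmin (t + 1) + S.perturbation c t) * (1 + ‖l t ω‖ ^ 2) := by
  obtain ⟨C, hC0, hC⟩ := CoupledGame.exists_drift_le hG hreg hgrowth hR0 hSb hD
  obtain ⟨C', -, hC'⟩ := h.exists_integral_norm_meanStep_sub_sq_le hG hreg hgrowth hσ hSb hσS
    hstep hR0 hR hl
  refine ⟨C, hC0, fun t hμ hlt => ?_⟩
  set s : Fin N → ℝ := fun i => S.σ i t with hs
  set b : Fin N → ℝ := fun i => S.γ i (t + 1) * S.σ i (t + 1) ^ 2 with hb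
  set ξ := noise S μ x t with hξ
  set f₁ : (JointSpace d × EuclideanSpace ℝ (Fin n)) × JointSpace d → ℝ := fun p =>
    ‖G.meanStep s b p.1.1 p.1.2 (p.1.1 + blockScale s p.2) - a‖ ^ 2 with hf₁
  set f₂ : (JointSpace d × EuclideanSpace ℝ (Fin n)) × JointSpace d → ℝ := fun p =>
    ‖p.1.2 + S.β₀ (t + 1) • G.g (p.1.1 + blockScale s p.2) - ls‖ ^ 2 with hf₂
  have hf₁m : Measurable f₁ := CoupledGame.measurable_norm_meanStep_sub_sq hG s b a
  have hf₂m : Measurable f₂ := CoupledGame.measurable_norm_dualStep_sub_sq hG s (S.β₀ (t + 1)) ls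
  have hz : Measurable[ℱ t] (fun ω => (μ t ω, l t ω)) :=
    (h.measurable_μ t).prodMk (h.measurable_l t)
  have hξm : Measurable ξ := h.measurable_noise t
  have hi₂ : Integrable (fun ω => f₂ ((μ t ω, l t ω), ξ ω)) P :=
    h.integrable_norm_dualStep_sub_sq hG hreg hσ hSb
      (fun i t => (AlgorithmParameters.σ_le_σmax i t).trans (hσS t)) hR ls t (hl t)
  have hi₁ : Integrable (fun ω => f₁ ((μ t ω, l t ω), ξ ω)) P := by
    refine (((hC' t).1.const_mul 2).add (integrable_const (2 * (R + ‖a‖) ^ 2))).mono'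
      (hf₁m.comp ((hz.mono (ℱ.le t) le_rfl).prodMk hξm)).aestronglyMeasurable
      (Eventually.of_forall fun ω => ?_)
    rw [Real.norm_of_nonneg (sq_nonneg _)]
    simp only [Pi.add_apply]
    set y := G.meanStep s b (μ t ω) (l t ω) (μ t ω + blockScale s (ξ ω))
    have h1 : ‖y - a‖ ≤ ‖y - μ t ω‖ + (R + ‖a‖) := by
      have h2 := norm_sub_le_norm_sub_add_norm_sub y (μ t ω) a
      have h3 := norm_sub_le (μ t ω) a
      linarith [hR t ω]
    have h2 := pow_le_pow_left₀ (norm_nonneg _) h1 2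
    nlinarith only [h2, sq_nonneg (‖y - μ t ω‖ - (R + ‖a‖))]
  have hle₁ : ∀ ω, ‖μ (t + 1) ω - a‖ ^ 2 ≤ f₁ ((μ t ω, l t ω), ξ ω) := fun ω =>
    pow_le_pow_left₀ (norm_nonneg _) (h.norm_mean_sub_le hG hσ ha t ω) 2
  have hle₂ : ∀ ω, ‖l (t + 1) ω - ls‖ ^ 2 ≤ f₂ ((μ t ω, l t ω), ξ ω) := fun ω =>
    pow_le_pow_left₀ (norm_nonneg _) (h.norm_multiplier_sub_le hσ hls t ω) 2
  have hμi : Integrable (fun ω => ‖μ (t + 1) ω - a‖ ^ 2) P := by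
    refine hi₁.mono' ?_ (Eventually.of_forall fun ω => ?_)
    · exact ((measurable_norm.comp ((((h.measurable_μ (t + 1)).mono (ℱ.le _) le_rfl)).sub_const
        a)).pow_const 2).aestronglyMeasurable
    · rw [Real.norm_of_nonneg (sq_nonneg _)]; exact hle₁ ω
  have hli : Integrable (fun ω => ‖l (t + 1) ω - ls‖ ^ 2) P := by
    refine hi₂.mono' ?_ (Eventually.of_forall fun ω => ?_)
    · exact ((measurable_norm.comp ((((h.measurable_l (t + 1)).mono (ℱ.le _) le_rfl)).sub_const
        ls)).pow_const 2).aestronglyMeasurable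
    · rw [Real.norm_of_nonneg (sq_nonneg _)]; exact hle₂ ω
  obtain ⟨hind, hlaw⟩ := h.indep_noise hσ t
  -- Conditioning freezes mean and multiplier and integrates out the noise of the unprojected step;
  -- projecting only decreases the distances.
  have hE₁ := condExp_eq_integral_of_indep (ℱ.le t) hz hξm hind hlaw hf₁m hi₁
  have hE₂ := condExp_eq_integral_of_indep (ℱ.le t) hz hξm hind hlaw hf₂m hi₂
  have hm₁ := condExp_mono (m := ℱ t) hμi hi₁ (Eventually.of_forall hle₁)
  have hm₂ := condExp_mono (m := ℱ t) hli hi₂ (Eventually.of_forall hle₂)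
  constructor
  · filter_upwards [hE₁, hE₂, hm₁, hm₂, condExp_add hμi hli (ℱ t)] with ω e₁ e₂ m₁ m₂ hadd
    have key := (hC s b _ _ _ _ _ (μ t ω) (hμ ω) (l t ω) (hlt ω) (hstep t) (hσS t) (hR t ω)).1
    change (P[(fun ω => ‖μ (t + 1) ω - a‖ ^ 2) + (fun ω => ‖l (t + 1) ω - ls‖ ^ 2) | ℱ t]) ω ≤ _
    rw [hadd, Pi.add_apply]
    rw [e₁] at m₁
    rw [e₂] at m₂
    exact (add_le_add m₁ m₂).trans key
  · filter_upwards [hE₁, hm₁] with ω e₁ m₁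
    have key := (hC s b _ _ _ _ _ (μ t ω) (hμ ω) (l t ω) (hlt ω) (hstep t) (hσS t) (hR t ω)).2
    rw [e₁] at m₁
    exact m₁.trans key

/-- Convergence of the means. -/
theorem ae_tendsto_mean [Nonempty (Fin N)] (h : IsPayoffBasedRun G S μ₀ l₀ P ℱ μ l x)
    (hG : G.IsConvexGame) (hreg : G.IsRegular) (hgrowth : G.HasQuadraticGrowth)
    (hS : S.Admissible) {a : JointSpace d} (ha : a ∈ G.jointActions)
    {ls : EuclideanSpace ℝ (Fin n)} (hls : ls ∈ nonnegOrthant n) {D : JointSpace d → ℝ}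
    (hDc : Continuous D) (hD0 : ∀ b ∈ G.jointActions, 0 ≤ D b)
    (hDpos : ∀ ε > 0, ∃ δ > 0, ∀ b ∈ G.jointActions, ε ≤ ‖b - a‖ ^ 2 → δ ≤ D b)
    (hD : ∀ b ∈ G.jointActions, ∀ l ∈ nonnegOrthant n,
      D b ≤ ∑ i, inner ℝ (G.extendedBlock i b l) (b i - a i) - inner ℝ (G.g b) (l - ls)) :
    ∀ᵐ ω ∂P, Tendsto (fun t => μ t ω) atTop (𝓝 a) := by
  obtain ⟨c, Sb, hSb, hσS, hstep, hpert, -, hbm0⟩ := hS.exists_isStepBound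
  have hσ := hS.σ_pos
  obtain ⟨R, hR0, hR⟩ := h.exists_norm_le hG
  have hl := h.integrable_norm_multiplier_sq hG hreg hσ hSb
    (fun i t => (AlgorithmParameters.σ_le_σmax i t).trans (hσS t)) hR
  obtain ⟨C, hC0, hC⟩ := h.exists_condExp_drift_le hG hreg hgrowth hσ hSb hσS hstep hR0 hR hl ha
    hls hD
  obtain ⟨C', hC'0, hC'⟩ := h.exists_integral_norm_meanStep_sub_sq_le hG hreg hgrowth hσ hSb hσS
    hstep hR0 hR hl
  have hpert0 : ∀ t, (c * S.γmax (t + 1)) ^ 2 ≤ S.perturbation c t := fun t => by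
    have h1 := (hstep t).bm_nonneg.trans ((hstep t).bm_le₀.trans (hstep t).le_B₀)
    have h2 := mul_nonneg h1 (hstep t).sb_nonneg
    have h3 := (hstep t).bm_le₀.trans (hstep t).le_B₀
    rw [AlgorithmParameters.perturbation]
    nlinarith only [h2, h3, sq_nonneg (S.βmax (t + 1))]
  have hpertnn : ∀ t, 0 ≤ S.perturbation c t := fun t => (sq_nonneg _).trans (hpert0 t)
  have hbm : ∀ t, 0 ≤ S.βmin (t + 1) := fun t => (hstep t).bm_nonneg
  have hμA := h.mem_jointActions
  have hlO := h.mem_nonnegOrthant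
  -- the Lyapunov function is almost surely bounded
  set V : ℕ → Ω → ℝ := fun t ω => ‖μ (t + 1) ω - a‖ ^ 2 + ‖l (t + 1) ω - ls‖ ^ 2 with hV
  set U : ℕ → Ω → ℝ := fun t ω => 2 * S.βmin (t + 2) * D (μ (t + 1) ω) with hU
  set u : ℕ → Ω → ℝ := fun t ω => ‖μ (t + 1) ω - a‖ ^ 2 with hu
  have hum : ∀ t, StronglyMeasurable[ℱ (t + 1)] (u t) := fun t =>
    ((measurable_norm.comp ((h.measurable_μ (t + 1)).sub_const a)).pow_const 2).stronglyMeasurable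
  have hub : ∀ t ω, ‖u t ω‖ ≤ (R + ‖a‖) ^ 2 := fun t ω => by
    rw [Real.norm_of_nonneg (sq_nonneg _)]
    exact pow_le_pow_left₀ (norm_nonneg _)
      ((norm_sub_le _ _).trans (add_le_add_left (hR (t + 1) ω) _)) 2
  have huL : ∀ t, MemLp (u t) 2 P := fun t =>
    MemLp.of_bound ((hum t).mono (ℱ.le _)).aestronglyMeasurable _
      (Eventually.of_forall (hub t))
  have hlsm : ∀ t, StronglyMeasurable[ℱ (t + 1)] (fun ω => ‖l (t + 1) ω - ls‖ ^ 2) := fun t =>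
    ((measurable_norm.comp ((h.measurable_l (t + 1)).sub_const ls)).pow_const 2).stronglyMeasurable
  have hlsi : ∀ t, Integrable (fun ω => ‖l (t + 1) ω - ls‖ ^ 2) P := fun t => by
    refine (((hl (t + 1)).const_mul 2).add (integrable_const (2 * ‖ls‖ ^ 2))).mono'
      ((hlsm t).mono (ℱ.le _)).aestronglyMeasurable (Eventually.of_forall fun ω => ?_)
    rw [Real.norm_of_nonneg (sq_nonneg _), Pi.add_apply]
    have := pow_le_pow_left₀ (norm_nonneg _) (norm_sub_le (l (t + 1) ω) ls) 2
    nlinarith only [this, sq_nonneg (‖l (t + 1) ω‖ - ‖ls‖)]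
  have hVi : ∀ t, Integrable (V t) P := fun t => ((huL t).integrable one_le_two).add (hlsi t)
  have hUm : ∀ t, StronglyMeasurable[ℱ (t + 1)] (U t) := fun t =>
    ((hDc.measurable.comp (h.measurable_μ (t + 1))).const_mul _).stronglyMeasurable
  obtain ⟨KD, hKD⟩ := (CoupledGame.isCompact_jointActions hG).exists_bound_of_continuousOn
    hDc.continuousOn
  have hUi : ∀ t, Integrable (U t) P := fun t => by
    refine Integrable.const_mul ((memLp_top_of_bound ?_ KD (Eventually.of_forall fun ω =>
      hKD _ (hμA t ω))).integrable le_top) _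
    exact (hDc.measurable.comp ((h.measurable_μ (t + 1)).mono (ℱ.le _)
      le_rfl)).aestronglyMeasurable
  have hU0 : ∀ t ω, 0 ≤ U t ω := fun t ω =>
    mul_nonneg (mul_nonneg two_pos.le (hbm (t + 1))) (hD0 _ (hμA t ω))
  -- The initial vectors may lie outside the action sets and the orthant, where the drift estimate
  -- is not available, so the process starts at time `1` with the shifted filtration.
  obtain ⟨⟨KE, hKE⟩, hRS⟩ := robbinsSiegmund (ℱ := shiftFiltration ℱ) (V := V) (U := U)
    (e := fun t => C * S.perturbation c (t + 1)) (fun t => (hum t).add (hlsm t)) hUm hVi hUi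
    (fun t ω => by positivity) hU0 (fun t => mul_nonneg hC0 (hpertnn _))
    (((summable_nat_add_iff 1).2 hpert).mul_left C) fun t => (hC (t + 1) (hμA t) (hlO t)).1
  -- the mean square increments of the distance to the equilibrium are summable
  have hEl : ∀ t, 1 + ∫ ω, ‖l (t + 1) ω‖ ^ 2 ∂P ≤ (2 + 2 * ‖ls‖ ^ 2) * (1 + KE) := fun t => by
    have h1 : ∫ ω, (1 + ‖l (t + 1) ω‖ ^ 2) ∂P ≤ ∫ ω, (2 + 2 * ‖ls‖ ^ 2) * (1 + V t ω) ∂P :=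
      integral_mono ((integrable_const 1).add (hl (t + 1)))
        (((integrable_const 1).add (hVi t)).const_mul _)
        fun ω => CoupledGame.one_add_norm_sq_le _ _ (sq_nonneg _)
    rw [integral_add (integrable_const 1) (hl (t + 1)), integral_const_mul,
      integral_add (integrable_const 1) (hVi t)] at h1
    simp only [integral_const, probReal_univ, one_smul] at h1
    refine h1.trans (mul_le_mul_of_nonneg_left ?_ (by positivity))
    linarith [hKE t]
  -- The first factor comes from `|u (t + 1) - u t| ≤ 2 * (R + ‖a‖) * ‖displacement‖`, the second
  -- from the displacement bound with the uniform second moment of the multiplier.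
  set Q : ℝ := 4 * (R + ‖a‖) ^ 2 * (C' * ((2 + 2 * ‖ls‖ ^ 2) * (1 + KE))) with hQ
  have hinc : ∀ t, ∫ ω, (u (t + 1) ω - u t ω) ^ 2 ∂P ≤ Q * S.perturbation c (t + 1) := fun t => by
    have hpt : ∀ ω, (u (t + 1) ω - u t ω) ^ 2 ≤ 4 * (R + ‖a‖) ^ 2 * ‖G.meanStep
        (fun i => S.σ i (t + 1)) (fun i => S.γ i (t + 1 + 1) * S.σ i (t + 1 + 1) ^ 2)
        (μ (t + 1) ω) (l (t + 1) ω) (μ (t + 1) ω + blockScale (fun i => S.σ i (t + 1))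
          (noise S μ x (t + 1) ω)) - μ (t + 1) ω‖ ^ 2 := fun ω => by
      -- The current mean already lies in the action sets, so it may serve as the reference point:
      -- the projected displacement is at most the unprojected one.
      have h1 := h.norm_mean_sub_le hG hσ (hμA t ω) (t + 1) ω
      have h2 : |‖μ (t + 1 + 1) ω - a‖ - ‖μ (t + 1) ω - a‖| ≤ ‖μ (t + 1 + 1) ω - μ (t + 1) ω‖ := by
        simpa using abs_norm_sub_norm_le (μ (t + 1 + 1) ω - a) (μ (t + 1) ω - a)
      have h3 : ‖μ (t + 1 + 1) ω - a‖ + ‖μ (t + 1) ω - a‖ ≤ 2 * (R + ‖a‖) := by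
        have := norm_sub_le (μ (t + 1 + 1) ω) a
        have := norm_sub_le (μ (t + 1) ω) a
        linarith [hR (t + 1 + 1) ω, hR (t + 1) ω]
      have h4 : |u (t + 1) ω - u t ω| ≤ 2 * (R + ‖a‖) * ‖G.meanStep
        (fun i => S.σ i (t + 1)) (fun i => S.γ i (t + 1 + 1) * S.σ i (t + 1 + 1) ^ 2)
        (μ (t + 1) ω) (l (t + 1) ω) (μ (t + 1) ω + blockScale (fun i => S.σ i (t + 1))
          (noise S μ x (t + 1) ω)) - μ (t + 1) ω‖ := by
        simp only [hu]
        rw [sq_sub_sq, abs_mul, abs_of_nonneg (by positivity)]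
        exact mul_le_mul h3 (h2.trans h1) (abs_nonneg _) (by positivity)
      rw [← sq_abs]
      exact (pow_le_pow_left₀ (abs_nonneg _) h4 2).trans (le_of_eq (by ring))
    have h1 := (integral_mono ((huL (t + 1)).sub (huL t)).integrable_sq
      ((hC' (t + 1)).1.const_mul _) hpt)
    rw [integral_const_mul] at h1
    refine h1.trans ?_
    have h2 : C' * (c * S.γmax (t + 1 + 1)) ^ 2 * (1 + ∫ ω, ‖l (t + 1) ω‖ ^ 2 ∂P) ≤
        C' * S.perturbation c (t + 1) * ((2 + 2 * ‖ls‖ ^ 2) * (1 + KE)) := by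
      have h3 := hpert0 (t + 1)
      have h4 := hEl t
      have h5 := hpertnn (t + 1)
      have h6 : 0 ≤ ∫ ω, ‖l (t + 1) ω‖ ^ 2 ∂P := integral_nonneg fun ω => sq_nonneg _
      gcongr
    refine (mul_le_mul_of_nonneg_left ((hC' (t + 1)).2.trans h2) (by positivity)).trans
      (le_of_eq ?_)
    rw [hQ]; ring
  have hmart := exists_tendsto_sum_sub_condExp (ℱ := shiftFiltration ℱ) hum huL hinc
    (((summable_nat_add_iff 1).2 hpert).mul_left Q)
  have hdrift : ∀ᵐ ω ∂P, ∀ t, (P[u (t + 1) | ℱ (t + 1)]) ω ≤ u t ω +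
      C * (S.βmin (t + 1 + 1) + S.perturbation c (t + 1)) * (1 + ‖l (t + 1) ω‖ ^ 2) :=
    ae_all_iff.2 fun t => (hC (t + 1) (hμA t) (hlO t)).2
  filter_upwards [hRS, hmart, hdrift] with ω ⟨⟨K, hK⟩, hUs⟩ ⟨y, hy⟩ hdr
  set KL : ℝ := (2 + 2 * ‖ls‖ ^ 2) * (1 + K) with hKL
  have hlK : ∀ t, 1 + ‖l (t + 1) ω‖ ^ 2 ≤ KL := fun t =>
    (CoupledGame.one_add_norm_sq_le _ ls (sq_nonneg ‖μ (t + 1) ω - a‖)).trans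
      (mul_le_mul_of_nonneg_left (by linarith [hK t]) (by positivity))
  have hKL0 : 0 ≤ KL := le_trans (by positivity) (hlK 0)
  -- On a path with bounded multiplier, the drift has the form of the deterministic criterion, `w`
  -- collecting the summable perturbations and the martingale differences.
  have hlim : Tendsto (fun t => u t ω) atTop (𝓝 0) := by
    refine tendsto_zero_of_summable_of_drift (b := fun t => S.βmin (t + 1 + 1)) (C := C * KL)
      (w := fun t => C * KL * S.perturbation c (t + 1) +
        (u (t + 1) ω - (P[u (t + 1) | ℱ (t + 1)]) ω)) (mul_nonneg hC0 hKL0)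
      (fun t => sq_nonneg _) (fun t => hbm (t + 1)) (fun t => ?_) ?_
      (hbm0.comp (tendsto_add_atTop_nat 1)) ?_ fun ε hε => ?_
    · have h1 := hdr t
      have h2 : C * (S.βmin (t + 1 + 1) + S.perturbation c (t + 1)) * (1 + ‖l (t + 1) ω‖ ^ 2) ≤
          C * (S.βmin (t + 1 + 1) + S.perturbation c (t + 1)) * KL :=
        mul_le_mul_of_nonneg_left (hlK t)
          (mul_nonneg hC0 (add_nonneg (hbm (t + 1)) (hpertnn (t + 1))))
      linarith only [h1, h2]
    · have h1 := (((summable_nat_add_iff 1).2 hpert).mul_left (C * KL)).hasSum.tendsto_sum_nat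
      refine ⟨_, (h1.add hy).congr fun T => ?_⟩
      rw [← Finset.sum_add_distrib]
      rfl
    · have h1 := (tendsto_add_atTop_iff_nat 2).2 hS.sum_βmin
      have h2 : ∀ T, ∑ t ∈ Finset.range T, S.βmin (t + 1 + 1) =
          ∑ t ∈ Finset.range (T + 2), S.βmin t - (S.βmin 1 + S.βmin 0) := fun T => by
        rw [Finset.sum_range_succ', Finset.sum_range_succ']; ring
      simp_rw [h2]
      exact tendsto_atTop_add_const_right _ _ h1
    -- Where `u ≥ ε` the merit function is at least `δ`, so the `βmin` spent there is at most `∑ U /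
    -- (2 * δ)`.
    · obtain ⟨δ, hδ, hδD⟩ := hDpos ε hε
      refine Summable.of_nonneg_of_le (fun t => ?_) (fun t => ?_) (hUs.mul_left (1 / (2 * δ)))
      · split_ifs
        · exact hbm (t + 1)
        · exact le_rfl
      · split_ifs with hε'
        · have h1 := hδD _ (hμA t ω) hε'
          have h2 := mul_le_mul_of_nonneg_left h1 (hbm (t + 1))
          rw [one_div, inv_mul_eq_div, le_div_iff₀ (by positivity)]
          simp only [hU]
          linarith only [h2]
        · exact mul_nonneg (by positivity) (hU0 t ω)
  have h1 : Tendsto (fun t => ‖μ (t + 1) ω - a‖) atTop (𝓝 0) := by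
    have h2 := hlim.sqrt
    rw [Real.sqrt_zero] at h2
    exact h2.congr fun t => Real.sqrt_sq (norm_nonneg _)
  exact (tendsto_add_atTop_iff_nat 1).1 (tendsto_iff_norm_sub_tendsto_zero.2 h1)

/-- If the means converge almost surely, the states converge in probability. -/
theorem tendstoInMeasure_state [Nonempty (Fin N)] (h : IsPayoffBasedRun G S μ₀ l₀ P ℱ μ l x)
    (hS : S.Admissible) {a : JointSpace d}
    (hμ : ∀ᵐ ω ∂P, Tendsto (fun t => μ t ω) atTop (𝓝 a)) :
    TendstoInMeasure P x atTop (fun _ => a) := by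
  obtain ⟨c, Sb, hSb, hσS, hstep, -, hσ0, -⟩ := hS.exists_isStepBound
  have hσ := hS.σ_pos
  have hμm : ∀ t, Measurable (μ t) := fun t => (h.measurable_μ t).mono (ℱ.le t) le_rfl
  refine tendstoInMeasure_of_sub
    (tendstoInMeasure_of_tendsto_ae (fun t => (hμm t).aestronglyMeasurable) hμ) ?_
  refine tendstoInMeasure_of_tendsto_eLpNorm one_ne_zero
    (fun t => ((h.measurable_x t).sub (hμm t)).aestronglyMeasurable) aestronglyMeasurable_const ?_
  -- The distance from state to mean is at most `σmax` times the norm of the noise, whose law does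
  -- not depend on `t`.
  have hb : ∀ t, eLpNorm ((fun ω => x t ω - μ t ω) - fun _ => 0) 1 P ≤
      ENNReal.ofReal (S.σmax t * gaussianMoment (JointSpace d) 1) := fun t => by
    have hi := h.integrable_mul_noise hσ t (φ := fun _ => S.σmax t) measurable_const
      (integrable_const _) 1
    rw [eLpNorm_one_eq_lintegral_enorm]
    calc ∫⁻ ω, ‖((fun ω => x t ω - μ t ω) - fun _ => 0 : Ω → JointSpace d) ω‖ₑ ∂P
        ≤ ∫⁻ ω, ENNReal.ofReal (S.σmax t * (1 + ‖noise S μ x t ω‖) ^ 1) ∂P := by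
          refine lintegral_mono fun ω => ?_
          rw [Pi.sub_apply, sub_zero, ← ofReal_norm]
          refine ENNReal.ofReal_le_ofReal ?_
          nth_rewrite 1 [eq_add_blockScale_noise (μ := μ) (x := x) hσ t ω]
          rw [add_sub_cancel_left]
          refine (norm_blockScale_le (fun i => (hσ i t).le) (hstep t).s_le (hstep t).sb_nonneg
            _).trans ?_
          have := (hstep t).sb_nonneg
          gcongr
          linarith
      _ = ENNReal.ofReal (∫ ω, S.σmax t * (1 + ‖noise S μ x t ω‖) ^ 1 ∂P) := by
          rw [ofReal_integral_eq_lintegral_ofReal hi.1 (Eventually.of_forall fun ω =>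
            mul_nonneg (hstep t).sb_nonneg (by positivity))]
      _ = _ := by rw [hi.2]; simp
  refine tendsto_of_tendsto_of_tendsto_of_le_of_le tendsto_const_nhds ?_ (fun _ => zero_le) hb
  have h1 := ENNReal.tendsto_ofReal (hσ0.mul_const (gaussianMoment (JointSpace d) 1))
  simpa using h1

end IsPayoffBasedRun

end

theorem theorem1 {N n : ℕ} {d : Fin N → ℕ} (G : CoupledGame N n d)
    (hconv : G.IsConvexGame) (hreg : G.IsRegular) (hslater : G.Slater)
    (hgrowth : G.HasQuadraticGrowth) (hpot : G.HasStrictlyConvexPotential) :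
    ∃ a : JointSpace d, G.variationalEquilibria = {a} ∧ G.IsGNE a ∧
      ∀ (S : AlgorithmParameters N), S.Admissible →
      ∀ (μ₀ : JointSpace d) (l₀ : EuclideanSpace ℝ (Fin n))
        {Ω : Type*} {mΩ : MeasurableSpace Ω} (P : Measure Ω) [IsProbabilityMeasure P]
        (ℱ : Filtration ℕ mΩ) (μ : ℕ → Ω → JointSpace d)
        (l : ℕ → Ω → EuclideanSpace ℝ (Fin n)) (x : ℕ → Ω → JointSpace d),
        IsPayoffBasedRun G S μ₀ l₀ P ℱ μ l x →
          (∀ᵐ ω ∂P, Tendsto (fun t => μ t ω) atTop (𝓝 a)) ∧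
          TendstoInMeasure P x atTop (fun _ => a) := by
  obtain ⟨a, ls, D, hVE, hGNE, hls, hDc, hD0, hDpos, hD⟩ :=
    CoupledGame.exists_equilibrium_merit hconv hslater hpot
  refine ⟨a, hVE, hGNE, fun S hS μ₀ l₀ Ω mΩ P _ ℱ μ l x h => ?_⟩
  -- Without regular players the parameter conditions say nothing about the dual step sizes beyond
  -- divergence of their sum, but the joint space is a single point.
  rcases isEmpty_or_nonempty (Fin N) with hN | hN
  · have hsub : Subsingleton (JointSpace d) := ⟨fun p q => PiLp.ext fun i => hN.elim i⟩
    have hx : x = fun _ _ => a := by funext t ω; exact Subsingleton.elim _ _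
    refine ⟨Eventually.of_forall fun ω => ?_, ?_⟩
    · exact tendsto_const_nhds.congr fun t => Subsingleton.elim a _
    · rw [hx]
      exact tendstoInMeasure_of_tendsto_ae (fun _ => aestronglyMeasurable_const)
        (Eventually.of_forall fun _ => tendsto_const_nhds)
  · have hμ := h.ae_tendsto_mean hconv hreg hgrowth hS hGNE.1.1 hls hDc hD0 hDpos hD
    exact ⟨hμ, h.tendstoInMeasure_state hS hμ⟩
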